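/- **Setting.** An instance of the scheduling problem $1|\mathrm{prec}|\sum C_i$ consists of a set $V$ of $n$ jobs, $4\mid n$, a partial order $<$ on $V$ and processing times $t(v)\in[0,\infty)$. An ordering is a bijection $\sigma:V\to\{1,\dots,n\}$ with $\sigma(u)<\sigma(v)$ whenever $u<v$; its cost is $\sum_{v}\sum_{u:\sigma(u)\le\sigma(v)}t(u)$. Let $A,B,C,D$ be the four consecutive quarters of $\{1,\dots,n\}$. A *branch* consists of such an instance together with the following data. * Jobs $v_{begin},v_{end}$ with $v_{begin}<v$ for all $v\ne v_{begin}$ and $v<v_{end}$ for all $v\neq v_{end}$, and a matching $\mathcal M$ in the comparability graph of $<$ such that, with $M=V(\mathcal M)\cup\{v_{begin},v_{end}\}$, no two jobs of $I_1=V\setminus M$ are comparable. * A partition $M=M^A\cup M^B\cup M^C\cup M^D$ with $v_{begin}\in M^A$ and $v_{end}\in M^D$. Put $W^{AB}_{half}=\{v\in I_1:\exists w\in M^A\cup M^B,\ v<w\}$ and $W^{CD}_{half}=\{v\in I_1:\exists w\in M^C\cup M^D,\ w<v\}$. * An assignment of each job of $W^{AB}_{half}$ to $A$ or $B$ and of each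 job of $W^{CD}_{half}$ to $C$ or $D$, such that for $u<v$ in $M\cup W^{AB}_{half}\cup W^{CD}_{half}$ the quarter of $u$ is not later than that of $v$. * Integers $0\le p^B,p^C\le n/4$. Let $I_2=I_1\setminus(W^{AB}_{half}\cup W^{CD}_{half})$, $P^{\neg A}=\{v\in I_2:\exists w\in M^B,\ w<v\}$, $P^A=I_2\setminus P^{\neg A}$, $P^{\neg D}=\{v\in I_2:\exists w\in M^C,\ v<w\}$, $P^D=I_2\setminus P^{\neg D}$. The *orderings of the branch* are the orderings $\sigma$ that place every job of $M\cup W^{AB}_{half}\cup W^{CD}_{half}$ in its assigned quarter and satisfy $|\sigma(P^{\neg A})\cap B|=p^B$ and $|\sigma(P^{\neg D})\cap C|=p^C$. To *solve* the branch is to output an ordering of the branch of minimum cost among the orderings of the branch, or to report that the branch contains no ordering. **Statement.** There are an algorithm and a constant $c$ such that the following holds. Let $\varepsilon_1,\varepsilon_2,\varepsilon_3,\varepsilon_4>0$ satisfy $2\varepsilon_1+2\varepsilon_2+\varepsilon_4<1/4$, and consider a branch on $n$ jobs with 1. $|\mathcal M|<\varepsilon_1 n$; 2. $|W^{AB}_{half}|\le\varepsilon_2n$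 and $|W^{CD}_{half}|\le\varepsilon_2 n$; 3. $|P^A|,|P^{\neg A}|,|P^{\neg D}|,|P^D|\le(1/2+\varepsilon_3)n$; 4. $p^B,p^C\ge(1/4-\varepsilon_4)n$, and $p^A=|\sigma(P^A)\cap A|\ge(1/4-\varepsilon_4)n$ and $p^D=|\sigma(P^D)\cap D|\ge(1/4-\varepsilon_4)n$ for every ordering $\sigma$ of the branch. Then the algorithm, given the branch, solves it in time at most $$\binom{n}{\lfloor\varepsilon_4n\rfloor}^2\,2^{(3/4+\varepsilon_3)n}\,n^{c}.$$ Here time is measured on a random access machine with integer and real memory, where integer operations are charged by binary length and real numbers can only be copied, added and compared, at unit cost. -/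

import Mathlib

/-! ## A random access machine with integer and real memory

Programs are structured RAM programs.  The memory consists of arrays indexed by natural numbers;
an array is named by a number fixed in the program text, so a program uses finitely many arrays.
Integer arrays hold natural numbers, real arrays hold real numbers.  Integers are charged
according to their binary length (logarithmic cost; arithmetic at schoolbook cost).  Reals can only
be copied, added and compared, each at unit cost, and there is no conversion between
reals and integers. -/

namespace RealRAM

/-- The memory: `nat a i` is cell `i` of the integer array named `a`, and `real a i` is
cell `i` of the real array named `a`. -/
structure State where
  nat : ℕ → ℕ → ℕ
  real : ℕ → ℕ → ℝ

/-- Integer operations (`sub` is truncated subtraction, `div` and `mod` are division with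
remainder). -/
inductive BinOp
  | add
  | sub
  | mul
  | div
  | mod

def BinOp.eval : BinOp → ℕ → ℕ → ℕ
  | .add, x, y => x + y
  | .sub, x, y => x - y
  | .mul, x, y => x * y
  | .div, x, y => x / y
  | .mod, x, y => x % y

/-- Integer expressions; `get a e` reads cell `e` of the integer array `a`. -/
inductive NExpr
  | lit (k : ℕ)
  | get (a : ℕ) (e : NExpr)
  | op (o : BinOp) (e₁ e₂ : NExpr)

def NExpr.eval (s : State) : NExpr → ℕ
  | .lit k => k
  | .get a e => s.nat a (e.eval s)
  | .op o e₁ e₂ => o.eval (e₁.eval s) (e₂.eval s)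

/-- Cost of evaluating an integer expression; `Nat.size` is the binary length. -/
def NExpr.cost (s : State) : NExpr → ℕ
  | .lit k => 1 + k.size
  | .get a e => e.cost s + 1 + (s.nat a (e.eval s)).size
  | .op _ e₁ e₂ =>
      e₁.cost s + e₂.cost s + (1 + (e₁.eval s).size) * (1 + (e₂.eval s).size)

/-- Real expressions; `get a e` reads cell `e` of the real array `a`. -/
inductive RExpr
  | zero
  | get (a : ℕ) (e : NExpr)
  | add (r₁ r₂ : RExpr)

def RExpr.eval (s : State) : RExpr → ℝ
  | .zero => 0
  | .get a e => s.real a (e.eval s)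
  | .add r₁ r₂ => r₁.eval s + r₂.eval s

def RExpr.cost (s : State) : RExpr → ℕ
  | .zero => 1
  | .get _ e => e.cost s + 1
  | .add r₁ r₂ => r₁.cost s + r₂.cost s + 1

/-- Tests: comparison of integers, comparison of reals, negation. -/
inductive Test
  | natLE (e₁ e₂ : NExpr)
  | realLE (r₁ r₂ : RExpr)
  | neg (b : Test)

def Test.Holds (s : State) : Test → Prop
  | .natLE e₁ e₂ => e₁.eval s ≤ e₂.eval s
  | .realLE r₁ r₂ => r₁.eval s ≤ r₂.eval s
  | .neg b => ¬ b.Holds s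

def Test.cost (s : State) : Test → ℕ
  | .natLE e₁ e₂ => e₁.cost s + e₂.cost s + 1
  | .realLE r₁ r₂ => r₁.cost s + r₂.cost s + 1
  | .neg b => b.cost s + 1

/-- Programs: assignment `a[e] := e'` in an integer array, assignment `a[e] := r` in a real array,
sequential composition, branching, and while loops. -/
inductive Program
  | skip
  | setNat (a : ℕ) (e e' : NExpr)
  | setReal (a : ℕ) (e : NExpr) (r : RExpr)
  | seq (p q : Program)
  | branch (b : Test) (p q : Program)
  | loop (b : Test) (p : Program)

def State.writeNat (s : State) (a i x : ℕ) : State :=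
  { s with nat := Function.update s.nat a (Function.update (s.nat a) i x) }

def State.writeReal (s : State) (a i : ℕ) (x : ℝ) : State :=
  { s with real := Function.update s.real a (Function.update (s.real a) i x) }

/-- `Runs p s s' k`: started in memory `s`, the program `p` halts, with memory `s'`, and its
running time is `k`. -/
inductive Runs : Program → State → State → ℕ → Prop
  | skip (s : State) : Runs .skip s s 1
  | setNat (s : State) (a : ℕ) (e e' : NExpr) :
      Runs (.setNat a e e') s (s.writeNat a (e.eval s) (e'.eval s)) (e.cost s + e'.cost s + 1)
  | setReal (s : State) (a : ℕ) (e : NExpr) (r : RExpr) :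
      Runs (.setReal a e r) s (s.writeReal a (e.eval s) (r.eval s)) (e.cost s + r.cost s + 1)
  | seq {p q : Program} {s s₁ s₂ : State} {k₁ k₂ : ℕ} :
      Runs p s s₁ k₁ → Runs q s₁ s₂ k₂ → Runs (.seq p q) s s₂ (k₁ + k₂)
  | branchTrue {b : Test} {p q : Program} {s s₁ : State} {k : ℕ} :
      b.Holds s → Runs p s s₁ k → Runs (.branch b p q) s s₁ (b.cost s + k + 1)
  | branchFalse {b : Test} {p q : Program} {s s₁ : State} {k : ℕ} :
      ¬ b.Holds s → Runs q s s₁ k → Runs (.branch b p q) s s₁ (b.cost s + k + 1)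
  | loopDone {b : Test} {p : Program} {s : State} :
      ¬ b.Holds s → Runs (.loop b p) s s (b.cost s + 1)
  | loopStep {b : Test} {p : Program} {s s₁ s₂ : State} {k₁ k₂ : ℕ} :
      b.Holds s → Runs p s s₁ k₁ → Runs (.loop b p) s₁ s₂ k₂ →
      Runs (.loop b p) s s₂ (b.cost s + k₁ + k₂ + 1)

end RealRAM

namespace Sched

/-! ## Instances and orderings -/

/-- An instance of the scheduling problem `1|prec|∑ C_i` with jobs `0, …, n-1`: a partial order
of precedence constraints and nonnegative processing times. -/
structure Inst (n : ℕ) where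
  ord : PartialOrder (Fin n)
  time : Fin n → ℝ
  time_nonneg : ∀ v, 0 ≤ time v

/-- `u` precedes `v`. -/
def Inst.Prec {n : ℕ} (I : Inst n) (u v : Fin n) : Prop := I.ord.lt u v

/-- The graph whose edges are the pairs of jobs bound by a precedence constraint. -/
def Inst.graph {n : ℕ} (I : Inst n) : SimpleGraph (Fin n) :=
  SimpleGraph.fromRel I.Prec

/-- Total completion time of an ordering. Positions are numbered `0, …, n-1` here. -/
def Inst.cost {n : ℕ} (I : Inst n) (σ : Equiv.Perm (Fin n)) : ℝ :=
  ∑ v, ∑ u with σ u ≤ σ v, I.time u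

/-- The ordering satisfies the precedence constraints. -/
def Inst.Respects {n : ℕ} (I : Inst n) (σ : Equiv.Perm (Fin n)) : Prop :=
  ∀ u v, I.Prec u v → σ u < σ v

/-- Position `i` (numbered from `0`) lies in the quarter `Γ` of the `n` positions. The quarters
`A`, `B`, `C`, `D` are numbered `0`, `1`, `2`, `3`. -/
def InQuarter {n : ℕ} (Γ : Fin 4) (i : Fin n) : Prop :=
  (Γ : ℕ) * n ≤ 4 * (i : ℕ) ∧ 4 * (i : ℕ) < ((Γ : ℕ) + 1) * n

/-! ## Branches -/

/-- An instance together with a first and a last job, a matching in the precedence graph, and the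
guesses that determine a branch: the quarter of every job in `M ∪ W_half` (the value of `guess` at
the other jobs has no meaning), and the numbers `pB`, `pC`. -/
structure Branch (n : ℕ) extends Inst n where
  vBegin : Fin n
  vEnd : Fin n
  matching : toInst.graph.Subgraph
  guess : Fin n → Fin 4
  pB : ℕ
  pC : ℕ

namespace Branch

variable {n : ℕ} (R : Branch n)

/-- The special jobs: the endpoints of the matching, the first job and the last job. -/
def M : Set (Fin n) := R.matching.verts ∪ {R.vBegin, R.vEnd}

/-- `M^Γ`: the special jobs guessed to lie in quarter `Γ`. -/
def MQ (Γ : Fin 4) : Set (Fin n) := {w | w ∈ R.M ∧ R.guess w = Γ}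

/-- `W_half^{AB}`: the jobs outside `M` that precede a special job of the first half. -/
def WhalfAB : Set (Fin n) := {v | v ∉ R.M ∧ ∃ w ∈ R.MQ 0 ∪ R.MQ 1, R.Prec v w}

/-- `W_half^{CD}`: the jobs outside `M` that succeed a special job of the second half. -/
def WhalfCD : Set (Fin n) := {v | v ∉ R.M ∧ ∃ w ∈ R.MQ 2 ∪ R.MQ 3, R.Prec w v}

/-- The jobs whose quarter is guessed, `M ∪ W_half`. -/
def Fixed : Set (Fin n) := R.M ∪ (R.WhalfAB ∪ R.WhalfCD)

/-- `I₂`, the remaining jobs. -/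
def I₂ : Set (Fin n) := R.Fixedᶜ

/-- `P^{¬A}`: the jobs of `I₂` that cannot be placed in quarter `A`. -/
def PnotA : Set (Fin n) := {v | v ∈ R.I₂ ∧ ∃ w ∈ R.MQ 1, R.Prec w v}

/-- `P^A = I₂ \ P^{¬A}`. -/
def PA : Set (Fin n) := R.I₂ \ R.PnotA

/-- `P^{¬D}`: the jobs of `I₂` that cannot be placed in quarter `D`. -/
def PnotD : Set (Fin n) := {v | v ∈ R.I₂ ∧ ∃ w ∈ R.MQ 2, R.Prec v w}

/-- `P^D = I₂ \ P^{¬D}`. -/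
def PD : Set (Fin n) := R.I₂ \ R.PnotD

/-- The number of jobs of `P` that the ordering `σ` places in quarter `Γ`. -/
noncomputable def count (P : Set (Fin n)) (Γ : Fin 4) (σ : Equiv.Perm (Fin n)) : ℕ :=
  {v | v ∈ P ∧ InQuarter Γ (σ v)}.ncard

/-- The data describe a branch of the algorithm. -/
structure Valid : Prop where
  /-- the number of jobs is divisible by four -/
  four_dvd : 4 ∣ n
  first : ∀ v, v ≠ R.vBegin → R.Prec R.vBegin v
  last : ∀ v, v ≠ R.vEnd → R.Prec v R.vEnd
  isMatching : R.matching.IsMatching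
  /-- no two jobs outside `M` are comparable (this is what maximality of the matching gives) -/
  covers : ∀ u v, R.Prec u v → u ∈ R.M ∨ v ∈ R.M
  guess_begin : R.guess R.vBegin = 0
  guess_end : R.guess R.vEnd = 3
  /-- the guesses do not contradict the precedence constraints -/
  guess_mono : ∀ u ∈ R.Fixed, ∀ v ∈ R.Fixed, R.Prec u v → R.guess u ≤ R.guess v
  guess_AB : ∀ v ∈ R.WhalfAB, R.guess v = 0 ∨ R.guess v = 1
  guess_CD : ∀ v ∈ R.WhalfCD, R.guess v = 2 ∨ R.guess v = 3
  pB_le : 4 * R.pB ≤ n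
  pC_le : 4 * R.pC ≤ n

/-- The orderings considered in the branch: those that satisfy the precedence constraints and
agree with all guesses. -/
structure Feasible (σ : Equiv.Perm (Fin n)) : Prop where
  respects : R.Respects σ
  quarter : ∀ v ∈ R.Fixed, InQuarter (R.guess v) (σ v)
  pB_eq : count R.PnotA 1 σ = R.pB
  pC_eq : count R.PnotD 2 σ = R.pC

/-- An optimal solution in the branch. -/
def Optimal (σ : Equiv.Perm (Fin n)) : Prop :=
  R.Feasible σ ∧ ∀ τ, R.Feasible τ → R.cost σ ≤ R.cost τ

open Classical in
/-- The initial memory. Integer array `0` holds `n, pB, pC`, array `1` the `n × n` matrix of the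
relation `u < v`, array `2` the indicator of `M`, array `3` the guessed quarters. Real array `0`
holds the processing times. All other cells are `0`. -/
noncomputable def input : RealRAM.State where
  nat a i :=
    match a with
    | 0 => if i = 0 then n else if i = 1 then R.pB else if i = 2 then R.pC else 0
    | 1 => if ∃ u v : Fin n, i = (u : ℕ) * n + (v : ℕ) ∧ R.Prec u v then 1 else 0
    | 2 => if ∃ v ∈ R.M, i = (v : ℕ) then 1 else 0
    | 3 => if h : i < n then (R.guess ⟨i, h⟩ : ℕ) else 0
    | _ => 0
  real a i :=
    match a with
    | 0 => if h : i < n then R.time ⟨i, h⟩ else 0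
    | _ => 0

/-- The final memory answers the branch: cell `0` of integer array `4` tells whether
the branch contains an ordering, and if it does, then integer array `5` lists, job by job, the
positions of an optimal one. -/
def Answers (s : RealRAM.State) : Prop :=
  (s.nat 4 0 = 0 ∧ ¬ ∃ σ, R.Feasible σ) ∨
  (s.nat 4 0 = 1 ∧ ∃ σ, R.Optimal σ ∧ ∀ v : Fin n, s.nat 5 v = (σ v : ℕ))

end Branch

end Sched

/-! Call the jobs of I₂ free, and let `na v`, `nd v` be 1 when v lies in P^{¬A}, P^{¬D}, and 0
otherwise. A free job is exceptional if it has `na = 0` and lies in B, or `nd = 0` and lies in C.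
Exactly p^B of the n/4 places of B go to jobs of P^{¬A}, so at most n/4 − p^B ≤ ε₄n exceptional jobs
fit into B, and similarly for C. The sets X and Z of exceptional jobs in B and in C can therefore be
enumerated at the price of the squared binomial coefficient, up to a polynomial factor. Once X and Z
are fixed, any other free job is placed by its half alone: a job of type (na, nd) = (i, j) goes to
quarter i in the first half and to quarter 3 − j in the second, where A, B, C, D are numbered 0, 1,
2, 3.

The four types are thus the edges of the 4-cycle A–D–B–C–A: (0,0) joins A and D, (1,0) joins B and
D, (1,1) joins B and C, (0,1) joins A and C. Opposite edges have no quarter in common. After the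
halves have been chosen for the jobs of two opposite types, the other two types influence disjoint
pairs of quarters and can be optimised independently, so that their numbers of choices add instead
of multiplying (`part_union`, `tripleOk_iff`, `tripleVal_eq`). The smaller opposite pair is taken as
the outer choice. It contains at most n/2 jobs; as two adjacent types together form one of P^A,
P^{¬A}, P^{¬D}, P^D, with at most (1/2+ε₃)n jobs, the outer pair and one inner type contain at most
n/4 + (1/2+ε₃)n jobs (`oneCard_search_le`). This is the exponent of 2.

The cost equals ∑ (n − σ(v)) t(v) with positions numbered from 0, so it splits over the quarters.
The best order of a given set inside a given quarter is found by dynamic programming over subsets,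
removing the last job (`dpProg_exec` fills the table, `dp_le` shows optimality, `Rebuilt.step`
recovers an ordering). Tables are needed only for sets that can occur as subsets of a quarter:
guessed jobs, of which there are at most n/4 + 2, non-exceptional free jobs, and few exceptional
ones. These families fit into the same bound (`length_families`) and contain every set that the
search looks up (`part_mem_family`).

Precedences between different quarters need not be tested: one end of every comparable pair lies in
M, and the definitions of W_half, P^{¬A} and P^{¬D} ensure that no colouring under consideration
reverses a pair (`Coherent.col_le_col`).

The rest implements this as an explicit program. The predicate `Exec` counts steps and bounds all
stored integers by 4n + 8 bits, so that each step has polynomial cost, which `time_le` absorbs into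
the factor n^c. -/

namespace RealRAM

/-! ## Cost bounds for bounded memories -/

/-- All integer cells are below `2 ^ B`. -/
def Bdd (B : ℕ) (s : State) : Prop := ∀ a i, s.nat a i < 2 ^ B

/-- Depends on the program text only. It is additive because the length of a product is at most the
sum of the lengths; a memory access needs only one further unit because a stored integer has at most
B bits. -/
def NExpr.weight : NExpr → ℕ
  | .lit k => 1 + k.size
  | .get _ e => e.weight + 1
  | .op _ e₁ e₂ => e₁.weight + e₂.weight

theorem NExpr.one_le_weight : ∀ e : NExpr, 1 ≤ e.weight
  | .lit _ => by simp [NExpr.weight]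
  | .get _ e => by simp [NExpr.weight]
  | .op _ e₁ e₂ => by have := e₁.one_le_weight; simp only [NExpr.weight]; omega

theorem NExpr.eval_lt {B : ℕ} {s : State} (hs : Bdd B s) :
    ∀ e : NExpr, e.eval s < 2 ^ (e.weight * (B + 1))
  | .lit k => by
      simp only [NExpr.eval, NExpr.weight]
      refine (Nat.lt_size_self k).trans_le (Nat.pow_le_pow_right (by norm_num) ?_)
      nlinarith [Nat.zero_le (k.size * B)]
  | .get a e => by
      simp only [NExpr.eval, NExpr.weight]
      refine (hs _ _).trans_le (Nat.pow_le_pow_right (by norm_num) ?_)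
      nlinarith [Nat.zero_le (e.weight * (B + 1))]
  | .op o e₁ e₂ => by
      have h₁ := e₁.eval_lt hs
      have h₂ := e₂.eval_lt hs
      have p₁ : 2 ≤ 2 ^ (e₁.weight * (B + 1)) := by
        calc 2 = 2 ^ 1 := rfl
          _ ≤ _ := Nat.pow_le_pow_right (by norm_num)
            (Nat.mul_pos e₁.one_le_weight (Nat.succ_pos B))
      have p₂ : 2 ≤ 2 ^ (e₂.weight * (B + 1)) := by
        calc 2 = 2 ^ 1 := rfl
          _ ≤ _ := Nat.pow_le_pow_right (by norm_num)
            (Nat.mul_pos e₂.one_le_weight (Nat.succ_pos B))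
      simp only [NExpr.eval, NExpr.weight, add_mul, pow_add]
      set x := e₁.eval s
      set y := e₂.eval s
      set a := 2 ^ (e₁.weight * (B + 1))
      set b := 2 ^ (e₂.weight * (B + 1))
      have hab : a ≤ a * b := Nat.le_mul_of_pos_right _ (by omega)
      cases o with
      | add => simp only [BinOp.eval]; nlinarith
      | sub => simp only [BinOp.eval]; omega
      | mul =>
        simp only [BinOp.eval]
        exact Nat.mul_lt_mul'' h₁ h₂
      | div => simp only [BinOp.eval]; exact (Nat.div_le_self _ _).trans_lt (by omega)
      | mod => simp only [BinOp.eval]; exact (Nat.mod_le _ _).trans_lt (by omega)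

/-- Arithmetic is charged by the product of the operand lengths. Each factor 1 + length is at most
twice weight times B + 1, which gives the 4 and the square. -/
theorem NExpr.cost_le {B : ℕ} {s : State} (hs : Bdd B s) :
    ∀ e : NExpr, e.cost s ≤ 4 * e.weight ^ 2 * (B + 1) ^ 2
  | .lit k => by
      simp only [NExpr.cost, NExpr.weight]
      nlinarith [Nat.zero_le (k.size), Nat.zero_le B, Nat.one_le_pow 2 (B + 1) (by omega),
        Nat.le_self_pow (n := 2) (by norm_num) (1 + k.size)]
  | .get a e => by
      have h := e.cost_le hs
      have h1 : (s.nat a (e.eval s)).size ≤ B := Nat.size_le.2 (hs _ _)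
      have := e.one_le_weight
      simp only [NExpr.cost, NExpr.weight]
      have h2 : B + 1 ≤ (B + 1) ^ 2 := Nat.le_self_pow (by norm_num) _
      calc _ ≤ 4 * e.weight ^ 2 * (B + 1) ^ 2 + (B + 1) ^ 2 := by omega
        _ = (4 * e.weight ^ 2 + 1) * (B + 1) ^ 2 := by ring
        _ ≤ _ := Nat.mul_le_mul_right _ (by nlinarith)
  | .op o e₁ e₂ => by
      have h₁ := e₁.cost_le hs
      have h₂ := e₂.cost_le hs
      have s₁ : (e₁.eval s).size ≤ e₁.weight * (B + 1) := Nat.size_le.2 (e₁.eval_lt hs)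
      have s₂ : (e₂.eval s).size ≤ e₂.weight * (B + 1) := Nat.size_le.2 (e₂.eval_lt hs)
      have w₁ : 1 ≤ e₁.weight * (B + 1) := Nat.mul_pos e₁.one_le_weight (Nat.succ_pos B)
      have w₂ : 1 ≤ e₂.weight * (B + 1) := Nat.mul_pos e₂.one_le_weight (Nat.succ_pos B)
      have h3 : (1 + (e₁.eval s).size) * (1 + (e₂.eval s).size)
          ≤ (2 * (e₁.weight * (B + 1))) * (2 * (e₂.weight * (B + 1))) :=
        Nat.mul_le_mul (by omega) (by omega)
      simp only [NExpr.cost, NExpr.weight]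
      nlinarith [Nat.zero_le (e₁.weight * e₂.weight * (B + 1) ^ 2)]

def NExpr.unit (e : NExpr) : ℕ := 4 * e.weight ^ 2

def RExpr.unit : RExpr → ℕ
  | .zero => 1
  | .get _ e => e.unit + 1
  | .add r₁ r₂ => r₁.unit + r₂.unit + 1

theorem RExpr.cost_le {B : ℕ} {s : State} (hs : Bdd B s) :
    ∀ r : RExpr, r.cost s ≤ r.unit * (B + 1) ^ 2
  | .zero => by simpa [RExpr.cost, RExpr.unit] using Nat.one_le_pow 2 (B + 1) (by omega)
  | .get _ e => by
      have := e.cost_le hs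
      have := Nat.one_le_pow 2 (B + 1) (by omega)
      simp only [RExpr.cost, RExpr.unit, NExpr.unit, add_mul]; omega
  | .add r₁ r₂ => by
      have := r₁.cost_le hs
      have := r₂.cost_le hs
      have := Nat.one_le_pow 2 (B + 1) (by omega)
      simp only [RExpr.cost, RExpr.unit, add_mul]; omega

def Test.unit : Test → ℕ
  | .natLE e₁ e₂ => e₁.unit + e₂.unit + 1
  | .realLE r₁ r₂ => r₁.unit + r₂.unit + 1
  | .neg b => b.unit + 1

theorem Test.cost_le {B : ℕ} {s : State} (hs : Bdd B s) :
    ∀ b : Test, b.cost s ≤ b.unit * (B + 1) ^ 2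
  | .natLE e₁ e₂ => by
      have := e₁.cost_le hs
      have := e₂.cost_le hs
      have := Nat.one_le_pow 2 (B + 1) (by omega)
      simp only [Test.cost, Test.unit, NExpr.unit, add_mul]; omega
  | .realLE r₁ r₂ => by
      have := r₁.cost_le hs
      have := r₂.cost_le hs
      have := Nat.one_le_pow 2 (B + 1) (by omega)
      simp only [Test.cost, Test.unit, add_mul]; omega
  | .neg b => by
      have := b.cost_le hs
      have := Nat.one_le_pow 2 (B + 1) (by omega)
      simp only [Test.cost, Test.unit, add_mul]; omega

/-- A loop contributes a single pass here; iterations are counted by the step number in `Exec`. The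
final exponent c depends on this constant. -/
def Program.unit : Program → ℕ
  | .skip => 1
  | .setNat _ e e' => e.unit + e'.unit + 1
  | .setReal _ e r => e.unit + r.unit + 1
  | .seq p q => p.unit + q.unit
  | .branch b p q => b.unit + p.unit + q.unit + 1
  | .loop b p => b.unit + p.unit + 1

/-! ## A program logic with time bounds -/

/-- Started in `s`, the program `p` halts within `t` steps, keeps all integers below `2 ^ B` and
establishes `Q`; each step costs at most `p.unit * (B + 1) ^ 2`. -/
def Exec (B : ℕ) (p : Program) (s : State) (t : ℕ) (Q : State → Prop) : Prop :=
  Bdd B s → ∃ s' k, Runs p s s' k ∧ k ≤ t * (p.unit * (B + 1) ^ 2) ∧ Bdd B s' ∧ Q s'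

/-- The integer arrays that a program may change. -/
def Program.natWrites : Program → List ℕ
  | .skip => []
  | .setNat a _ _ => [a]
  | .setReal _ _ _ => []
  | .seq p q => p.natWrites ++ q.natWrites
  | .branch _ p q => p.natWrites ++ q.natWrites
  | .loop _ p => p.natWrites

/-- The real arrays that a program may change. -/
def Program.realWrites : Program → List ℕ
  | .skip => []
  | .setNat _ _ _ => []
  | .setReal a _ _ => [a]
  | .seq p q => p.realWrites ++ q.realWrites
  | .branch _ p q => p.realWrites ++ q.realWrites
  | .loop _ p => p.realWrites

/-- The two memories agree outside the given integer and real arrays. -/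
def Frame (N R : List ℕ) (s s' : State) : Prop :=
  (∀ a ∉ N, s'.nat a = s.nat a) ∧ ∀ a ∉ R, s'.real a = s.real a

theorem Frame.refl (N R : List ℕ) (s : State) : Frame N R s s := ⟨fun _ _ => rfl, fun _ _ => rfl⟩

theorem Frame.trans {N R : List ℕ} {s s₁ s₂ : State} (h : Frame N R s s₁) (h' : Frame N R s₁ s₂) :
    Frame N R s s₂ :=
  ⟨fun a ha => (h'.1 a ha).trans (h.1 a ha), fun a ha => (h'.2 a ha).trans (h.2 a ha)⟩

theorem Frame.mono {N R N' R' : List ℕ} {s s' : State} (h : Frame N R s s') (hN : N ⊆ N')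
    (hR : R ⊆ R') : Frame N' R' s s' :=
  ⟨fun a ha => h.1 a (fun h' => ha (hN h')), fun a ha => h.2 a (fun h' => ha (hR h'))⟩

@[simp] theorem State.writeNat_nat_same (s : State) (a i x : ℕ) :
    (s.writeNat a i x).nat a = Function.update (s.nat a) i x := by simp [State.writeNat]

@[simp] theorem State.writeNat_nat_ne (s : State) {a b : ℕ} (i x : ℕ) (h : b ≠ a) :
    (s.writeNat a i x).nat b = s.nat b := by simp [State.writeNat, h]

@[simp] theorem State.writeNat_real (s : State) (a i x : ℕ) :
    (s.writeNat a i x).real = s.real := rfl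

@[simp] theorem State.writeReal_real_same (s : State) (a i : ℕ) (x : ℝ) :
    (s.writeReal a i x).real a = Function.update (s.real a) i x := by simp [State.writeReal]

@[simp] theorem State.writeReal_real_ne (s : State) {a b : ℕ} (i : ℕ) (x : ℝ) (h : b ≠ a) :
    (s.writeReal a i x).real b = s.real b := by simp [State.writeReal, h]

@[simp] theorem State.writeReal_nat (s : State) (a i : ℕ) (x : ℝ) :
    (s.writeReal a i x).nat = s.nat := rfl

theorem Runs.frame {p : Program} {s s' : State} {k : ℕ} (h : Runs p s s' k) :
    Frame p.natWrites p.realWrites s s' := by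
  induction h with
  | skip s => exact Frame.refl _ _ _
  | setNat s a e e' =>
    exact ⟨fun b hb => State.writeNat_nat_ne _ _ _ (by simpa [Program.natWrites] using hb),
      fun _ _ => rfl⟩
  | setReal s a e e' =>
    exact ⟨fun _ _ => rfl,
      fun b hb => State.writeReal_real_ne _ _ _ (by simpa [Program.realWrites] using hb)⟩
  | seq _ _ ih₁ ih₂ =>
    exact (ih₁.mono (by simp [Program.natWrites]) (by simp [Program.realWrites])).trans
      (ih₂.mono (by simp [Program.natWrites]) (by simp [Program.realWrites]))
  | branchTrue _ _ ih => exact ih.mono (by simp [Program.natWrites]) (by simp [Program.realWrites])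
  | branchFalse _ _ ih => exact ih.mono (by simp [Program.natWrites]) (by simp [Program.realWrites])
  | loopDone _ => exact Frame.refl _ _ _
  | loopStep _ _ _ ih₁ ih₂ => exact Frame.trans ih₁ ih₂

variable {B : ℕ} {s : State} {Q : State → Prop}

/-- The frame is available when the postcondition is weakened, so a specification states only what a
program changes; everything else follows from its syntactic list of written arrays. -/
theorem Exec.mono {p : Program} {t t' : ℕ} {Q' : State → Prop} (h : Exec B p s t Q') (ht : t ≤ t')
    (hQ : ∀ s', Frame p.natWrites p.realWrites s s' → Q' s' → Q s') : Exec B p s t' Q := by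
  intro hs
  obtain ⟨s', k, hr, hk, hb, hq⟩ := h hs
  exact ⟨s', k, hr, hk.trans (Nat.mul_le_mul_right _ ht), hb, hQ s' hr.frame hq⟩

theorem Exec.le {p : Program} {t t' : ℕ} (h : Exec B p s t Q) (ht : t ≤ t') : Exec B p s t' Q :=
  h.mono ht fun _ _ h => h

theorem Exec.skip (hQ : Q s) : Exec B .skip s 1 Q := by
  intro hs
  refine ⟨s, 1, .skip s, ?_, hs, hQ⟩
  simpa [Program.unit] using Nat.one_le_pow 2 (B + 1) (by omega)

theorem Exec.setNat {a : ℕ} {e e' : NExpr} (hB : e'.eval s < 2 ^ B)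
    (hQ : Q (s.writeNat a (e.eval s) (e'.eval s))) : Exec B (.setNat a e e') s 1 Q := by
  intro hs
  refine ⟨_, _, .setNat s a e e', ?_, ?_, hQ⟩
  · have := e.cost_le hs
    have := e'.cost_le hs
    have := Nat.one_le_pow 2 (B + 1) (by omega)
    simp only [Program.unit, NExpr.unit, add_mul]; omega
  · intro b i
    by_cases hb : b = a
    · subst hb
      rw [State.writeNat_nat_same, Function.update_apply]
      split_ifs
      · exact hB
      · exact hs _ _
    · rw [State.writeNat_nat_ne _ _ _ hb]
      exact hs _ _

theorem Exec.setReal {a : ℕ} {e : NExpr} {r : RExpr}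
    (hQ : Q (s.writeReal a (e.eval s) (r.eval s))) : Exec B (.setReal a e r) s 1 Q := by
  intro hs
  refine ⟨_, _, .setReal s a e r, ?_, hs, hQ⟩
  have := e.cost_le hs
  have := r.cost_le hs
  have := Nat.one_le_pow 2 (B + 1) (by omega)
  simp only [Program.unit, NExpr.unit, add_mul]; omega

theorem Exec.seq {p q : Program} {t₁ t₂ : ℕ} {Q₁ : State → Prop} (h₁ : Exec B p s t₁ Q₁)
    (h₂ : ∀ s', Frame p.natWrites p.realWrites s s' → Q₁ s' → Exec B q s' t₂ Q) :
    Exec B (.seq p q) s (t₁ + t₂) Q := by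
  intro hs
  obtain ⟨s₁, k₁, hr₁, hk₁, hb₁, hq₁⟩ := h₁ hs
  obtain ⟨s₂, k₂, hr₂, hk₂, hb₂, hq₂⟩ := h₂ s₁ hr₁.frame hq₁ hb₁
  refine ⟨s₂, _, .seq hr₁ hr₂, ?_, hb₂, hq₂⟩
  simp only [Program.unit]
  calc k₁ + k₂ ≤ t₁ * (p.unit * (B + 1) ^ 2) + t₂ * (q.unit * (B + 1) ^ 2) := by omega
    _ ≤ t₁ * ((p.unit + q.unit) * (B + 1) ^ 2) + t₂ * ((p.unit + q.unit) * (B + 1) ^ 2) := by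
        gcongr <;> omega
    _ = _ := by ring

theorem Exec.setNat_seq {a t : ℕ} {e e' : NExpr} {q : Program} (hB : e'.eval s < 2 ^ B)
    (h : Exec B q (s.writeNat a (e.eval s) (e'.eval s)) t Q) :
    Exec B (.seq (.setNat a e e') q) s (1 + t) Q :=
  Exec.seq (Q₁ := fun s' => s' = s.writeNat a (e.eval s) (e'.eval s)) (Exec.setNat hB rfl)
    fun s' _ h' => by rw [h']; exact h

theorem Exec.setReal_seq {a t : ℕ} {e : NExpr} {r : RExpr} {q : Program}
    (h : Exec B q (s.writeReal a (e.eval s) (r.eval s)) t Q) :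
    Exec B (.seq (.setReal a e r) q) s (1 + t) Q :=
  Exec.seq (Q₁ := fun s' => s' = s.writeReal a (e.eval s) (r.eval s)) (Exec.setReal rfl)
    fun s' _ h' => by rw [h']; exact h

theorem Exec.branch {b : Test} {p q : Program} {t : ℕ} (h₁ : b.Holds s → Exec B p s t Q)
    (h₂ : ¬ b.Holds s → Exec B q s t Q) : Exec B (.branch b p q) s (t + 1) Q := by
  intro hs
  have hb := b.cost_le hs
  have h1 := Nat.one_le_pow 2 (B + 1) (by omega)
  -- The additional step pays for the test, because `unit` of a branching includes that of its test.
  have key : ∀ k x, k ≤ t * (x * (B + 1) ^ 2) → x ≤ p.unit + q.unit →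
      b.cost s + k + 1 ≤ (t + 1) * ((Program.branch b p q).unit * (B + 1) ^ 2) := by
    intro k x hk hx
    simp only [Program.unit]
    have : t * (x * (B + 1) ^ 2) ≤ t * ((p.unit + q.unit) * (B + 1) ^ 2) := by gcongr
    nlinarith [Nat.zero_le (t * ((b.unit + 1) * (B + 1) ^ 2)),
      Nat.zero_le ((p.unit + q.unit) * (B + 1) ^ 2)]
  by_cases h : b.Holds s
  · obtain ⟨s', k, hr, hk, hb', hq⟩ := h₁ h hs
    exact ⟨s', _, .branchTrue h hr, key k _ hk (by omega), hb', hq⟩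
  · obtain ⟨s', k, hr, hk, hb', hq⟩ := h₂ h hs
    exact ⟨s', _, .branchFalse h hr, key k _ hk (by omega), hb', hq⟩

/-- Loop rule: `Inv j` holds after `j` iterations, and there are exactly `m` iterations. -/
theorem Exec.loop {b : Test} {p : Program} {t m : ℕ} {Inv : ℕ → State → Prop}
    (hb : ∀ j s, j ≤ m → Inv j s → (b.Holds s ↔ j < m))
    (hstep : ∀ j < m, ∀ s, Inv j s → Exec B p s t (Inv (j + 1))) :
    ∀ r j s, j + r = m → Inv j s → Exec B (.loop b p) s (r * (t + 1) + 1) (Inv m) := by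
  intro r
  induction r with
  | zero =>
    intro j s hj h hs
    have hn : ¬ b.Holds s := by rw [hb j s (by omega) h]; omega
    refine ⟨s, _, .loopDone hn, ?_, hs, by rwa [show m = j by omega]⟩
    have := b.cost_le hs
    have := Nat.one_le_pow 2 (B + 1) (by omega)
    simp only [Program.unit, add_mul]; omega
  | succ r ih =>
    intro j s hj h hs
    have hn : b.Holds s := by rw [hb j s (by omega) h]; omega
    obtain ⟨s₁, k₁, hr₁, hk₁, hb₁, hq₁⟩ := hstep j (by omega) s h hs
    obtain ⟨s₂, k₂, hr₂, hk₂, hb₂, hq₂⟩ := ih (j + 1) s₁ (by omega) hq₁ hb₁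
    refine ⟨s₂, _, .loopStep hn hr₁ hr₂, ?_, hb₂, hq₂⟩
    have hc := b.cost_le hs
    have h1 := Nat.one_le_pow 2 (B + 1) (by omega)
    set U := (Program.loop b p).unit * (B + 1) ^ 2 with hU
    have h2 : b.unit * (B + 1) ^ 2 + (B + 1) ^ 2 ≤ U := by
      rw [hU]; simp only [Program.unit]; nlinarith [Nat.zero_le (p.unit * (B + 1) ^ 2)]
    have h3 : t * (p.unit * (B + 1) ^ 2) ≤ t * U := by
      rw [hU]; simp only [Program.unit]; gcongr; omega
    have h4 : ((r + 1) * (t + 1) + 1) * U = (r * (t + 1) + 1) * U + t * U + U := by ring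
    omega

/-- Cell `0` of an integer array, used as a variable. -/
abbrev NExpr.var (a : ℕ) : NExpr := .get a (.lit 0)

/-- `for i < N do p`; the counter `i` is cell `0` of integer array `i`. -/
def Program.forLoop (i : ℕ) (N : NExpr) (p : Program) : Program :=
  .seq (.setNat i (.lit 0) (.lit 0))
    (.loop (.natLE (.op .add (.var i) (.lit 1)) N)
      (.seq p (.setNat i (.lit 0) (.op .add (.var i) (.lit 1)))))

/-- Each round pays for the body, the increment and the test; the last 2 pays for the initialisation
and the failing test. The bound `N` is evaluated anew in every test, hence the requirement that it
has the value `m` in all memories reachable by the writes of the body and the counter. -/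
theorem Exec.forLoop {i : ℕ} {N : NExpr} {p : Program} (m t : ℕ) (Inv : ℕ → State → Prop)
    (hi : i ∉ p.natWrites) (hm : m < 2 ^ B)
    (hInv : ∀ j s x, Inv j s → Inv j (s.writeNat i 0 x))
    (hN : ∀ s', Frame (i :: p.natWrites) p.realWrites s s' → N.eval s' = m)
    (h0 : Inv 0 s)
    (hstep : ∀ j < m, ∀ s', Frame (i :: p.natWrites) p.realWrites s s' → s'.nat i 0 = j →
      Inv j s' → Exec B p s' t (Inv (j + 1)))
    (hQ : ∀ s', Frame (i :: p.natWrites) p.realWrites s s' → Inv m s' → Q s') :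
    Exec B (.forLoop i N p) s (m * (t + 2) + 2) Q := by
  have hw : ∀ s' x, Frame (i :: p.natWrites) p.realWrites s' (s'.writeNat i 0 x) := fun s' x =>
    ⟨fun a ha => State.writeNat_nat_ne _ _ _ (by rintro rfl; simp at ha), fun _ _ => rfl⟩
  have key := Exec.loop (B := B) (b := .natLE (.op .add (.var i) (.lit 1)) N) (m := m)
    (p := .seq p (.setNat i (.lit 0) (.op .add (.var i) (.lit 1)))) (t := t + 1)
    (Inv := fun j s' => Frame (i :: p.natWrites) p.realWrites s s' ∧ s'.nat i 0 = j ∧ Inv j s')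
    (fun j s' hj h => by
      simp only [Test.Holds, NExpr.eval, BinOp.eval, hN s' h.1, h.2.1]; omega)
    (fun j hj s' h => by
      refine Exec.seq (hstep j hj s' h.1 h.2.1 h.2.2) fun s₁ hf hI => ?_
      have h5 : s₁.nat i 0 = j := by rw [hf.1 i hi]; exact h.2.1
      refine Exec.setNat ?_ ?_
      · simp only [NExpr.eval, BinOp.eval, h5]; omega
      · simp only [NExpr.eval, BinOp.eval, h5]
        refine ⟨(h.1.trans (hf.mono (by simp) (by simp))).trans (hw _ _), by simp, hInv _ _ _ hI⟩)
    m 0 (s.writeNat i 0 0) (by omega) ⟨hw _ _, by simp, hInv _ _ _ h0⟩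
  have := Exec.setNat_seq (B := B) (a := i) (e := .lit 0) (e' := .lit 0)
    (by simp [NExpr.eval]) key
  refine this.mono (by ring_nf; omega) fun s' _ h => hQ s' h.1 h.2.2

end RealRAM

namespace Sched

/-! ## Sets of jobs as bit masks -/

/-- The number whose binary digits describe the set `S`. -/
def mask (S : Finset ℕ) : ℕ := ∑ i ∈ S, 2 ^ i

@[simp] theorem mask_empty : mask ∅ = 0 := rfl

theorem mask_lt {S : Finset ℕ} {n : ℕ} (h : ∀ i ∈ S, i < n) : mask S < 2 ^ n :=
  Nat.geomSum_lt (le_refl 2) h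

theorem mask_insert {S : Finset ℕ} {v : ℕ} (h : v ∉ S) : mask (insert v S) = mask S + 2 ^ v := by
  rw [mask, Finset.sum_insert h, add_comm]; rfl

theorem mask_erase {S : Finset ℕ} {v : ℕ} (h : v ∈ S) : mask (S.erase v) = mask S - 2 ^ v := by
  have := Finset.add_sum_erase S (fun i => 2 ^ i) h
  simp only [mask]; omega

theorem mask_erase_lt {S : Finset ℕ} {v : ℕ} (h : v ∈ S) : mask (S.erase v) < mask S := by
  have := Finset.add_sum_erase S (fun i => 2 ^ i) h
  have := Nat.two_pow_pos v
  simp only [mask]; omega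

theorem mask_union {S T : Finset ℕ} (h : Disjoint S T) : mask (S ∪ T) = mask S + mask T :=
  Finset.sum_union h

theorem mask_bit (S : Finset ℕ) (v : ℕ) : mask S / 2 ^ v % 2 = if v ∈ S then 1 else 0 := by
  have h1 : v ∈ S ↔ (mask S).testBit v := by
    rw [← Nat.mem_bitIndices, ← List.mem_toFinset, mask, Finset.toFinset_bitIndices_sum_two_pow]
  rw [Nat.testBit_eq_decide_div_mod_eq] at h1
  split_ifs with h
  · simpa using h1.1 h
  · have : ¬ mask S / 2 ^ v % 2 = 1 := fun h' => h (h1.2 (by simpa using h'))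
    omega

/-! ## Enumeration of set families -/

/-- The total load of `S`, where a job of class `c` has load `c - 1`. -/
def load (c : ℕ → ℕ) (S : Finset ℕ) : ℕ := ∑ i ∈ S, (c i - 1)

theorem load_insert (c : ℕ → ℕ) {S : Finset ℕ} {v : ℕ} (h : v ∉ S) :
    load c (insert v S) = load c S + (c v - 1) := by
  rw [load, Finset.sum_insert h, add_comm]; rfl

theorem load_mono (c : ℕ → ℕ) {S T : Finset ℕ} (h : S ⊆ T) : load c S ≤ load c T :=
  Finset.sum_le_sum_of_subset h

/-- The members of `l` that can be extended by `v`, extended by `v`. -/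
def extend (c : ℕ → ℕ) (k v : ℕ) (l : List (Finset ℕ)) : List (Finset ℕ) :=
  (l.filter fun S => load c S + (c v - 1) + (1 - c v) * (k + 1) ≤ k).map (insert v)

/-- The sets of jobs `< m` of nonzero class with load at most `k`, in increasing order of masks. -/
def enum (c : ℕ → ℕ) (k : ℕ) : ℕ → List (Finset ℕ)
  | 0 => [∅]
  | v + 1 => enum c k v ++ extend c k v (enum c k v)

/-- With truncated subtraction the last summand is a penalty exceeding k for class 0 and vanishes
otherwise, so one comparison tests admissibility and load together. -/
theorem extend_test {a b k : ℕ} : a + (b - 1) + (1 - b) * (k + 1) ≤ k ↔ 1 ≤ b ∧ a + (b - 1) ≤ k := by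
  rcases Nat.eq_zero_or_pos b with rfl | hb
  · simp; omega
  · rw [show 1 - b = 0 by omega]; simp; omega

/-- Inserting a job never lowers the load, so a set can be discarded as soon as it is too heavy
without losing any set of the family. -/
theorem mem_enum {c : ℕ → ℕ} {k m : ℕ} {S : Finset ℕ} :
    S ∈ enum c k m ↔ (∀ i ∈ S, i < m ∧ 1 ≤ c i) ∧ load c S ≤ k := by
  induction m generalizing S with
  | zero =>
    simp only [enum, List.mem_singleton]
    constructor
    · rintro rfl; simp [load]
    · rintro ⟨h, -⟩
      exact Finset.eq_empty_of_forall_notMem fun i hi => by simpa using (h i hi).1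
  | succ v ih =>
    simp only [enum, List.mem_append, extend, List.mem_map, List.mem_filter, decide_eq_true_eq,
      extend_test]
    constructor
    · rintro (h | ⟨T, ⟨hT, hc, hk⟩, rfl⟩)
      · exact ⟨fun i hi => ⟨((ih.1 h).1 i hi).1.trans (Nat.lt_succ_self v), ((ih.1 h).1 i hi).2⟩,
          (ih.1 h).2⟩
      · have hT' := ih.1 hT
        have hv : v ∉ T := fun h => by simpa using (hT'.1 v h).1
        refine ⟨fun i hi => ?_, by rwa [load_insert c hv]⟩
        rcases Finset.mem_insert.1 hi with rfl | hi
        · exact ⟨Nat.lt_succ_self _, hc⟩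
        · exact ⟨(hT'.1 i hi).1.trans (Nat.lt_succ_self v), (hT'.1 i hi).2⟩
    · rintro ⟨h, hk⟩
      by_cases hv : v ∈ S
      · right
        have hl := load_insert c (Finset.notMem_erase v S)
        rw [Finset.insert_erase hv] at hl
        refine ⟨S.erase v, ⟨ih.2 ⟨fun i hi => ?_, by omega⟩, (h v hv).2, by omega⟩,
          Finset.insert_erase hv⟩
        have h1 := Finset.mem_erase.1 hi
        have := (h i h1.2).1
        exact ⟨by omega, (h i h1.2).2⟩
      · left
        refine ih.2 ⟨fun i hi => ?_, hk⟩
        have h1 : i ≠ v := fun h' => hv (h' ▸ hi)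
        have := (h i hi).1
        exact ⟨by omega, (h i hi).2⟩

/-- Masks of the old sets are below 2^v, those of the extended sets at least 2^v, and inserting v
shifts all masks by the same amount. The order matters for the dynamic program, which must meet a
set after its subsets. -/
theorem enum_sorted (c : ℕ → ℕ) (k m : ℕ) :
    (enum c k m).Pairwise fun S T => mask S < mask T := by
  induction m with
  | zero => simp [enum]
  | succ v ih =>
    have hv : ∀ S ∈ enum c k v, v ∉ S := fun S hS h => by simpa using ((mem_enum.1 hS).1 v h).1
    rw [enum, List.pairwise_append]
    refine ⟨ih, ?_, ?_⟩
    · rw [extend, List.pairwise_map]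
      refine (ih.filter _).imp_of_mem ?_
      intro S T hS hT h
      rw [mask_insert (hv S (List.mem_of_mem_filter hS)),
        mask_insert (hv T (List.mem_of_mem_filter hT))]
      omega
    · intro S hS T hT
      obtain ⟨T', hT', rfl⟩ := List.mem_map.1 hT
      rw [mask_insert (hv T' (List.mem_of_mem_filter hT'))]
      have := mask_lt (n := v) fun i hi => ((mem_enum.1 hS).1 i hi).1
      omega

theorem enum_nodup (c : ℕ → ℕ) (k m : ℕ) : (enum c k m).Nodup :=
  (enum_sorted c k m).imp fun h h' => by simp [h'] at h

theorem length_enum_le (c : ℕ → ℕ) (k m : ℕ) : (enum c k m).length ≤ 2 ^ m := by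
  rw [← List.toFinset_card_of_nodup (enum_nodup c k m)]
  calc _ ≤ (Finset.range m).powerset.card := by
        refine Finset.card_le_card fun S hS => ?_
        rw [List.mem_toFinset] at hS
        exact Finset.mem_powerset.2 fun i hi => Finset.mem_range.2 ((mem_enum.1 hS).1 i hi).1
    _ = 2 ^ m := by simp

theorem length_enum_pos (c : ℕ → ℕ) (k m : ℕ) : 0 < (enum c k m).length :=
  List.length_pos_of_mem (mem_enum.2 ⟨by simp, by simp [load]⟩ : (∅ : Finset ℕ) ∈ enum c k m)

theorem extend_take_succ (c : ℕ → ℕ) (k v : ℕ) (l : List (Finset ℕ)) {i : ℕ} (hi : i < l.length) :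
    extend c k v (l.take (i + 1)) = extend c k v (l.take i) ++
      if load c l[i] + (c v - 1) + (1 - c v) * (k + 1) ≤ k then [insert v l[i]] else [] := by
  rw [List.take_succ_eq_append_getElem hi, extend, extend, List.filter_append, List.map_append]
  congr 1
  split_ifs with h <;> simp [h]

theorem length_extend_le (c : ℕ → ℕ) (k v : ℕ) (l : List (Finset ℕ)) :
    (extend c k v l).length ≤ l.length := by
  rw [extend, List.length_map]; exact List.length_filter_le _ _

theorem choose_le_choose_of_le_half {j K N : ℕ} (hj : j ≤ K) (hK : 2 * K ≤ N) :
    N.choose j ≤ N.choose K := by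
  induction K, hj using Nat.le_induction with
  | base => exact le_rfl
  | succ K hj ih =>
    exact (ih (by omega)).trans (Nat.choose_le_succ_of_lt_half_left (by omega))

/-- Size of an enumerated family in terms of the numbers of jobs of the classes `1` and `2`. -/
theorem length_enum_le_mul (c : ℕ → ℕ) (k m : ℕ) (hc : ∀ i < m, c i ≤ 2) {K N : ℕ} (hk : k ≤ K)
    (hN : ((Finset.range m).filter fun i => c i = 2).card ≤ N) (hK : 2 * K ≤ N) :
    (enum c k m).length ≤
      2 ^ ((Finset.range m).filter fun i => c i = 1).card * ((K + 1) * N.choose K) := by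
  set F := (Finset.range m).filter fun i => c i = 1 with hF
  set G := (Finset.range m).filter fun i => c i = 2 with hG
  rw [← List.toFinset_card_of_nodup (enum_nodup c k m)]
  calc _ ≤ (F.powerset ×ˢ (Finset.range (K + 1)).biUnion fun j => G.powersetCard j).card := by
        -- A member is determined by its traces on the two classes. The trace on class 1 is
        -- arbitrary; the one on class 2 has at most K elements, each carrying load 1.
        refine Finset.card_le_card_of_injOn (fun S => (S ∩ F, S ∩ G)) ?_ ?_
        · intro S hS
          have hS' := mem_enum.1 (List.mem_toFinset.1 hS)
          simp only [Finset.coe_product, Set.mem_prod, Finset.mem_coe, Finset.mem_powerset,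
            Finset.mem_biUnion, Finset.mem_range, Finset.mem_powersetCard]
          refine ⟨Finset.inter_subset_right, _, ?_, Finset.inter_subset_right, rfl⟩
          have : (S ∩ G).card ≤ load c S := by
            calc (S ∩ G).card = load c (S ∩ G) := by
                  rw [load, Finset.card_eq_sum_ones]
                  refine Finset.sum_congr rfl fun i hi => ?_
                  have := (Finset.mem_filter.1 (Finset.mem_inter.1 hi).2).2
                  omega
              _ ≤ _ := load_mono c Finset.inter_subset_left
          have := hS'.2
          omega
        · intro S hS T hT hST
          have hS' := mem_enum.1 (List.mem_toFinset.1 hS)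
          have hT' := mem_enum.1 (List.mem_toFinset.1 hT)
          have key : ∀ U : Finset ℕ, (∀ i ∈ U, i < m ∧ 1 ≤ c i) → U = (U ∩ F) ∪ (U ∩ G) := by
            intro U hU
            ext i
            simp only [Finset.mem_union, Finset.mem_inter, hF, hG, Finset.mem_filter,
              Finset.mem_range]
            constructor
            · intro hi
              have h1 := hU i hi
              have h2 := hc i h1.1
              have : c i = 1 ∨ c i = 2 := by omega
              tauto
            · tauto
          simp only [Prod.mk.injEq] at hST
          rw [key S hS'.1, key T hT'.1, hST.1, hST.2]
    _ ≤ 2 ^ F.card * ((K + 1) * N.choose K) := by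
        rw [Finset.card_product, Finset.card_powerset]
        refine Nat.mul_le_mul_left _ ?_
        refine Finset.card_biUnion_le.trans ?_
        calc _ ≤ ∑ j ∈ Finset.range (K + 1), N.choose K := by
              refine Finset.sum_le_sum fun j hj => ?_
              rw [Finset.card_powersetCard]
              -- Binomial coefficients increase up to the middle, so each of the K + 1 layers is at
              -- most the top one.
              exact (Nat.choose_le_choose j hN).trans
                (choose_le_choose_of_le_half (by simpa [Nat.lt_succ_iff] using hj) hK)
          _ = _ := by simp

end Sched

/-! ### Arithmetic notation for the expressions of the machine -/

namespace RealRAM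

instance (k : ℕ) : OfNat NExpr k := ⟨.lit k⟩
instance : Add NExpr := ⟨.op .add⟩
instance : Sub NExpr := ⟨.op .sub⟩
instance : Mul NExpr := ⟨.op .mul⟩
instance : Div NExpr := ⟨.op .div⟩
instance : Mod NExpr := ⟨.op .mod⟩
instance : Add RExpr := ⟨.add⟩

section
variable (s : State) (x y : NExpr) (k a : ℕ)

@[simp] theorem NExpr.eval_ofNat : NExpr.eval s ofNat(k) = OfNat.ofNat k := rfl
@[simp] theorem NExpr.eval_lit : NExpr.eval s (.lit k) = k := rfl
@[simp] theorem NExpr.eval_add : NExpr.eval s (x + y) = x.eval s + y.eval s := rfl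
@[simp] theorem NExpr.eval_sub : NExpr.eval s (x - y) = x.eval s - y.eval s := rfl
@[simp] theorem NExpr.eval_mul : NExpr.eval s (x * y) = x.eval s * y.eval s := rfl
@[simp] theorem NExpr.eval_div : NExpr.eval s (x / y) = x.eval s / y.eval s := rfl
@[simp] theorem NExpr.eval_mod : NExpr.eval s (x % y) = x.eval s % y.eval s := rfl
@[simp] theorem NExpr.eval_get : NExpr.eval s (.get a x) = s.nat a (x.eval s) := rfl
@[simp] theorem RExpr.eval_zero : RExpr.eval s .zero = 0 := rfl
@[simp] theorem RExpr.eval_get : RExpr.eval s (.get a x) = s.real a (x.eval s) := rfl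
@[simp] theorem RExpr.eval_add (r r' : RExpr) :
    RExpr.eval s (r + r') = r.eval s + r'.eval s := rfl
@[simp] theorem Test.holds_natLE : (Test.natLE x y).Holds s ↔ x.eval s ≤ y.eval s := Iff.rfl
@[simp] theorem Test.holds_realLE (r r' : RExpr) :
    (Test.realLE r r').Holds s ↔ r.eval s ≤ r'.eval s := Iff.rfl
@[simp] theorem Test.holds_neg (b : Test) : (Test.neg b).Holds s ↔ ¬ b.Holds s := Iff.rfl

end

infixr:30 ";;" => Program.seq

end RealRAM

namespace Sched

open RealRAM
open RealRAM.NExpr (get var)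
open RealRAM.Program (setNat setReal forLoop branch)

/-! ## Names of the arrays -/

notation "aIn" => (0 : ℕ)
notation "aPr" => (1 : ℕ)
notation "aM" => (2 : ℕ)
notation "aG" => (3 : ℕ)
notation "aRes" => (4 : ℕ)
notation "aOut" => (5 : ℕ)
notation "aPow" => (6 : ℕ)
notation "aFx" => (7 : ℕ)
notation "aNa" => (8 : ℕ)
notation "aNd" => (9 : ℕ)
notation "aOr" => (10 : ℕ)
notation "aNe" => (11 : ℕ)
notation "aEq" => (12 : ℕ)
notation "aCl" => (13 : ℕ)
notation "aLim" => (14 : ℕ)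
notation "aLen" => (15 : ℕ)
notation "aL" => (16 : ℕ)
notation "aCc" => (17 : ℕ)
notation "aBp" => (18 : ℕ)
notation "aQ" => (19 : ℕ)
notation "aCn" => (20 : ℕ)
notation "aSp" => (21 : ℕ)
notation "aTg" => (22 : ℕ)
notation "aX" => (23 : ℕ)
notation "aZ" => (24 : ℕ)
notation "aMm" => (25 : ℕ)
notation "aD" => (26 : ℕ)
notation "aS" => (27 : ℕ)
notation "aSz" => (28 : ℕ)
notation "aBl" => (29 : ℕ)
notation "aFd" => (30 : ℕ)
notation "aOld" => (31 : ℕ)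
notation "aBf" => (32 : ℕ)
notation "aBi" => (33 : ℕ)
notation "aGf" => (34 : ℕ)
notation "aGx" => (35 : ℕ)
notation "aGz" => (36 : ℕ)
notation "aGm" => (37 : ℕ)
notation "aO" => (38 : ℕ)
notation "iA" => (39 : ℕ)
notation "iB" => (40 : ℕ)
notation "iC" => (41 : ℕ)
notation "iD" => (42 : ℕ)
notation "rT" => (0 : ℕ)
notation "rMt" => (1 : ℕ)
notation "rH" => (2 : ℕ)
notation "rC" => (3 : ℕ)
notation "rBv" => (4 : ℕ)
notation "rGv" => (5 : ℕ)

/-! ## The tables computed from the input -/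

/-- The content of the input arrays. -/
structure Data where
  n : ℕ
  pr : ℕ → ℕ → ℕ
  mm : ℕ → ℕ
  gg : ℕ → ℕ
  tt : ℕ → ℝ
  pB : ℕ
  pC : ℕ

namespace Data

/-- Only the ranges of the entries, as needed for the integer bounds. Compatibility with a
precedence order is expressed separately by `Coherent`. -/
structure Ok (D : Data) : Prop where
  four_le : 4 ≤ D.n
  pr_le : ∀ u v, D.pr u v ≤ 1
  mm_le : ∀ v, D.mm v ≤ 1
  gg_le : ∀ v, D.gg v ≤ 3
  pB_le : D.pB ≤ D.n
  pC_le : D.pC ≤ D.n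

variable (D : Data)

/-- Bound for the binary length of the integers in memory. -/
def bits : ℕ := 4 * D.n + 8

/-- Truncated arithmetic encodes the quarter of a special job: `2 - g` is nonzero for A and B, `g -
1` for C and D, `g * (2 - g)` only for B, and `(g - 1) * (3 - g)` only for C. Below, `1 - (1 - x)`
turns a sum into the indicator of its being nonzero. -/
def fxSum (v m : ℕ) : ℕ :=
  D.mm v + ∑ w ∈ Finset.range m, D.mm w * (D.pr v w * (2 - D.gg w) + D.pr w v * (D.gg w - 1))

def naSum (v m : ℕ) : ℕ := ∑ w ∈ Finset.range m, D.mm w * D.pr w v * (D.gg w * (2 - D.gg w))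

def ndSum (v m : ℕ) : ℕ :=
  ∑ w ∈ Finset.range m, D.mm w * D.pr v w * ((D.gg w - 1) * (3 - D.gg w))

/-- `1` if the quarter of `v` is guessed, `0` otherwise. -/
def fx (v : ℕ) : ℕ := 1 - (1 - D.fxSum v D.n)

/-- `1` if `v` succeeds a special job of the second quarter, `0` otherwise. -/
def na (v : ℕ) : ℕ := 1 - (1 - D.naSum v D.n)

/-- `1` if `v` precedes a special job of the third quarter, `0` otherwise. -/
def nd (v : ℕ) : ℕ := 1 - (1 - D.ndSum v D.n)

def neSum (m : ℕ) : ℕ := ∑ v ∈ Finset.range m, (1 - D.fx v) * ((D.na v + D.nd v) % 2)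

def eqSum (m : ℕ) : ℕ := ∑ v ∈ Finset.range m, (1 - D.fx v) * ((D.na v + D.nd v + 1) % 2)

/-- The orientation: `1` if most of the free jobs have `na ≠ nd`, `0` otherwise. -/
def orient : ℕ := 1 - (1 - (D.neSum D.n - D.eqSum D.n))

/-- The class of job `v` in the set family number `l`. -/
def cls (l v : ℕ) : ℕ :=
  match l with
  -- Class 0 forbids a job, class 1 admits it freely, class 2 admits it against the limit. Families
  -- 0 to 3 contain the possible subsets of A, B, C, D, with exceptional jobs in class 2 for B and
  -- C. Families 4 and 5 contain the exceptional sets X and Z. Family 6 consists of choices for the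
  -- outer pair of types; families 7 and 8 of choices for the inner type with `na = 0` and with `na
  -- = 1`.
  | 0 => D.fx v * (1 - D.gg v) + (1 - D.fx v) * (1 - D.na v)
  | 1 => D.fx v * (D.gg v * (2 - D.gg v)) + (1 - D.fx v) * (2 - D.na v)
  | 2 => D.fx v * ((D.gg v - 1) * (3 - D.gg v)) + (1 - D.fx v) * (2 - D.nd v)
  | 3 => D.fx v * (D.gg v - 2) + (1 - D.fx v) * (1 - D.nd v)
  | 4 => (1 - D.fx v) * ((1 - D.na v) * 2)
  | 5 => (1 - D.fx v) * ((1 - D.nd v) * 2)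
  | 6 => (1 - D.fx v) * ((D.na v + D.nd v + D.orient) % 2)
  | 7 => (1 - D.fx v) * ((1 - D.na v) * ((D.nd v + D.orient + 1) % 2))
  | 8 => (1 - D.fx v) * (D.na v * ((D.nd v + D.orient) % 2))
  | _ => 0

/-- The exceptional jobs of B share its n/4 places with exactly p^B others, and similarly in C. The
remaining families have no job of class 2, so that the limit 0 does not restrict them. -/
def lim (l : ℕ) : ℕ :=
  match l with
  | 1 => D.n / 4 - D.pB
  | 2 => D.n / 4 - D.pC
  | 4 => D.n / 4 - D.pB
  | 5 => D.n / 4 - D.pC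
  | _ => 0

/-- The set family number `l`. -/
def family (l : ℕ) : List (Finset ℕ) := enum (D.cls l) (D.lim l) D.n

theorem fx_le (v : ℕ) : D.fx v ≤ 1 := Nat.sub_le _ _
theorem na_le (v : ℕ) : D.na v ≤ 1 := Nat.sub_le _ _
theorem nd_le (v : ℕ) : D.nd v ≤ 1 := Nat.sub_le _ _
theorem orient_le : D.orient ≤ 1 := Nat.sub_le _ _

/-- The input is in memory. -/
structure Input (s : State) : Prop where
  n : s.nat aIn 0 = D.n
  pB : s.nat aIn 1 = D.pB
  pC : s.nat aIn 2 = D.pC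
  pr : ∀ u < D.n, ∀ v < D.n, s.nat aPr (u * D.n + v) = D.pr u v
  mm : ∀ v < D.n, s.nat aM v = D.mm v
  gg : ∀ v < D.n, s.nat aG v = D.gg v
  tt : ∀ v < D.n, s.real rT v = D.tt v

variable {D}

theorem Input.congr {s s' : State} (h : D.Input s) (h0 : s'.nat aIn = s.nat aIn)
    (h1 : s'.nat aPr = s.nat aPr) (h2 : s'.nat aM = s.nat aM) (h3 : s'.nat aG = s.nat aG)
    (h4 : s'.real rT = s.real rT) : D.Input s' := by
  obtain ⟨a, b, c, d, e, f, g⟩ := h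
  constructor <;> simpa only [h0, h1, h2, h3, h4]

theorem lt_bits {x : ℕ} (h : x ≤ 16 * D.n + 64) : x < 2 ^ D.bits := by
  have : D.n < 2 ^ D.n := Nat.lt_two_pow_self
  have h2 : 2 ^ D.n ≤ 2 ^ (4 * D.n) := Nat.pow_le_pow_right (by norm_num) (by omega)
  rw [bits, pow_add]; omega

/-! ## Powers of two -/

def powProg : Program :=
  setNat aPow 0 1;;
  forLoop iA (var aIn) (setNat aPow (var iA + 1) (get aPow (var iA) * 2))

theorem powProg_exec {s : State} (hs : s.nat aIn 0 = D.n) :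
    Exec D.bits powProg s (1 + (D.n * 3 + 2)) fun s' => ∀ v ≤ D.n, s'.nat aPow v = 2 ^ v := by
  refine Exec.setNat_seq (by simp [lt_bits]) ?_
  refine Exec.forLoop D.n 1 (fun j s' => ∀ v ≤ j, s'.nat aPow v = 2 ^ v) (by decide)
    (lt_bits (by omega)) (fun j s x h => by simpa using h) (fun s' h => ?_) ?_ ?_ (fun s' _ h => h)
  · simp [h.1 aIn (by decide), hs]
  · simp
  · intro j hj s' hf hi h
    refine Exec.setNat ?_ ?_
    · simp only [NExpr.eval_mul, NExpr.eval_get, NExpr.eval_ofNat, NExpr.eval_lit, hi, h j le_rfl]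
      rw [← pow_succ]
      exact Nat.pow_lt_pow_right (by norm_num) (by simp [bits]; omega)
    · intro v hv
      simp only [NExpr.eval_mul, NExpr.eval_add, NExpr.eval_get, NExpr.eval_ofNat, NExpr.eval_lit, hi, h j le_rfl,
        State.writeNat_nat_same, Function.update_apply]
      split_ifs with hv'
      · rw [hv', pow_succ]
      · exact h v (by omega)

/-! ## The classification of the jobs -/

def flagStep : Program :=
  setNat aFx (var iA) (get aFx (var iA) + get aM (var iB) *
    (get aPr (var iA * var aIn + var iB) * (2 - get aG (var iB)) +
      get aPr (var iB * var aIn + var iA) * (get aG (var iB) - 1)));;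
  setNat aNa (var iA) (get aNa (var iA) + get aM (var iB) *
    get aPr (var iB * var aIn + var iA) * (get aG (var iB) * (2 - get aG (var iB))));;
  setNat aNd (var iA) (get aNd (var iA) + get aM (var iB) *
    get aPr (var iA * var aIn + var iB) * ((get aG (var iB) - 1) * (3 - get aG (var iB))))

def flagProg : Program :=
  forLoop iA (var aIn) (
    setNat aFx (var iA) (get aM (var iA));;
    setNat aNa (var iA) 0;;
    setNat aNd (var iA) 0;;
    forLoop iB (var aIn) flagStep;;
    setNat aFx (var iA) (1 - (1 - get aFx (var iA)));;
    setNat aNa (var iA) (1 - (1 - get aNa (var iA)));;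
    setNat aNd (var iA) (1 - (1 - get aNd (var iA))))

theorem Ok.fxSum_le (hD : D.Ok) (v m : ℕ) : D.fxSum v m ≤ 1 + 4 * m := by
  have h : ∀ w ∈ Finset.range m,
      D.mm w * (D.pr v w * (2 - D.gg w) + D.pr w v * (D.gg w - 1)) ≤ 4 := fun w _ => by
    have h1 := hD.mm_le w
    have h2 : D.pr v w * (2 - D.gg w) ≤ 1 * 2 := Nat.mul_le_mul (hD.pr_le _ _) (by omega)
    have h3 : D.pr w v * (D.gg w - 1) ≤ 1 * 2 :=
      Nat.mul_le_mul (hD.pr_le _ _) (by have := hD.gg_le w; omega)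
    calc _ ≤ 1 * 4 := Nat.mul_le_mul h1 (by omega)
      _ = 4 := rfl
  have := Finset.sum_le_card_nsmul _ _ _ h
  have := hD.mm_le v
  rw [fxSum]; simp at *; omega

theorem Ok.naSum_le (hD : D.Ok) (v m : ℕ) : D.naSum v m ≤ 4 * m := by
  have h : ∀ w ∈ Finset.range m,
      D.mm w * D.pr w v * (D.gg w * (2 - D.gg w)) ≤ 4 := fun w _ => by
    have h3 : D.gg w * (2 - D.gg w) ≤ 4 := by
      have := hD.gg_le w
      interval_cases D.gg w <;> norm_num
    calc _ ≤ 1 * 1 * 4 := Nat.mul_le_mul (Nat.mul_le_mul (hD.mm_le _) (hD.pr_le _ _)) h3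
      _ = 4 := rfl
  have := Finset.sum_le_card_nsmul _ _ _ h
  rw [naSum]; simp at *; omega

theorem Ok.ndSum_le (hD : D.Ok) (v m : ℕ) : D.ndSum v m ≤ 4 * m := by
  have h : ∀ w ∈ Finset.range m,
      D.mm w * D.pr v w * ((D.gg w - 1) * (3 - D.gg w)) ≤ 4 := fun w _ => by
    have h3 : (D.gg w - 1) * (3 - D.gg w) ≤ 4 := by
      have := hD.gg_le w
      interval_cases D.gg w <;> norm_num
    calc _ ≤ 1 * 1 * 4 := Nat.mul_le_mul (Nat.mul_le_mul (hD.mm_le _) (hD.pr_le _ _)) h3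
      _ = 4 := rfl
  have := Finset.sum_le_card_nsmul _ _ _ h
  rw [ndSum]; simp at *; omega

theorem flagStep_exec (hD : D.Ok) {s : State} (hs : D.Input s) {v j : ℕ} (hv : v < D.n)
    (hj : j < D.n) (hA : s.nat iA 0 = v) (hB : s.nat iB 0 = j) {Q : State → Prop}
    (hf : s.nat aFx v = D.fxSum v j) (ha : s.nat aNa v = D.naSum v j)
    (hd : s.nat aNd v = D.ndSum v j)
    (hQ : Q (((s.writeNat aFx v (D.fxSum v (j + 1))).writeNat aNa v
      (D.naSum v (j + 1))).writeNat aNd v (D.ndSum v (j + 1)))) :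
    Exec D.bits flagStep s (1 + (1 + 1)) Q := by
  have e1 : D.fxSum v (j + 1) = D.fxSum v j + D.mm j *
      (D.pr v j * (2 - D.gg j) + D.pr j v * (D.gg j - 1)) := by
    simp only [fxSum, Finset.sum_range_succ]; omega
  have e2 : D.naSum v (j + 1) = D.naSum v j + D.mm j * D.pr j v * (D.gg j * (2 - D.gg j)) := by
    simp only [naSum, Finset.sum_range_succ]
  have e3 : D.ndSum v (j + 1) = D.ndSum v j +
      D.mm j * D.pr v j * ((D.gg j - 1) * (3 - D.gg j)) := by
    simp only [ndSum, Finset.sum_range_succ]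
  have b1 := hD.fxSum_le v (j + 1)
  have b2 := hD.naSum_le v (j + 1)
  have b3 := hD.ndSum_le v (j + 1)
  have p1 := hs.pr v hv j hj
  have p2 := hs.pr j hj v hv
  have p3 := hs.mm j hj
  have p4 := hs.gg j hj
  refine Exec.setNat_seq ?_ (Exec.setNat_seq ?_ (Exec.setNat ?_ ?_)) <;>
    simp [hA, hB, hf, ha, hd, p1, p2, p3, p4, hs.n, ← e1, ← e2, ← e3]
  · exact lt_bits (by omega)
  · exact lt_bits (by omega)
  · exact lt_bits (by omega)
  · exact hQ

theorem flagProg_exec (hD : D.Ok) {s : State} (hs : D.Input s) :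
    Exec D.bits flagProg s (D.n * ((1 + (1 + (1 + ((D.n * ((1 + (1 + 1)) + 2) + 2) + (1 + (1 + 1)))))) + 2) + 2)
      fun s' => (∀ v < D.n, s'.nat aFx v = D.fx v) ∧ (∀ v < D.n, s'.nat aNa v = D.na v) ∧
        ∀ v < D.n, s'.nat aNd v = D.nd v := by
  refine Exec.forLoop D.n _ (fun j s' => (∀ v < j, s'.nat aFx v = D.fx v) ∧
      (∀ v < j, s'.nat aNa v = D.na v) ∧ ∀ v < j, s'.nat aNd v = D.nd v) (by decide)
    (lt_bits (by omega)) (fun j s x h => by simpa using h) (fun s' h => ?_) (by simp) ?_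
    (fun s' _ h => h)
  · simp [h.1 aIn (by decide), hs.n]
  · intro v hv s' hf hi h
    have hs' : D.Input s' := hs.congr (hf.1 _ (by decide)) (hf.1 _ (by decide))
      (hf.1 _ (by decide)) (hf.1 _ (by decide)) (hf.2 _ (by decide))
    refine Exec.setNat_seq ?_ (Exec.setNat_seq ?_ (Exec.setNat_seq ?_ ?_)) <;>
      simp [hi, hs'.mm v hv, -Nat.reduceAdd]
    · exact lt_bits (by have := hD.mm_le v; omega)
    set s₁ := ((s'.writeNat aFx v (D.mm v)).writeNat aNa v 0).writeNat aNd v 0 with hs₁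
    have hI : D.Input s₁ := hs'.congr (by simp [hs₁]) (by simp [hs₁]) (by simp [hs₁])
      (by simp [hs₁]) (by simp [hs₁])
    have hi₁ : s₁.nat iA 0 = v := by simp [hs₁, hi]
    refine Exec.seq (Q₁ := fun s₂ => s₂.nat aFx = Function.update (s'.nat aFx) v (D.fxSum v D.n) ∧
      s₂.nat aNa = Function.update (s'.nat aNa) v (D.naSum v D.n) ∧
      s₂.nat aNd = Function.update (s'.nat aNd) v (D.ndSum v D.n)) ?_ ?_
    · refine Exec.forLoop D.n (1 + (1 + 1)) (fun j s₂ =>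
        s₂.nat aFx = Function.update (s'.nat aFx) v (D.fxSum v j) ∧
        s₂.nat aNa = Function.update (s'.nat aNa) v (D.naSum v j) ∧
        s₂.nat aNd = Function.update (s'.nat aNd) v (D.ndSum v j)) (by decide)
        (lt_bits (by omega)) (fun j s x h => by simpa using h) (fun s' h => ?_) ?_ ?_
        (fun s' _ h => h)
      · simp [h.1 aIn (by decide), hI.n]
      · simp [hs₁, fxSum, naSum, ndSum]
      · intro j hj s₂ hf₂ hj₂ h₂
        refine flagStep_exec hD (hI.congr (hf₂.1 _ (by decide)) (hf₂.1 _ (by decide))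
          (hf₂.1 _ (by decide)) (hf₂.1 _ (by decide)) (hf₂.2 _ (by decide))) hv hj
          (by rw [hf₂.1 iA (by decide), hi₁]) hj₂ (by simp [h₂.1]) (by simp [h₂.2.1])
          (by simp [h₂.2.2]) ?_
        simp [h₂.1, h₂.2.1, h₂.2.2]
    · intro s₂ hf₂ h₂
      have hi₂ : s₂.nat iA 0 = v := by rw [hf₂.1 iA (by decide), hi₁]
      refine Exec.setNat_seq ?_ (Exec.setNat_seq ?_ (Exec.setNat ?_ ?_)) <;>
        simp [hi₂, h₂.1, h₂.2.1, h₂.2.2]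
      · exact lt_bits (by omega)
      · exact lt_bits (by omega)
      · exact lt_bits (by omega)
      · refine ⟨fun u hu => ?_, fun u hu => ?_, fun u hu => ?_⟩ <;>
          rw [Function.update_apply] <;> split_ifs with huv
        · rw [huv, fx]
        · exact h.1 u (by omega)
        · rw [huv, na]
        · exact h.2.1 u (by omega)
        · rw [huv, nd]
        · exact h.2.2 u (by omega)

end Data
end Sched

/-! ### Frame conditions for several arrays at once -/

namespace RealRAM

theorem Frame.agree {N R : List ℕ} {s s' : State} (h : Frame N R s s') (L : List ℕ)
    (hL : ∀ a ∈ L, a ∉ N) : ∀ a ∈ L, s'.nat a = s.nat a := fun a ha => h.1 a (hL a ha)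

theorem Frame.agree_real {N R : List ℕ} {s s' : State} (h : Frame N R s s') (L : List ℕ)
    (hL : ∀ a ∈ L, a ∉ R) : ∀ a ∈ L, s'.real a = s.real a := fun a ha => h.2 a (hL a ha)

end RealRAM

namespace Sched

open RealRAM
open RealRAM.NExpr (get var)
open RealRAM.Program (setNat setReal forLoop branch)

namespace Data

variable {D : Data}

/-- The input, the powers of two and the classification of the jobs are in memory. -/
structure Base (D : Data) (s : State) : Prop where
  input : D.Input s
  pow : ∀ v ≤ D.n, s.nat aPow v = 2 ^ v
  fx : ∀ v < D.n, s.nat aFx v = D.fx v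
  na : ∀ v < D.n, s.nat aNa v = D.na v
  nd : ∀ v < D.n, s.nat aNd v = D.nd v

theorem Base.congr {s s' : State} (h : D.Base s)
    (hn : ∀ a ∈ [aIn, aPr, aM, aG, aPow, aFx, aNa, aNd], s'.nat a = s.nat a)
    (hr : ∀ a ∈ [rT], s'.real a = s.real a) : D.Base s' := by
  simp only [List.forall_mem_cons] at hn hr
  obtain ⟨a, b, c, d, e⟩ := h
  have := a.congr hn.1 hn.2.1 hn.2.2.1 hn.2.2.2.1 hr.1
  constructor
  · exact this
  all_goals simpa only [hn]

/-! ## The orientation -/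

def orientProg : Program :=
  setNat aNe 0 0;;
  setNat aEq 0 0;;
  forLoop iA (var aIn) (
    setNat aNe 0 (var aNe + (1 - get aFx (var iA)) *
      ((get aNa (var iA) + get aNd (var iA)) % 2));;
    setNat aEq 0 (var aEq + (1 - get aFx (var iA)) *
      ((get aNa (var iA) + get aNd (var iA) + 1) % 2)));;
  setNat aOr 0 (1 - (1 - (var aNe - var aEq)))

theorem mul_mod_two_le (x y : ℕ) : (1 - x) * (y % 2) ≤ 1 := by
  calc _ ≤ 1 * 1 := Nat.mul_le_mul (by omega) (by omega)
    _ = 1 := rfl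

theorem neSum_succ (m : ℕ) :
    D.neSum (m + 1) = D.neSum m + (1 - D.fx m) * ((D.na m + D.nd m) % 2) := by
  simp only [neSum, Finset.sum_range_succ]

theorem eqSum_succ (m : ℕ) :
    D.eqSum (m + 1) = D.eqSum m + (1 - D.fx m) * ((D.na m + D.nd m + 1) % 2) := by
  simp only [eqSum, Finset.sum_range_succ]

theorem neSum_le (m : ℕ) : D.neSum m ≤ m := by
  induction m with
  | zero => simp [neSum]
  | succ m ih => rw [neSum_succ]; have := mul_mod_two_le (D.fx m) (D.na m + D.nd m); omega

theorem eqSum_le (m : ℕ) : D.eqSum m ≤ m := by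
  induction m with
  | zero => simp [eqSum]
  | succ m ih => rw [eqSum_succ]; have := mul_mod_two_le (D.fx m) (D.na m + D.nd m + 1); omega

theorem orientProg_exec {s : State} (hs : D.Base s) :
    Exec D.bits orientProg s (1 + (1 + ((D.n * ((1 + 1) + 2) + 2) + 1)))
      fun s' => s'.nat aOr 0 = D.orient := by
  refine Exec.setNat_seq (lt_bits (by simp)) (Exec.setNat_seq (lt_bits (by simp)) ?_)
  refine Exec.seq (Q₁ := fun s' => s'.nat aNe 0 = D.neSum D.n ∧ s'.nat aEq 0 = D.eqSum D.n) ?_ ?_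
  · refine Exec.forLoop D.n _ (fun j s' => s'.nat aNe 0 = D.neSum j ∧ s'.nat aEq 0 = D.eqSum j)
      (by decide) (lt_bits (by omega)) (fun j s x h => by simpa using h) (fun s' h => ?_)
      (by simp [neSum, eqSum]) ?_ (fun s' _ h => h)
    · simp [h.1 aIn (by decide), hs.input.n]
    · intro j hj s' hf hi h
      have h1 : s'.nat aFx j = D.fx j := by rw [hf.1 _ (by decide)]; simp [hs.fx j hj]
      have h2 : s'.nat aNa j = D.na j := by rw [hf.1 _ (by decide)]; simp [hs.na j hj]
      have h3 : s'.nat aNd j = D.nd j := by rw [hf.1 _ (by decide)]; simp [hs.nd j hj]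
      refine Exec.setNat_seq ?_ (Exec.setNat ?_ ?_) <;>
        simp [hi, h1, h2, h3, h.1, h.2, ← neSum_succ, ← eqSum_succ]
      · exact lt_bits (by have := neSum_le (D := D) (j + 1); omega)
      · exact lt_bits (by have := eqSum_le (D := D) (j + 1); omega)
  · intro s' hf h
    refine Exec.setNat ?_ ?_ <;> simp [h.1, h.2]
    · exact lt_bits (by omega)
    · rfl

/-! ## The class table -/

/-- `1` if `v` is free. -/
def eFree : NExpr := 1 - get aFx (var iA)

/-- Two-dimensional tables are stored with row length 16; there are nine families, so different
entries never share a cell. -/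
def classStep : Program :=
  setNat aCl (var iA * 16 + 0) (get aFx (var iA) * (1 - get aG (var iA)) +
    eFree * (1 - get aNa (var iA)));;
  setNat aCl (var iA * 16 + 1) (get aFx (var iA) * (get aG (var iA) * (2 - get aG (var iA))) +
    eFree * (2 - get aNa (var iA)));;
  setNat aCl (var iA * 16 + 2) (get aFx (var iA) * ((get aG (var iA) - 1) *
    (3 - get aG (var iA))) + eFree * (2 - get aNd (var iA)));;
  setNat aCl (var iA * 16 + 3) (get aFx (var iA) * (get aG (var iA) - 2) +
    eFree * (1 - get aNd (var iA)));;
  setNat aCl (var iA * 16 + 4) (eFree * ((1 - get aNa (var iA)) * 2));;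
  setNat aCl (var iA * 16 + 5) (eFree * ((1 - get aNd (var iA)) * 2));;
  setNat aCl (var iA * 16 + 6) (eFree * ((get aNa (var iA) + get aNd (var iA) + var aOr) % 2));;
  setNat aCl (var iA * 16 + 7) (eFree * ((1 - get aNa (var iA)) *
    ((get aNd (var iA) + var aOr + 1) % 2)));;
  setNat aCl (var iA * 16 + 8) (eFree * (get aNa (var iA) * ((get aNd (var iA) + var aOr) % 2)))

def limitProg : Program :=
  setNat aLim 0 0;;
  setNat aLim 1 (var aIn / 4 - get aIn 1);;
  setNat aLim 2 (var aIn / 4 - get aIn 2);;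
  setNat aLim 3 0;;
  setNat aLim 4 (var aIn / 4 - get aIn 1);;
  setNat aLim 5 (var aIn / 4 - get aIn 2);;
  setNat aLim 6 0;;
  setNat aLim 7 0;;
  setNat aLim 8 0;;
  setNat aTg 0 0;;
  setNat aTg 1 (get aIn 1);;
  setNat aTg 2 (get aIn 2);;
  setNat aTg 3 0

def classProg : Program := forLoop iA (var aIn) classStep;; limitProg

/-- The prescribed number of non-exceptional free jobs in a quarter. -/
def target (D : Data) (q : ℕ) : ℕ :=
  match q with
  | 1 => D.pB
  | 2 => D.pC
  | _ => 0

theorem Ok.cls_le (hD : D.Ok) (l v : ℕ) : D.cls l v ≤ 2 := by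
  have h1 := D.fx_le v
  have h2 := D.na_le v
  have h3 := D.nd_le v
  have h4 := hD.gg_le v
  have h5 := D.orient_le
  unfold cls
  generalize D.fx v = a at *
  generalize D.na v = b at *
  generalize D.nd v = c at *
  generalize D.gg v = d at *
  generalize D.orient = e at *
  split <;> interval_cases a <;> simp <;> try omega
  all_goals first
    | (interval_cases d <;> omega)
    | (interval_cases b <;> omega)

theorem lim_le (l : ℕ) : D.lim l ≤ D.n := by
  unfold lim
  split <;> omega

/-- All tables that are fixed before the enumeration are in memory. -/
structure Tables (D : Data) (s : State) : Prop extends D.Base s where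
  orient : s.nat aOr 0 = D.orient
  cls : ∀ v < D.n, ∀ l < 9, s.nat aCl (v * 16 + l) = D.cls l v
  lim : ∀ l < 9, s.nat aLim l = D.lim l
  target : ∀ q < 4, s.nat aTg q = D.target q

theorem Tables.congr {s s' : State} (h : D.Tables s)
    (hn : ∀ a ∈ [aIn, aPr, aM, aG, aPow, aFx, aNa, aNd, aOr, aCl, aLim, aTg],
      s'.nat a = s.nat a) (hr : ∀ a ∈ [rT], s'.real a = s.real a) : D.Tables s' := by
  have hb : D.Base s' := h.toBase.congr (fun a ha => hn a (by simp at ha ⊢; tauto)) hr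
  obtain ⟨-, b, c, d, e⟩ := h
  simp only [List.forall_mem_cons] at hn
  refine ⟨hb, ?_, ?_, ?_, ?_⟩
  all_goals simpa only [hn]

theorem classStep_exec (hD : D.Ok) {s : State} (hs : D.Base s) (ho : s.nat aOr 0 = D.orient)
    {v : ℕ} (hv : v < D.n) (hA : s.nat iA 0 = v)
    (h : ∀ u < v, ∀ l < 9, s.nat aCl (u * 16 + l) = D.cls l u) :
    Exec D.bits classStep s (1 + (1 + (1 + (1 + (1 + (1 + (1 + (1 + 1))))))))
      fun s' => ∀ u < v + 1, ∀ l < 9, s'.nat aCl (u * 16 + l) = D.cls l u := by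
  have h1 := hs.fx v hv
  have h2 := hs.na v hv
  have h3 := hs.nd v hv
  have h4 := hs.input.gg v hv
  have hb : ∀ l, D.cls l v < 2 ^ D.bits := fun l => lt_bits (by have := hD.cls_le l v; omega)
  refine Exec.setNat_seq ?_ (Exec.setNat_seq ?_ (Exec.setNat_seq ?_ (Exec.setNat_seq ?_
    (Exec.setNat_seq ?_ (Exec.setNat_seq ?_ (Exec.setNat_seq ?_ (Exec.setNat_seq ?_
    (Exec.setNat ?_ ?_))))))))
  · simpa [hA, h1, h2, h3, h4, ho, eFree, cls] using hb 0
  · simpa [hA, h1, h2, h3, h4, ho, eFree, cls] using hb 1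
  · simpa [hA, h1, h2, h3, h4, ho, eFree, cls] using hb 2
  · simpa [hA, h1, h2, h3, h4, ho, eFree, cls] using hb 3
  · simpa [hA, h1, h2, h3, h4, ho, eFree, cls] using hb 4
  · simpa [hA, h1, h2, h3, h4, ho, eFree, cls] using hb 5
  · simpa [hA, h1, h2, h3, h4, ho, eFree, cls] using hb 6
  · simpa [hA, h1, h2, h3, h4, ho, eFree, cls] using hb 7
  · simpa [hA, h1, h2, h3, h4, ho, eFree, cls] using hb 8
  · simp only [State.writeNat_nat_same, State.writeNat_nat_ne, ne_eq,
      not_false_eq_true, Nat.reduceEqDiff, eFree, NExpr.eval_add, NExpr.eval_mul, NExpr.eval_sub,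
      NExpr.eval_mod, NExpr.eval_get, NExpr.eval_ofNat, NExpr.eval_lit, hA, h1, h2, h3, h4, ho]
    intro u hu l hl
    rcases Nat.lt_succ_iff_lt_or_eq.1 hu with hu | rfl
    · have hne : ∀ k < 16, u * 16 + l ≠ v * 16 + k := by omega
      rw [← h u hu l hl]
      iterate 9 rw [Function.update_of_ne (hne _ (by norm_num))]
    · have hne : ∀ a b : ℕ, u * 16 + a = u * 16 + b ↔ a = b := by omega
      simp only [Function.update_apply, hne]
      interval_cases l <;> simp [cls]

theorem limitProg_exec (hD : D.Ok) {s : State} (hs : D.Base s) :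
    Exec D.bits limitProg s (1 + (1 + (1 + (1 + (1 + (1 + (1 + (1 + (1 + (1 + (1 + (1 + 1))))))))))))
      fun s' => (∀ l < 9, s'.nat aLim l = D.lim l) ∧ ∀ q < 4, s'.nat aTg q = D.target q := by
  have h1 := hs.input.n
  have h2 := hs.input.pB
  have h3 := hs.input.pC
  have h4 := hD.pB_le
  have h5 := hD.pC_le
  refine Exec.setNat_seq ?_ (Exec.setNat_seq ?_ (Exec.setNat_seq ?_ (Exec.setNat_seq ?_
    (Exec.setNat_seq ?_ (Exec.setNat_seq ?_ (Exec.setNat_seq ?_ (Exec.setNat_seq ?_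
    (Exec.setNat_seq ?_ (Exec.setNat_seq ?_ (Exec.setNat_seq ?_ (Exec.setNat_seq ?_
    (Exec.setNat ?_ ?_))))))))))))
  iterate 13
    focus
      refine lt_bits ?_
      simp [h1, h2, h3]
      try omega
  constructor
  · intro l hl
    interval_cases l <;> simp [lim, h1, h2, h3]
  · intro q hq
    interval_cases q <;> simp [target, h2, h3]

theorem classProg_exec (hD : D.Ok) {s : State} (hs : D.Base s) (ho : s.nat aOr 0 = D.orient) :
    Exec D.bits classProg s
      ((D.n * ((1 + (1 + (1 + (1 + (1 + (1 + (1 + (1 + 1)))))))) + 2) + 2) +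
        (1 + (1 + (1 + (1 + (1 + (1 + (1 + (1 + (1 + (1 + (1 + (1 + 1))))))))))))) D.Tables := by
  refine Exec.seq (Q₁ := fun s' => ∀ u < D.n, ∀ l < 9, s'.nat aCl (u * 16 + l) = D.cls l u)
    ?_ ?_
  · refine Exec.forLoop D.n _ (fun j s' => ∀ u < j, ∀ l < 9, s'.nat aCl (u * 16 + l) = D.cls l u)
      (by decide) (lt_bits (by omega)) (fun j s x h => by simpa using h) (fun s' h => ?_)
      (by simp) ?_ (fun s' _ h => h)
    · simp [h.1 aIn (by decide), hs.input.n]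
    · intro j hj s' hf hi h
      exact classStep_exec hD (hs.congr (hf.agree _ (by decide)) (hf.agree_real _ (by decide)))
        (by rw [hf.1 _ (by decide), ho]) hj hi h
  · intro s' hf h
    have hb : D.Base s' := hs.congr (hf.agree _ (by decide)) (hf.agree_real _ (by decide))
    refine (limitProg_exec hD hb).mono le_rfl fun s'' hf' h' => ?_
    refine ⟨hb.congr (hf'.agree _ (by decide)) (hf'.agree_real _ (by decide)), ?_, ?_, h'.1, h'.2⟩
    · rw [hf'.1 _ (by decide), hf.1 _ (by decide), ho]
    · rwa [hf'.1 aCl (by decide)]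

end Data
end Sched

namespace Sched

open RealRAM
open RealRAM.NExpr (get var)
open RealRAM.Program (setNat setReal forLoop branch)

namespace Data

variable {D : Data}

/-! ## The enumeration of the set families -/

/-- The list `lst` is stored as list number `l`. -/
structure ListAt (D : Data) (l : ℕ) (lst : List (Finset ℕ)) (s : State) : Prop where
  len : s.nat aLen l = lst.length
  mask : ∀ i (h : i < lst.length), s.nat aL (i * 16 + l) = mask lst[i]
  load : ∀ i (h : i < lst.length), s.nat aCc (i * 16 + l) = load (D.cls l) lst[i]

theorem ListAt.congr {l : ℕ} {lst : List (Finset ℕ)} {s s' : State} (h : D.ListAt l lst s)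
    (hn : ∀ a ∈ [aLen, aL, aCc], s'.nat a = s.nat a) : D.ListAt l lst s' := by
  obtain ⟨a, b, c⟩ := h
  simp only [List.forall_mem_cons] at hn
  constructor <;> simpa only [hn]

def enumStep : Program :=
  branch (.natLE (get aCc (var iC * 16 + var iA) + (get aCl (var iB * 16 + var iA) - 1) +
      (1 - get aCl (var iB * 16 + var iA)) * (get aLim (var iA) + 1)) (get aLim (var iA)))
    (setNat aL (get aLen (var iA) * 16 + var iA)
        (get aL (var iC * 16 + var iA) + get aPow (var iB));;
      setNat aCc (get aLen (var iA) * 16 + var iA)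
        (get aCc (var iC * 16 + var iA) + (get aCl (var iB * 16 + var iA) - 1));;
      setNat aLen (var iA) (get aLen (var iA) + 1))
    .skip

/-- The extended sets are appended to the list that is being scanned. Its old length is saved first,
so that exactly the old sets are scanned. Every list starts with the empty set, whose mask and load
are 0. -/
def enumProg : Program :=
  forLoop iA 9 (
    setNat aLen (var iA) 1;;
    setNat aL (var iA) 0;;
    setNat aCc (var iA) 0;;
    forLoop iB (var aIn) (
      setNat aOld 0 (get aLen (var iA));;
      forLoop iC (var aOld) enumStep))

/-- Appending a set to list number `l`. -/
theorem ListAt.append {l x : ℕ} {lst : List (Finset ℕ)} {S : Finset ℕ} {s : State}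
    (h : D.ListAt l lst s) (hx : x = lst.length + 1) :
    D.ListAt l (lst ++ [S]) (((s.writeNat aL (lst.length * 16 + l) (Sched.mask S)).writeNat aCc
      (lst.length * 16 + l) (Sched.load (D.cls l) S)).writeNat aLen l x) := by
  constructor
  · simp [hx]
  · intro i hi
    rw [List.getElem_append]
    split_ifs with h'
    · simp [h'.ne, h.mask i h']
    · have : i = lst.length := by simp at hi; omega
      simp [this]
  · intro i hi
    rw [List.getElem_append]
    split_ifs with h'
    · simp [h'.ne, h.load i h']
    · have : i = lst.length := by simp at hi; omega
      simp [this]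

theorem ListAt.of_ne {l l' i x y z : ℕ} {lst : List (Finset ℕ)} {s : State}
    (h : D.ListAt l' lst s) (hl : l < 16) (hl' : l' < l) :
    D.ListAt l' lst (((s.writeNat aL (i * 16 + l) x).writeNat aCc
      (i * 16 + l) y).writeNat aLen l z) := by
  constructor
  · have : l' ≠ l := by omega
    simp [this, h.len]
  · intro j hj
    have : j * 16 + l' ≠ i * 16 + l := by omega
    simp [this, h.mask j hj]
  · intro j hj
    have : j * 16 + l' ≠ i * 16 + l := by omega
    simp [this, h.load j hj]

/-- Bounds the intermediate lists of the enumeration by the finished one. -/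
theorem length_enum_mono (c : ℕ → ℕ) (k : ℕ) {m m' : ℕ} (h : m ≤ m') :
    (enum c k m).length ≤ (enum c k m').length := by
  induction m', h using Nat.le_induction with
  | base => exact le_rfl
  | succ m' _ ih => rw [enum, List.length_append]; omega

theorem pow_lt_bits {a x : ℕ} (ha : a ≤ 4 * D.n + 7) (h : x ≤ 2 ^ a) : x < 2 ^ D.bits :=
  h.trans_lt (Nat.pow_lt_pow_right (by norm_num) (by rw [bits]; omega))

theorem enumStep_exec {s : State} (hs : D.Tables s) {l v i : ℕ} (hl : l < 9)
    (hv : v < D.n) (hA : s.nat iA 0 = l) (hB : s.nat iB 0 = v) (hC : s.nat iC 0 = i)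
    (hi : i < (enum (D.cls l) (D.lim l) v).length)
    (h : (∀ l' < l, D.ListAt l' (D.family l') s) ∧ D.ListAt l (enum (D.cls l) (D.lim l) v ++
      extend (D.cls l) (D.lim l) v ((enum (D.cls l) (D.lim l) v).take i)) s) :
    Exec D.bits enumStep s ((1 + (1 + 1)) + 1) fun s' =>
      (∀ l' < l, D.ListAt l' (D.family l') s') ∧ D.ListAt l (enum (D.cls l) (D.lim l) v ++
      extend (D.cls l) (D.lim l) v ((enum (D.cls l) (D.lim l) v).take (i + 1))) s' := by
  obtain ⟨h, hL⟩ := h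
  set E := enum (D.cls l) (D.lim l) v with hE
  set lst := E ++ extend (D.cls l) (D.lim l) v (E.take i) with hlst
  have hi' : i < lst.length := by rw [hlst, List.length_append]; omega
  have hget : lst[i] = E[i] := List.getElem_append_left hi
  have hmem := mem_enum.1 (List.getElem_mem hi)
  have hvE : v ∉ E[i] := fun h => by simpa using (hmem.1 v h).1
  have c1 := hs.cls v hv l hl
  have c2 := hs.lim l hl
  have c3 := hs.pow v hv.le
  have c4 := hL.mask i hi'
  have c5 := hL.load i hi'
  have c6 := hL.len
  rw [hget] at c4 c5
  have hT : (Test.natLE (get aCc (var iC * 16 + var iA) + (get aCl (var iB * 16 + var iA) - 1) +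
      (1 - get aCl (var iB * 16 + var iA)) * (get aLim (var iA) + 1)) (get aLim (var iA))).Holds s ↔
      load (D.cls l) E[i] + (D.cls l v - 1) + (1 - D.cls l v) * (D.lim l + 1) ≤ D.lim l := by
    simp [hA, hB, hC, c1, c2, c5]
  have hlen : lst.length + 1 ≤ 2 ^ (D.n + 1) := by
    have h1 := length_extend_le (D.cls l) (D.lim l) v (E.take i)
    have h2 : E.length ≤ 2 ^ v := length_enum_le _ _ _
    have h3 : 2 ^ (v + 1) ≤ 2 ^ D.n := Nat.pow_le_pow_right (by norm_num) hv
    rw [hlst, List.length_append]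
    simp only [List.length_take] at h1
    have := Nat.one_le_two_pow (n := D.n)
    rw [pow_succ] at h3 ⊢
    omega
  rw [extend_take_succ _ _ _ _ hi, ← List.append_assoc, ← hlst]
  refine Exec.branch (t := 1 + (1 + 1)) (fun hb => ?_) (fun hb => ?_) <;> rw [hT] at hb
  · rw [if_pos hb]
    have hb' := extend_test.1 hb
    have hm : mask (insert v E[i]) = mask E[i] + 2 ^ v := mask_insert hvE
    have hm' : mask (insert v E[i]) < 2 ^ D.n := mask_lt fun w hw => by
      rcases Finset.mem_insert.1 hw with rfl | hw
      · exact hv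
      · exact (hmem.1 w hw).1.trans hv
    have hl' := load_insert (D.cls l) hvE
    have key := hL.append (S := insert v E[i]) (x := lst.length + 1) rfl
    have key' := fun l' (hl'' : l' < l) => (h l' hl'').of_ne (l := l) (i := lst.length)
      (x := mask (insert v E[i])) (y := load (D.cls l) (insert v E[i])) (z := lst.length + 1)
      (by omega) hl''
    refine Exec.setNat_seq ?_ (Exec.setNat_seq ?_ (Exec.setNat ?_ ?_)) <;>
      simp [hA, hB, hC, c1, c3, c4, c5, c6]
    · exact pow_lt_bits (a := D.n) (by omega) (by omega)
    · exact lt_bits (by have := lim_le (D := D) l; omega)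
    · exact pow_lt_bits (a := D.n + 1) (by omega) hlen
    · rw [← hm, ← hl']
      exact ⟨key', key⟩
  · rw [if_neg hb, List.append_nil]
    exact Exec.le (t := 1) (Exec.skip ⟨h, hL⟩) (by norm_num)

theorem enumProg_exec {s : State} (hs : D.Tables s) {N : ℕ}
    (hN : ∀ l < 9, (D.family l).length ≤ N) :
    Exec D.bits enumProg s
      (9 * ((1 + (1 + (1 + (D.n * ((1 + (N * (((1 + (1 + 1)) + 1) + 2) + 2)) + 2) + 2)))) + 2) + 2)
      fun s' => ∀ l < 9, D.ListAt l (D.family l) s' := by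
  refine Exec.forLoop 9 _ (fun j s' => ∀ l < j, D.ListAt l (D.family l) s') (by decide)
    (lt_bits (by omega)) (fun j s x h l hl => (h l hl).congr (by simp)) (fun s' h => ?_)
    (by simp) ?_ (fun s' _ h => h)
  · simp
  intro l hl s₁ hf₁ hA h
  have hs₁ : D.Tables s₁ := hs.congr (hf₁.agree _ (by decide)) (hf₁.agree_real _ (by decide))
  refine Exec.setNat_seq (lt_bits (by simp)) (Exec.setNat_seq (by simp)
    (Exec.setNat_seq (by simp) ?_))
  refine Exec.forLoop D.n _ (fun j s' => (∀ l' < l, D.ListAt l' (D.family l') s') ∧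
    D.ListAt l (enum (D.cls l) (D.lim l) j) s') (by decide)
    (lt_bits (by omega)) (fun j s x h => ⟨fun l hl => (h.1 l hl).congr (by simp),
      h.2.congr (by simp)⟩) (fun s' h => ?_)
    ⟨?_, ?_⟩ ?_ ?_
  · simp [h.1 aIn (by decide), hs₁.input.n]
  · intro l' hl'
    have h' := h l' hl'
    constructor
    · have : l' ≠ l := by omega
      simp [hA, this, h'.len]
    · intro j hj
      have : j * 16 + l' ≠ l := by omega
      simp [hA, this, h'.mask j hj]
    · intro j hj
      have : j * 16 + l' ≠ l := by omega
      simp [hA, this, h'.load j hj]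
  · constructor <;> simp [hA, enum, load]
  · intro v hv s₂ hf₂ hB h₂
    have hA₂ : s₂.nat iA 0 = l := by rw [hf₂.1 _ (by decide)]; simp [hA]
    have hs₂ : D.Tables s₂ := hs₁.congr
      (fun a ha => by
        rw [hf₂.1 a (by revert ha a; decide)]
        have : a ≠ aLen ∧ a ≠ aL ∧ a ≠ aCc := by revert ha a; decide
        simp [this])
      (fun a ha => by
        rw [hf₂.2 a (by revert ha a; decide)]
        simp)
    have hlen : s₂.nat aLen l = (enum (D.cls l) (D.lim l) v).length := h₂.2.len
    have hlen2 : (enum (D.cls l) (D.lim l) v).length ≤ N :=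
      (length_enum_mono _ _ hv.le).trans (hN l hl)
    have hlen3 : (enum (D.cls l) (D.lim l) v).length < 2 ^ D.bits :=
      pow_lt_bits (a := v) (by omega) (length_enum_le _ _ _)
    refine Exec.setNat_seq (by simpa [hA₂, hlen] using hlen3) ?_
    refine Exec.le (t := (enum (D.cls l) (D.lim l) v).length * (((1 + (1 + 1)) + 1) + 2) + 2) ?_
      (by gcongr)
    refine Exec.forLoop (enum (D.cls l) (D.lim l) v).length _
      (fun i s' => (∀ l' < l, D.ListAt l' (D.family l') s') ∧
        D.ListAt l (enum (D.cls l) (D.lim l) v ++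
          extend (D.cls l) (D.lim l) v ((enum (D.cls l) (D.lim l) v).take i)) s') (by decide)
      hlen3 (fun j s x h => ⟨fun l hl => (h.1 l hl).congr (by simp), h.2.congr (by simp)⟩)
      (fun s' h => ?_) ⟨?_, ?_⟩ ?_ ?_
    · rw [NExpr.eval_get, h.1 aOld (by decide)]
      simp [hA₂, hlen]
    · exact fun l' hl' => (h₂.1 l' hl').congr (by simp)
    · simpa [extend] using h₂.2.congr (by simp)
    · intro i hi s₃ hf₃ hC h₃
      refine enumStep_exec (hs₂.congr (fun a ha => ?_) (hf₃.agree_real _ (by decide)))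
        hl hv ?_ ?_ hC hi h₃
      · rw [hf₃.1 a (by revert ha a; decide)]
        have : a ≠ aOld := by revert ha a; decide
        simp [this]
      · rw [hf₃.1 _ (by decide)]; simp [hA₂]
      · rw [hf₃.1 _ (by decide)]; simp [hB]
    · intro s' _ h'
      simpa [enum] using h'
  · intro s' _ h' l' hl'
    rcases Nat.lt_succ_iff_lt_or_eq.1 hl' with h'' | rfl
    · exact h'.1 l' h''
    · exact h'.2

/-! ## Multiples of the processing times -/

/-- The cost involves integer multiples of processing times, but reals can only be added and there
is no conversion from integers. All multiples up to n are therefore tabulated by repeated addition.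
-/
def multProg : Program :=
  forLoop iA (var aIn) (
    setReal rMt (var iA * (var aIn + 1)) .zero;;
    forLoop iB (var aIn)
      (setReal rMt (var iA * (var aIn + 1) + var iB + 1)
        (RExpr.get rMt (var iA * (var aIn + 1) + var iB) + RExpr.get rT (var iA))))

theorem multProg_exec {s : State} (hs : D.Input s) :
    Exec D.bits multProg s (D.n * ((1 + (D.n * (1 + 2) + 2)) + 2) + 2) fun s' =>
      ∀ v < D.n, ∀ k ≤ D.n, s'.real rMt (v * (D.n + 1) + k) = k * D.tt v := by
  have haddr : ∀ u v k j, u < v → k ≤ D.n → u * (D.n + 1) + k ≠ v * (D.n + 1) + j := by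
    intro u v k j huv hk
    have : (u + 1) * (D.n + 1) ≤ v * (D.n + 1) := Nat.mul_le_mul_right _ huv
    rw [add_mul] at this; omega
  refine Exec.forLoop D.n _ (fun j s' => ∀ v < j, ∀ k ≤ D.n,
      s'.real rMt (v * (D.n + 1) + k) = k * D.tt v) (by decide)
    (lt_bits (by omega)) (fun j s x h => by simpa using h) (fun s' h => ?_) (by simp) ?_
    (fun s' _ h => h)
  · simp [h.1 aIn (by decide), hs.n]
  intro v hv s₁ hf₁ hA h
  have hn₁ : s₁.nat aIn 0 = D.n := by rw [hf₁.1 _ (by decide), hs.n]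
  have ht₁ : s₁.real rT v = D.tt v := by rw [hf₁.2 _ (by decide), hs.tt v hv]
  refine Exec.setReal_seq ?_
  refine Exec.forLoop D.n _ (fun j s' => (∀ u < v, ∀ k ≤ D.n,
      s'.real rMt (u * (D.n + 1) + k) = k * D.tt u) ∧
      ∀ k ≤ j, s'.real rMt (v * (D.n + 1) + k) = k * D.tt v) (by decide)
    (lt_bits (by omega)) (fun j s x h => by simpa using h) (fun s' h => ?_) ⟨?_, ?_⟩ ?_ ?_
  · simp [h.1 aIn (by decide), hn₁]
  · intro u hu k hk
    have := haddr u v k 0 hu hk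
    simp [hA, hn₁] at this ⊢
    simp [this, h u hu k hk]
  · simp [hA, hn₁]
  · intro j hj s₂ hf₂ hB h₂
    have hn₂ : s₂.nat aIn 0 = D.n := by rw [hf₂.1 _ (by decide)]; simp [hn₁]
    have hA₂ : s₂.nat iA 0 = v := by rw [hf₂.1 _ (by decide)]; simp [hA]
    have ht₂ : s₂.real rT v = D.tt v := by rw [hf₂.2 _ (by decide)]; simp [ht₁]
    refine Exec.setReal ⟨?_, ?_⟩
    · intro u hu k hk
      have := haddr u v k (j + 1) hu hk
      simp only [← add_assoc] at this
      simp [hA₂, hB, hn₂, this, h₂.1 u hu k hk]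
    · intro k hk
      simp only [NExpr.eval_add, NExpr.eval_mul, NExpr.eval_get, NExpr.eval_lit, NExpr.eval_ofNat,
        RExpr.eval_add, RExpr.eval_get, hA₂, hB, hn₂, ht₂, State.writeReal_real_same,
        Function.update_apply, h₂.2 j le_rfl]
      split_ifs with hk'
      · obtain rfl : k = j + 1 := by omega
        push_cast; ring
      · exact h₂.2 k (by omega)
  · intro s' _ h' u hu
    rcases Nat.lt_succ_iff_lt_or_eq.1 hu with h'' | rfl
    · exact h'.1 u h''
    · exact h'.2

end Data
end Sched

namespace Sched

open RealRAM
open RealRAM.NExpr (get var)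
open RealRAM.Program (setNat setReal forLoop branch)

namespace Data

variable {D : Data}

/-- Everything that is fixed before the dynamic program is in memory. -/
structure Ready (D : Data) (s : State) : Prop extends D.Tables s where
  lists : ∀ l < 9, D.ListAt l (D.family l) s
  mult : ∀ v < D.n, ∀ k ≤ D.n, s.real rMt (v * (D.n + 1) + k) = k * D.tt v

theorem Ready.congr {s s' : State} (h : D.Ready s)
    (hn : ∀ a ∈ [aIn, aPr, aM, aG, aPow, aFx, aNa, aNd, aOr, aCl, aLim, aTg, aLen, aL, aCc],
      s'.nat a = s.nat a) (hr : ∀ a ∈ [rT, rMt], s'.real a = s.real a) : D.Ready s' := by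
  refine ⟨h.toTables.congr (fun a ha => hn a (by simp at ha ⊢; tauto))
    (fun a ha => hr a (by simp at ha ⊢; tauto)),
    fun l hl => (h.lists l hl).congr (fun a ha => hn a (by simp at ha ⊢; tauto)), ?_⟩
  rw [hr rMt (by simp)]
  exact h.mult

/-! ## The dynamic program for the quarters -/

/-- Digit number `v` of `m`. -/
def eBit (m v : NExpr) : NExpr := m / get aPow v % 2

theorem eval_eBit {s : State} {m v : NExpr} {S : Finset ℕ} {u : ℕ} (hu : u ≤ D.n)
    (hp : ∀ v ≤ D.n, s.nat aPow v = 2 ^ v) (hm : m.eval s = mask S) (hv : v.eval s = u) :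
    (eBit m v).eval s = if u ∈ S then 1 else 0 := by
  simp [eBit, hm, hv, hp u hu, mask_bit]

/-- The table is sparse: cells of sets outside the families are never consulted, so it needs no
initialisation of exponential cost. -/
def eAddr : NExpr := var aS * 4 + var iA

def dpUpdate : Program :=
  setReal rH eAddr (RExpr.get rC 0);;
  setNat aBp eAddr (var iC);;
  setNat aFd 0 1

def dpBlock : Program :=
  setNat aBl 0 0;;
  forLoop iD (var aIn)
    (setNat aBl 0 (var aBl + eBit (var aS) (var iD) * get aPr (var iC * var aIn + var iD)))

def dpTry : Program :=
  setReal rC 0 (RExpr.get rH ((var aS - get aPow (var iC)) * 4 + var iA) +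
    RExpr.get rMt (var iC * (var aIn + 1) +
      (var aIn - (var iA * (var aIn / 4) + (var aSz - 1)))));;
  branch (.natLE (var aFd) 0) dpUpdate
    (branch (.neg (.realLE (RExpr.get rH eAddr) (RExpr.get rC 0))) dpUpdate .skip)

def dpJob : Program :=
  branch (.natLE 1 (eBit (var aS) (var iC)))
    (dpBlock;; branch (.natLE (var aBl) 0) dpTry .skip) .skip

def dpSize : Program :=
  setNat aSz 0 0;;
  forLoop iC (var aIn) (setNat aSz 0 (var aSz + eBit (var aS) (var iC)))

def dpStep : Program :=
  setNat aS 0 (get aL (var iB * 16 + var iA));;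
  dpSize;;
  setReal rH eAddr .zero;;
  setNat aFd 0 0;;
  forLoop iC (var aIn) dpJob

def dpProg : Program := forLoop iA 4 (forLoop iB (get aLen (var iA)) dpStep)

/-- `v` can be the last job of `S`. -/
def Last (D : Data) (S : Finset ℕ) (v : ℕ) : Prop := v ∈ S ∧ ∀ u ∈ S, D.pr v u = 0

/-- The contribution of job `v` in position `p` of quarter `q` to the cost. -/
noncomputable def posCost (D : Data) (q p v : ℕ) : ℝ := ((D.n - (q * (D.n / 4) + p) : ℕ) : ℝ) * D.tt v

/-- The value of `S` when `v` is its last job, computed from the table `H`. -/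
noncomputable def cand (D : Data) (H : ℕ → ℝ) (q : ℕ) (S : Finset ℕ) (v : ℕ) : ℝ :=
  H (mask (S.erase v) * 4 + q) + D.posCost q (S.card - 1) v

/-- `x` and `y` are the best value and the best last job among the jobs `< j`. -/
def Best (D : Data) (H : ℕ → ℝ) (q : ℕ) (S : Finset ℕ) (j : ℕ) (f : ℕ) (x : ℝ) (y : ℕ) : Prop :=
  -- The default 0 is the correct final value for the empty set. For data coming from a branch,
  -- every nonempty set of jobs has a possible last job.
  (f = 0 ∧ x = 0 ∧ ∀ v < j, ¬ D.Last S v) ∨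
  (f = 1 ∧ D.Last S y ∧ x = D.cand H q S y ∧ ∀ v < j, D.Last S v → x ≤ D.cand H q S v)

theorem dpBlock_exec {s : State} (hs : D.Base s) {S : Finset ℕ} {v : ℕ}
    (hv : v < D.n) (hpr : ∀ u w, D.pr u w ≤ 1) (hS : s.nat aS 0 = mask S) (hC : s.nat iC 0 = v) :
    Exec D.bits dpBlock s (1 + (D.n * (1 + 2) + 2)) fun s' =>
      s'.nat aBl 0 = ∑ u ∈ Finset.range D.n, (if u ∈ S then 1 else 0) * D.pr v u := by
  refine Exec.setNat_seq (lt_bits (by simp)) ?_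
  have hle : ∀ j, ∑ u ∈ Finset.range j, (if u ∈ S then 1 else 0) * D.pr v u ≤ j := by
    intro j
    have := Finset.sum_le_card_nsmul (Finset.range j)
      (fun u => (if u ∈ S then 1 else 0) * D.pr v u) 1
      (fun u _ => by have := hpr v u; split_ifs <;> omega)
    simpa using this
  refine Exec.forLoop D.n _ (fun j s' =>
      s'.nat aBl 0 = ∑ u ∈ Finset.range j, (if u ∈ S then 1 else 0) * D.pr v u) (by decide)
    (lt_bits (by omega)) (fun j s x h => by simpa using h) (fun s' h => ?_) (by simp) ?_
    (fun s' _ h => h)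
  · simp [h.1 aIn (by decide), hs.input.n]
  intro j hj s₁ hf hD h
  have e1 : s₁.nat aIn 0 = D.n := by rw [hf.1 _ (by decide)]; simp [hs.input.n]
  have e2 : s₁.nat aS 0 = mask S := by rw [hf.1 _ (by decide)]; simp [hS]
  have e3 : s₁.nat iC 0 = v := by rw [hf.1 _ (by decide)]; simp [hC]
  have e4 : ∀ v ≤ D.n, s₁.nat aPow v = 2 ^ v := by rw [hf.1 _ (by decide)]; simpa using hs.pow
  have e5 : s₁.nat aPr (v * D.n + j) = D.pr v j := by
    rw [hf.1 _ (by decide)]; simpa using hs.input.pr v hv j hj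
  have e6 := eval_eBit (D := D) (s := s₁) (m := var aS) (v := var iD) hj.le e4 (by simpa using e2)
    (by simpa using hD)
  have e7 : NExpr.eval s₁ (var aBl + eBit (var aS) (var iD) * get aPr (var iC * var aIn + var iD))
      = ∑ u ∈ Finset.range (j + 1), (if u ∈ S then 1 else 0) * D.pr v u := by
    rw [Finset.sum_range_succ, NExpr.eval_add, NExpr.eval_mul, e6]
    simp [e1, e3, hD, e5, h]
  refine Exec.setNat ?_ ?_
  · rw [e7]; exact lt_bits (by have := hle (j + 1); omega)
  · rw [e7]; simp

theorem last_iff_sum {S : Finset ℕ} {v : ℕ} (hS : ∀ u ∈ S, u < D.n) :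
    D.Last S v ↔
      v ∈ S ∧ ∑ u ∈ Finset.range D.n, (if u ∈ S then 1 else 0) * D.pr v u ≤ 0 := by
  rw [Last, Nat.le_zero, Finset.sum_eq_zero_iff]
  refine and_congr_right fun _ => ⟨fun h u _ => ?_, fun h u hu => ?_⟩
  · split_ifs with hu
    · simp [h u hu]
    · simp
  · simpa [hu] using h u (Finset.mem_range.2 (hS u hu))

/-- The current tables are described as the tables from before the treatment of S with one cell
changed, so all candidates for S are compared through the same function `H`. -/
theorem dpJob_exec (hpr : ∀ u w, D.pr u w ≤ 1) {H : ℕ → ℝ} {P : ℕ → ℕ} {s : State} (hs : D.Ready s)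
    {S : Finset ℕ} {q v : ℕ} (hSn : ∀ u ∈ S, u < D.n) (hv : v < D.n) (hS : s.nat aS 0 = mask S)
    (hA : s.nat iA 0 = q) (hC : s.nat iC 0 = v) (hz : s.nat aSz 0 = S.card)
    (h : ∃ f x y, s.nat aFd 0 = f ∧ s.real rH = Function.update H (mask S * 4 + q) x ∧
      s.nat aBp = Function.update P (mask S * 4 + q) y ∧ D.Best H q S v f x y) :
    Exec D.bits dpJob s
      (((1 + (D.n * (1 + 2) + 2)) + ((1 + (((1 + (1 + 1)) + 1) + 1)) + 1)) + 1) fun s' =>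
      ∃ f x y, s'.nat aFd 0 = f ∧ s'.real rH = Function.update H (mask S * 4 + q) x ∧
      s'.nat aBp = Function.update P (mask S * 4 + q) y ∧ D.Best H q S (v + 1) f x y := by
  obtain ⟨f, x, y, hf, hx, hy, h⟩ := h
  have hbit := eval_eBit (D := D) (s := s) (m := var aS) (v := var iC) hv.le hs.pow
    (by simpa using hS) (by simpa using hC)
  have hskip : ¬ D.Last S v → D.Best H q S (v + 1) f x y := by
    intro hl
    rcases h with ⟨h1, h2, h3⟩ | ⟨h1, h2, h3, h4⟩
    · refine .inl ⟨h1, h2, fun u hu => ?_⟩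
      rcases Nat.lt_succ_iff_lt_or_eq.1 hu with hu | rfl
      exacts [h3 u hu, hl]
    · refine .inr ⟨h1, h2, h3, fun u hu hu' => ?_⟩
      rcases Nat.lt_succ_iff_lt_or_eq.1 hu with hu | rfl
      exacts [h4 u hu hu', absurd hu' hl]
  refine Exec.branch (t := _ + _) (fun hb => ?_) (fun hb => ?_) <;>
    rw [Test.holds_natLE, hbit, NExpr.eval_ofNat] at hb
  swap
  · refine Exec.le (t := 1) (Exec.skip ⟨f, x, y, hf, hx, hy, hskip fun hl => hb ?_⟩) (by omega)
    simp [hl.1]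
  have hvS : v ∈ S := by by_contra hc; simp [hc] at hb
  refine Exec.seq (dpBlock_exec hs.toBase hv hpr hS hC) fun s₁ hf₁ h₁ => ?_
  have hs₁ : D.Ready s₁ := hs.congr (hf₁.agree _ (by decide)) (hf₁.agree_real _ (by decide))
  have k1 : s₁.nat aFd 0 = f := by rw [hf₁.1 _ (by decide), hf]
  have k2 : s₁.real rH = Function.update H (mask S * 4 + q) x := by rw [hf₁.2 _ (by decide), hx]
  have k3 : s₁.nat aBp = Function.update P (mask S * 4 + q) y := by rw [hf₁.1 _ (by decide), hy]
  have k4 : s₁.nat aS 0 = mask S := by rw [hf₁.1 _ (by decide), hS]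
  have k5 : s₁.nat iA 0 = q := by rw [hf₁.1 _ (by decide), hA]
  have k6 : s₁.nat iC 0 = v := by rw [hf₁.1 _ (by decide), hC]
  have k7 : s₁.nat aSz 0 = S.card := by rw [hf₁.1 _ (by decide), hz]
  refine Exec.branch (t := 1 + (((1 + (1 + 1)) + 1) + 1)) (fun hb' => ?_) (fun hb' => ?_) <;>
    rw [Test.holds_natLE, NExpr.eval_get, NExpr.eval_lit, h₁, NExpr.eval_ofNat] at hb'
  swap
  · exact Exec.le (t := 1) (Exec.skip ⟨f, x, y, k1, k2, k3, hskip fun hl =>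
      hb' ((last_iff_sum hSn).1 hl).2⟩) (by omega)
  have hlast : D.Last S v := (last_iff_sum hSn).2 ⟨hvS, hb'⟩
  -- The value read belongs to a proper subset, hence to a smaller mask, so the cell under
  -- construction is not consulted.
  have haddr : mask (S.erase v) * 4 + q ≠ mask S * 4 + q := by
    have := mask_erase_lt hvS
    omega
  refine Exec.setReal_seq ?_
  have hval : RExpr.eval s₁ (RExpr.get rH ((var aS - get aPow (var iC)) * 4 + var iA) +
    RExpr.get rMt (var iC * (var aIn + 1) +
      (var aIn - (var iA * (var aIn / 4) + (var aSz - 1))))) = D.cand H q S v := by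
    have hm := mask_erase hvS
    simp only [RExpr.eval_add, RExpr.eval_get, NExpr.eval_add, NExpr.eval_mul, NExpr.eval_sub,
      NExpr.eval_get, NExpr.eval_lit, NExpr.eval_ofNat, NExpr.eval_div, k4, k5, k6, k7,
      hs₁.pow v hv.le, hs₁.input.n, ← hm, k2, Function.update_of_ne haddr,
      hs₁.mult v hv _ (Nat.sub_le _ _)]
    rfl
  rw [hval]
  set s₂ := s₁.writeReal rC (NExpr.eval s₁ 0) (D.cand H q S v) with hs₂
  have m1 : s₂.nat = s₁.nat := rfl
  have m2 : s₂.real rH = Function.update H (mask S * 4 + q) x := by simp [hs₂, k2]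
  have m3 : s₂.real rC 0 = D.cand H q S v := by simp [hs₂]
  have hupd : D.Best H q S (v + 1) 1 (D.cand H q S v) v →
      Exec D.bits dpUpdate s₂ (1 + (1 + 1)) fun s' =>
      ∃ f x y, s'.nat aFd 0 = f ∧ s'.real rH = Function.update H (mask S * 4 + q) x ∧
      s'.nat aBp = Function.update P (mask S * 4 + q) y ∧ D.Best H q S (v + 1) f x y := by
    intro hbest
    refine Exec.setReal_seq (Exec.setNat_seq ?_ (Exec.setNat ?_ ⟨1, D.cand H q S v, v, ?_, ?_, ?_,
      hbest⟩)) <;> simp [eAddr, m1, m2, m3, k3, k4, k5, k6]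
    · exact lt_bits (by omega)
    · simp [bits]
  refine Exec.branch (t := (1 + (1 + 1)) + 1) (fun hb => ?_) (fun hb => ?_) <;>
    rw [Test.holds_natLE, NExpr.eval_get, NExpr.eval_lit, NExpr.eval_ofNat, m1, k1] at hb
  · refine Exec.le (hupd (.inr ⟨rfl, hlast, rfl, fun u hu hul => ?_⟩)) (by omega)
    rcases h with ⟨-, -, h3⟩ | ⟨h1, -⟩
    · rcases Nat.lt_succ_iff_lt_or_eq.1 hu with hu | rfl
      exacts [absurd hul (h3 u hu), le_rfl]
    · omega
  · rcases h with ⟨h1, -⟩ | ⟨h1, h2, h3, h4⟩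
    · omega
    refine Exec.branch (t := 1 + (1 + 1)) (fun hb => ?_) (fun hb => ?_) <;>
      simp [eAddr, m1, m2, m3, k4, k5] at hb
    · refine hupd (.inr ⟨rfl, hlast, rfl, fun u hu hul => ?_⟩)
      rcases Nat.lt_succ_iff_lt_or_eq.1 hu with hu | rfl
      exacts [hb.le.trans (h4 u hu hul), le_rfl]
    · refine Exec.le (t := 1) (Exec.skip ⟨1, x, y, by rw [m1, k1, h1], m2, by rw [m1, k3], .inr
        ⟨rfl, h2, h3, fun u hu hul => ?_⟩⟩) (by omega)
      rcases Nat.lt_succ_iff_lt_or_eq.1 hu with hu | rfl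
      exacts [h4 u hu hul, hb]

theorem dpSize_exec {s : State} (hs : D.Base s) {S : Finset ℕ} (hSn : ∀ u ∈ S, u < D.n)
    (hS : s.nat aS 0 = mask S) :
    Exec D.bits dpSize s (1 + (D.n * (1 + 2) + 2)) fun s' => s'.nat aSz 0 = S.card := by
  refine Exec.setNat_seq (lt_bits (by simp)) ?_
  have hle : ∀ j, ∑ u ∈ Finset.range j, (if u ∈ S then 1 else 0) ≤ j := by
    intro j
    have := Finset.sum_le_card_nsmul (Finset.range j)
      (fun u => (if u ∈ S then 1 else 0)) 1 (fun u _ => by split_ifs <;> omega)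
    simpa using this
  refine Exec.forLoop D.n _ (fun j s' =>
      s'.nat aSz 0 = ∑ u ∈ Finset.range j, (if u ∈ S then 1 else 0)) (by decide)
    (lt_bits (by omega)) (fun j s x h => by simpa using h) (fun s' h => ?_) (by simp) ?_
    (fun s' _ h => ?_)
  · simp [h.1 aIn (by decide), hs.input.n]
  · intro j hj s₁ hf hC h
    have e2 : s₁.nat aS 0 = mask S := by rw [hf.1 _ (by decide)]; simp [hS]
    have e4 : ∀ v ≤ D.n, s₁.nat aPow v = 2 ^ v := by rw [hf.1 _ (by decide)]; simpa using hs.pow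
    have e6 := eval_eBit (D := D) (s := s₁) (m := var aS) (v := var iC) hj.le e4
      (by simpa using e2) (by simpa using hC)
    have e7 : NExpr.eval s₁ (var aSz + eBit (var aS) (var iC))
        = ∑ u ∈ Finset.range (j + 1), (if u ∈ S then 1 else 0) := by
      rw [Finset.sum_range_succ, NExpr.eval_add, e6]
      simp [h]
    refine Exec.setNat ?_ ?_
    · rw [e7]; exact lt_bits (by have := hle (j + 1); omega)
    · rw [e7]; simp
  · rw [h, Finset.sum_ite_mem, Finset.inter_eq_right.2 fun u hu => Finset.mem_range.2 (hSn u hu)]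
    simp

/-- The tables are correct at the set `S` of quarter `q`. -/
def DpOk (D : Data) (q : ℕ) (S : Finset ℕ) (H : ℕ → ℝ) (P : ℕ → ℕ) : Prop :=
  ∃ f, D.Best H q S D.n f (H (mask S * 4 + q)) (P (mask S * 4 + q))

/-- Number of steps of `dpStep`. -/
def dpTime (n : ℕ) : ℕ := 1 + ((1 + (n * (1 + 2) + 2)) + (1 + (1 + (n *
  ((((1 + (n * (1 + 2) + 2)) + ((1 + (((1 + (1 + 1)) + 1) + 1)) + 1)) + 1) + 2) + 2))))

theorem dpStep_exec (hpr : ∀ u w, D.pr u w ≤ 1) {s : State} (hs : D.Ready s)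
    {q i : ℕ} (hq : q < 4) (hi : i < (D.family q).length)
    (hA : s.nat iA 0 = q) (hB : s.nat iB 0 = i) :
    Exec D.bits dpStep s (dpTime D.n) fun s' => ∃ f x y,
      s'.real rH = Function.update (s.real rH) (mask (D.family q)[i] * 4 + q) x ∧
      s'.nat aBp = Function.update (s.nat aBp) (mask (D.family q)[i] * 4 + q) y ∧
      D.Best (s.real rH) q (D.family q)[i] D.n f x y := by
  have hSn : ∀ u ∈ (D.family q)[i], u < D.n := fun u hu =>
    ((mem_enum.1 (List.getElem_mem hi)).1 u hu).1
  have hL := (hs.lists q (by omega)).mask i hi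
  set S := (D.family q)[i] with hS
  refine Exec.setNat_seq ?_ ?_
  · simp only [NExpr.eval_add, NExpr.eval_mul, NExpr.eval_get, NExpr.eval_lit, NExpr.eval_ofNat,
      hA, hB, hL]
    exact pow_lt_bits (a := D.n) (by omega) (mask_lt hSn).le
  set s₁ := s.writeNat aS _ _ with hs₁
  have r₁ : D.Ready s₁ := hs.congr (fun a ha => State.writeNat_nat_ne _ _ _
    (by revert ha a; decide)) (fun a ha => rfl)
  have b1 : s₁.nat aS 0 = mask S := by simp [hs₁, hA, hB, hL]
  have b2 : s₁.nat aBp = s.nat aBp := by simp [hs₁]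
  have b3 : s₁.nat iA 0 = q := by simp [hs₁, hA]
  have b4 : s₁.real rH = s.real rH := rfl
  clear_value s₁
  refine Exec.seq (dpSize_exec r₁.toBase hSn b1) fun s₂ hf₂ h₂ => ?_
  refine Exec.setReal_seq (Exec.setNat_seq (lt_bits (by simp)) ?_)
  set s₃ := (s₂.writeReal rH _ _).writeNat aFd _ _ with hs₃
  have r₃ : D.Ready s₃ := r₁.congr
    (fun a ha => (State.writeNat_nat_ne _ _ _ (by revert ha a; decide)).trans
      (hf₂.1 a (by revert ha a; decide)))
    (fun a ha => (State.writeReal_real_ne _ _ _ (by revert ha a; decide)).trans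
      (hf₂.2 a (by revert ha a; decide)))
  have c1 : s₃.nat aS 0 = mask S := by simp [hs₃, hf₂.1 aS (by decide), b1]
  have c2 : s₃.nat aBp = s.nat aBp := by simp [hs₃, hf₂.1 aBp (by decide), b2]
  have c3 : s₃.nat iA 0 = q := by simp [hs₃, hf₂.1 iA (by decide), b3]
  have c4 : s₃.real rH = Function.update (s.real rH) (mask S * 4 + q) 0 := by
    simp [hs₃, eAddr, hf₂.1 aS (by decide), hf₂.1 iA (by decide), hf₂.2 rH (by decide), b1, b3, b4]
  have c5 : s₃.nat aFd 0 = 0 := by simp [hs₃]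
  have c6 : s₃.nat aSz 0 = S.card := by simp [hs₃, h₂]
  clear_value s₃
  refine Exec.forLoop D.n _ (fun j s' => ∃ f x y, s'.nat aFd 0 = f ∧
      s'.real rH = Function.update (s.real rH) (mask S * 4 + q) x ∧
      s'.nat aBp = Function.update (s.nat aBp) (mask S * 4 + q) y ∧
      D.Best (s.real rH) q S j f x y) (by decide)
    (lt_bits (by omega)) (fun j s x h => by simpa using h) (fun s' h => ?_)
    ⟨0, 0, s.nat aBp (mask S * 4 + q), c5, c4, by rw [c2, Function.update_eq_self],
      .inl ⟨rfl, rfl, by simp⟩⟩ ?_ ?_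
  · simp [h.1 aIn (by decide), r₃.input.n]
  · intro j hj s₄ hf₄ hC h₄
    exact dpJob_exec hpr (r₃.congr (hf₄.agree _ (by decide)) (hf₄.agree_real _ (by decide))) hSn hj
      (by rw [hf₄.1 _ (by decide), c1]) (by rw [hf₄.1 _ (by decide), c3]) hC
      (by rw [hf₄.1 _ (by decide), c6]) h₄
  · rintro s' - ⟨f, x, y, -, h2, h3, h4⟩
    exact ⟨f, x, y, h2, h3, h4⟩

/-- Correctness at T involves only cells of its quarter with mask at most that of T. A later write
goes to another residue modulo 4 or, by the order of the enumeration, to a larger mask. -/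
theorem DpOk.update {q q' : ℕ} {S T : Finset ℕ} {H : ℕ → ℝ} {P : ℕ → ℕ} (h : D.DpOk q' T H P)
    (hq : q < 4) (hq' : q' < 4) (hST : q' ≠ q ∨ mask T < mask S) (x : ℝ) (y : ℕ) :
    D.DpOk q' T (Function.update H (mask S * 4 + q) x) (Function.update P (mask S * 4 + q) y) := by
  have hne : ∀ U : Finset ℕ, mask U ≤ mask T → mask U * 4 + q' ≠ mask S * 4 + q := by omega
  have hc : ∀ v, D.Last T v → D.cand (Function.update H (mask S * 4 + q) x) q' T v =
      D.cand H q' T v := by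
    intro v hv
    rw [cand, cand, Function.update_of_ne (hne _ (mask_erase_lt hv.1).le)]
  obtain ⟨f, h⟩ := h
  refine ⟨f, ?_⟩
  rw [Function.update_of_ne (hne _ le_rfl), Function.update_of_ne (hne _ le_rfl)]
  rcases h with h | ⟨h1, h2, h3, h4⟩
  · exact .inl h
  · refine .inr ⟨h1, h2, by rw [hc _ h2, h3], fun v hv hl => ?_⟩
    rw [hc _ hl]
    exact h4 v hv hl

theorem Best.dpOk {q f : ℕ} {S : Finset ℕ} {H : ℕ → ℝ} {x : ℝ} {y : ℕ} {P : ℕ → ℕ}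
    (h : D.Best H q S D.n f x y) :
    D.DpOk q S (Function.update H (mask S * 4 + q) x) (Function.update P (mask S * 4 + q) y) := by
  have hc : ∀ v, D.Last S v → D.cand (Function.update H (mask S * 4 + q) x) q S v =
      D.cand H q S v := by
    intro v hv
    have := mask_erase_lt hv.1
    rw [cand, cand, Function.update_of_ne (by omega)]
  refine ⟨f, ?_⟩
  rw [Function.update_self, Function.update_self]
  rcases h with h | ⟨h1, h2, h3, h4⟩
  · exact .inl h
  · refine .inr ⟨h1, h2, by rw [hc _ h2, h3], fun v hv hl => ?_⟩
    rw [hc _ hl]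
    exact h4 v hv hl

theorem dpProg_exec (hpr : ∀ u w, D.pr u w ≤ 1) {s : State} (hs : D.Ready s) {N : ℕ}
    (hN : ∀ l < 9, (D.family l).length ≤ N) :
    Exec D.bits dpProg s (4 * ((N * (dpTime D.n + 2) + 2) + 2) + 2) fun s' =>
      ∀ q < 4, ∀ S ∈ D.family q, D.DpOk q S (s'.real rH) (s'.nat aBp) := by
  refine Exec.forLoop 4 _ (fun j s' => ∀ q < j, ∀ S ∈ D.family q,
      D.DpOk q S (s'.real rH) (s'.nat aBp)) (by decide)
    (lt_bits (by omega)) (fun j s x h => by simpa using h) (fun s' h => by simp)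
    (by simp) ?_ (fun s' _ h => h)
  intro q hq s₁ hf₁ hA h
  have r₁ : D.Ready s₁ := hs.congr (hf₁.agree _ (by decide)) (hf₁.agree_real _ (by decide))
  have hlen := (r₁.lists q (by omega)).len
  refine Exec.le (t := (D.family q).length * (dpTime D.n + 2) + 2) ?_
    (by have := hN q (by omega); gcongr)
  refine Exec.forLoop (D.family q).length _ (fun i s' => (∀ q' < q, ∀ S ∈ D.family q',
      D.DpOk q' S (s'.real rH) (s'.nat aBp)) ∧ ∀ S ∈ (D.family q).take i,
      D.DpOk q S (s'.real rH) (s'.nat aBp)) (by decide)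
    (pow_lt_bits (a := D.n) (by omega) (length_enum_le _ _ _))
    (fun j s x h => by simpa using h) (fun s' h => ?_) ⟨h, by simp⟩ ?_ ?_
  · simp [h.1 aLen (by decide), h.1 iA (by decide), hA, hlen]
  · intro i hi s₂ hf₂ hB h₂
    refine (dpStep_exec hpr (r₁.congr (hf₂.agree _ (by decide)) (hf₂.agree_real _ (by decide)))
      hq hi (by rw [hf₂.1 _ (by decide), hA]) hB).mono le_rfl ?_
    rintro s₃ - ⟨f, x, y, hx, hy, hb⟩
    rw [hx, hy]
    refine ⟨fun q' hq' S hS => (h₂.1 q' hq' S hS).update hq (by omega) (.inl (by omega)) _ _,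
      fun S hS => ?_⟩
    rw [List.take_succ_eq_append_getElem hi, List.mem_append, List.mem_singleton] at hS
    rcases hS with hS | rfl
    · refine (h₂.2 S hS).update hq hq (.inr ?_) _ _
      obtain ⟨j, hj, rfl⟩ := List.mem_take_iff_getElem.1 hS
      exact List.pairwise_iff_getElem.1 (enum_sorted _ _ _) _ _ _ _ (by omega)
    · exact hb.dpOk
  · intro s' _ h' q' hq'
    rcases Nat.lt_succ_iff_lt_or_eq.1 hq' with h'' | rfl
    · exact h'.1 q' h''
    · simpa using h'.2

end Data
end Sched

namespace Sched

open RealRAM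
open RealRAM.NExpr (get var)
open RealRAM.Program (setNat setReal forLoop branch)

namespace Data

variable {D : Data}

/-! ## Colourings of the jobs by quarters -/

/-- The quarter of `v`: the jobs of `X` go to the second quarter, the jobs of `Z` to the third, and
the other free jobs to the first half or the second half according to `m`. -/
def col (D : Data) (X Z m : Finset ℕ) (v : ℕ) : ℕ :=
  if D.fx v = 1 then D.gg v else if v ∈ X then 1 else if v ∈ Z then 2 else
    -- In the first half this is A unless v lies in P^{¬A}; in the second half it is D unless v lies
    -- in P^{¬D}.
    if v ∈ m then D.na v else 3 - D.nd v

/-- The jobs `< j` placed in quarter `q`. -/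
def partTo (D : Data) (X Z m : Finset ℕ) (j q : ℕ) : Finset ℕ :=
  (Finset.range j).filter fun v => D.col X Z m v = q

/-- `1` for the free jobs that are not exceptional in quarter `q`. -/
def regular (D : Data) (q v : ℕ) : ℕ :=
  -- By truncation the coefficient of `na` is 1 exactly in the first half and that of `nd` exactly
  -- in the second.
  (1 - D.fx v) * ((1 - (q - 1)) * D.na v + (1 - (2 - q)) * D.nd v)

theorem Ok.col_le (hD : D.Ok) (X Z m : Finset ℕ) (v : ℕ) : D.col X Z m v ≤ 3 := by
  have h2 := D.na_le v
  have h4 := hD.gg_le v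
  unfold col
  split_ifs <;> omega

theorem Ok.regular_le (q v : ℕ) : D.regular q v ≤ 2 := by
  have h2 := D.na_le v
  have h3 := D.nd_le v
  calc _ ≤ 1 * (1 * 1 + 1 * 1) := by unfold regular; gcongr <;> omega
    _ = 2 := rfl

theorem partTo_succ (X Z m : Finset ℕ) (j q : ℕ) : D.partTo X Z m (j + 1) q =
    if D.col X Z m j = q then insert j (D.partTo X Z m j q) else D.partTo X Z m j q := by
  rw [partTo, Finset.range_add_one, Finset.filter_insert]; rfl

theorem notMem_partTo (X Z m : Finset ℕ) (j q : ℕ) : j ∉ D.partTo X Z m j q := by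
  simp [partTo]

theorem partTo_lt {X Z m : Finset ℕ} {j q v : ℕ} (h : v ∈ D.partTo X Z m j q) : v < j :=
  Finset.mem_range.1 (Finset.mem_filter.1 h).1

theorem card_partTo_le (X Z m : Finset ℕ) (j q : ℕ) : (D.partTo X Z m j q).card ≤ j :=
  (Finset.card_filter_le _ _).trans (by simp)

theorem sum_regular_le (X Z m : Finset ℕ) (j q : ℕ) :
    ∑ v ∈ D.partTo X Z m j q, D.regular q v ≤ 2 * j := by
  refine (Finset.sum_le_card_nsmul (D.partTo X Z m j q) _ 2 fun v _ =>
    Ok.regular_le (D := D) q v).trans ?_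
  have := card_partTo_le (D := D) X Z m j q
  rw [smul_eq_mul]; omega

def eCol : NExpr :=
  get aFx (var iC) * get aG (var iC) + (1 - get aFx (var iC)) *
    (eBit (var aX) (var iC) + (1 - eBit (var aX) (var iC)) *
      (eBit (var aZ) (var iC) * 2 + (1 - eBit (var aZ) (var iC)) *
        (eBit (var aMm) (var iC) * get aNa (var iC) +
          (1 - eBit (var aMm) (var iC)) * (3 - get aNd (var iC)))))

def eRegular : NExpr :=
  (1 - get aFx (var iC)) * ((1 - (var aD - 1)) * get aNa (var iC) +
    (1 - (2 - var aD)) * get aNd (var iC))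

def colorStep : Program :=
  setNat aD 0 eCol;;
  setNat aQ (var aD) (get aQ (var aD) + get aPow (var iC));;
  setNat aSp (var aD) (get aSp (var aD) + eRegular);;
  setNat aCn (var aD) (get aCn (var aD) + 1)

def colorProg : Program :=
  forLoop iD 4 (setNat aQ (var iD) 0;; setNat aSp (var iD) 0;; setNat aCn (var iD) 0);;
  forLoop iC (var aIn) colorStep

/-- The colouring `col X Z m`, restricted to the jobs `< j`, is in memory. -/
structure Colored (D : Data) (X Z m : Finset ℕ) (j : ℕ) (s : State) : Prop where
  q : ∀ q < 4, s.nat aQ q = mask (D.partTo X Z m j q)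
  sp : ∀ q < 4, s.nat aSp q = ∑ v ∈ D.partTo X Z m j q, D.regular q v
  cn : ∀ q < 4, s.nat aCn q = (D.partTo X Z m j q).card

theorem colorStep_exec (hD : D.Ok) {s : State} (hs : D.Base s) {X Z m : Finset ℕ} {j : ℕ}
    (hj : j < D.n) (hX : s.nat aX 0 = mask X) (hZ : s.nat aZ 0 = mask Z)
    (hm : s.nat aMm 0 = mask m) (hC : s.nat iC 0 = j) (h : D.Colored X Z m j s) :
    Exec D.bits colorStep s (1 + (1 + (1 + 1))) (D.Colored X Z m (j + 1)) := by
  have e1 := eval_eBit (D := D) (s := s) (m := var aX) (v := var iC) hj.le hs.pow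
    (by simpa using hX) (by simpa using hC)
  have e2 := eval_eBit (D := D) (s := s) (m := var aZ) (v := var iC) hj.le hs.pow
    (by simpa using hZ) (by simpa using hC)
  have e3 := eval_eBit (D := D) (s := s) (m := var aMm) (v := var iC) hj.le hs.pow
    (by simpa using hm) (by simpa using hC)
  have f1 := hs.fx j hj
  have f2 := hs.na j hj
  have f3 := hs.nd j hj
  have f4 := hs.input.gg j hj
  have ecol : NExpr.eval s eCol = D.col X Z m j := by
    simp only [eCol, NExpr.eval_add, NExpr.eval_mul, NExpr.eval_sub, NExpr.eval_get,
      NExpr.eval_lit, NExpr.eval_ofNat, e1, e2, e3, hC, f1, f2, f3, f4, col]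
    rcases Nat.le_one_iff_eq_zero_or_eq_one.1 (D.fx_le j) with hf | hf <;> rw [hf]
    · by_cases h1 : j ∈ X <;> by_cases h2 : j ∈ Z <;> by_cases h3 : j ∈ m <;> simp [h1, h2, h3]
    · simp
  have hc := hD.col_le X Z m j
  set c := D.col X Z m j with hcdef
  have g1 := h.q c (by omega)
  have g2 := h.sp c (by omega)
  have g3 := h.cn c (by omega)
  have hpart : D.partTo X Z m (j + 1) c = insert j (D.partTo X Z m j c) := by
    rw [partTo_succ, if_pos rfl]
  have hpart' : ∀ q ≠ c, D.partTo X Z m (j + 1) q = D.partTo X Z m j q := fun q hq => by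
    rw [partTo_succ, if_neg (Ne.symm hq)]
  have i1 : mask (D.partTo X Z m (j + 1) c) = mask (D.partTo X Z m j c) + 2 ^ j := by
    rw [hpart, mask_insert (notMem_partTo _ _ _ _ _)]
  have i2 : ∑ v ∈ D.partTo X Z m (j + 1) c, D.regular c v =
      ∑ v ∈ D.partTo X Z m j c, D.regular c v + D.regular c j := by
    rw [hpart, Finset.sum_insert (notMem_partTo _ _ _ _ _), add_comm]
  have i3 : (D.partTo X Z m (j + 1) c).card = (D.partTo X Z m j c).card + 1 := by
    rw [hpart, Finset.card_insert_of_notMem (notMem_partTo _ _ _ _ _)]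
  refine Exec.setNat_seq ?_ (Exec.setNat_seq ?_ (Exec.setNat_seq ?_ (Exec.setNat ?_ ?_))) <;>
    simp [ecol, eRegular, hC, f1, f2, f3, g1, g2, g3, hs.pow j hj.le, ← i1]
  · exact lt_bits (by omega)
  · exact pow_lt_bits (a := j + 1) (by omega) (mask_lt fun v hv => partTo_lt hv).le
  · rw [← regular, ← i2]
    exact lt_bits (by have := sum_regular_le (D := D) X Z m (j + 1) c; omega)
  · exact lt_bits (by have := card_partTo_le (D := D) X Z m j c; omega)
  · rw [← regular, ← i2, ← i3]
    constructor <;> intro q hq <;> by_cases hqc : q = c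
    · simp [hqc]
    · simp [hqc, hpart' q hqc, h.q q hq]
    · simp [hqc]
    · simp [hqc, hpart' q hqc, h.sp q hq]
    · simp [hqc]
    · simp [hqc, hpart' q hqc, h.cn q hq]

def colorTime (n : ℕ) : ℕ := (4 * ((1 + (1 + 1)) + 2) + 2) + (n * ((1 + (1 + (1 + 1))) + 2) + 2)

theorem colorProg_exec (hD : D.Ok) {s : State} (hs : D.Base s) {X Z m : Finset ℕ}
    (hX : s.nat aX 0 = mask X) (hZ : s.nat aZ 0 = mask Z) (hm : s.nat aMm 0 = mask m) :
    Exec D.bits colorProg s (colorTime D.n) (D.Colored X Z m D.n) := by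
  refine Exec.seq (Q₁ := D.Colored X Z m 0) ?_ fun s₁ hf₁ h₁ => ?_
  · refine Exec.forLoop 4 (1 + (1 + 1)) (fun j s' => ∀ q < j, s'.nat aQ q = 0 ∧ s'.nat aSp q = 0 ∧
      s'.nat aCn q = 0) (by decide) (lt_bits (by omega))
      (fun j s x h => by simpa using h) (fun s' h => by simp) (by simp) ?_ ?_
    · intro j hj s' hf hi h
      refine Exec.setNat_seq (lt_bits (by simp)) (Exec.setNat_seq (lt_bits (by simp))
        (Exec.setNat (lt_bits (by simp)) ?_))
      intro q hq
      by_cases hqj : q = j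
      · simp [hi, hqj]
      · simpa [hi, hqj] using h q (by omega)
    · intro s' _ h
      constructor <;> intro q hq <;> simp [partTo, h q hq]
  · have r₁ : D.Base s₁ := hs.congr (hf₁.agree _ (by decide)) (hf₁.agree_real _ (by decide))
    refine Exec.forLoop D.n _ (fun j s' => D.Colored X Z m j s') (by decide) (lt_bits (by omega))
      (fun j s x h => ?_) (fun s' h => ?_) h₁ ?_ (fun s' _ h => h)
    · obtain ⟨a, b, c⟩ := h
      constructor <;> simpa
    · simp [h.1 aIn (by decide), r₁.input.n]
    · intro j hj s₂ hf₂ hC h₂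
      exact colorStep_exec hD (r₁.congr (hf₂.agree _ (by decide)) (hf₂.agree_real _ (by decide))) hj
        (by rw [hf₂.1 _ (by decide), hf₁.1 _ (by decide), hX])
        (by rw [hf₂.1 _ (by decide), hf₁.1 _ (by decide), hZ])
        (by rw [hf₂.1 _ (by decide), hf₁.1 _ (by decide), hm]) hC h₂

/-! ## Searching for a minimum -/

/-- `a` is a best admissible element of `A`, with value `x`, if `f = 1`; there is none if
`f = 0`. -/
def ArgMin {α : Type*} (ok : α → Prop) (val : α → ℝ) (A : Set α) (f : ℕ) (x : ℝ) (a : α) : Prop :=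
  (f = 0 ∧ ∀ b ∈ A, ¬ ok b) ∨ (f = 1 ∧ a ∈ A ∧ ok a ∧ x = val a ∧ ∀ b ∈ A, ok b → x ≤ val b)

/-- A single comparison with `b` can account for a whole block of new elements, provided that none
of its admissible members is better than `b`. -/
theorem ArgMin.extend {α : Type*} {ok : α → Prop} {val : α → ℝ} {A A' : Set α} {f : ℕ} {x : ℝ}
    {a b : α} (h : ArgMin ok val (insert b A) f x a) (hA : insert b A ⊆ A') (hb : ok b)
    (hA' : ∀ c ∈ A', ok c → c ∈ A ∨ val b ≤ val c) : ArgMin ok val A' f x a := by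
  rcases h with ⟨-, h⟩ | ⟨h1, h2, h3, h4, h5⟩
  · exact absurd hb (h b (Set.mem_insert _ _))
  · refine .inr ⟨h1, hA h2, h3, h4, fun c hc hok => ?_⟩
    rcases hA' c hc hok with hc | hc
    · exact h5 c (Set.mem_insert_of_mem _ hc) hok
    · exact (h5 b (Set.mem_insert _ _) hb).trans hc

theorem ArgMin.extend_of_not {α : Type*} {ok : α → Prop} {val : α → ℝ} {A A' : Set α} {f : ℕ}
    {x : ℝ} {a : α} (h : ArgMin ok val A f x a) (hA : A ⊆ A')
    (hA' : ∀ c ∈ A', ok c → c ∈ A) : ArgMin ok val A' f x a := by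
  rcases h with ⟨h0, h⟩ | ⟨h1, h2, h3, h4, h5⟩
  · exact .inl ⟨h0, fun c hc hok => h c (hA' c hc hok) hok⟩
  · exact .inr ⟨h1, hA h2, h3, h4, fun c hc hok => h5 c (hA' c hc hok) hok⟩

/-- Run `p` if the value in `rC` is better than the recorded value `x`, or if there is none. -/
def minProg (f : NExpr) (x : RExpr) (p : Program) : Program :=
  branch (.natLE f 0) p (branch (.neg (.realLE x (RExpr.get rC 0))) p .skip)

theorem minProg_exec {α : Type*} {ok : α → Prop} {val : α → ℝ} {A : Set α} {a b : α} {B t : ℕ}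
    {s : State} {f : NExpr} {x : RExpr} {p : Program} {Q : State → Prop}
    (h : ArgMin ok val A (f.eval s) (x.eval s) a) (hb : ok b) (hv : s.real rC 0 = val b)
    (ht : 1 ≤ t) (hp : ArgMin ok val (insert b A) 1 (val b) b → Exec B p s t Q)
    (hk : ArgMin ok val (insert b A) (f.eval s) (x.eval s) a → Q s) :
    Exec B (minProg f x p) s (t + 1 + 1) Q := by
  refine Exec.branch (t := t + 1) (fun hf => ?_) (fun hf => ?_) <;>
    rw [Test.holds_natLE, NExpr.eval_ofNat] at hf
  · refine Exec.le (hp (.inr ⟨rfl, Set.mem_insert _ _, hb, rfl, fun c hc hok => ?_⟩)) (by omega)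
    rcases h with ⟨-, h⟩ | ⟨h1, -⟩
    · rcases hc with rfl | hc
      exacts [le_rfl, absurd hok (h c hc)]
    · omega
  · rcases h with ⟨h1, -⟩ | ⟨h1, h2, h3, h4, h5⟩
    · omega
    refine Exec.branch (t := t) (fun hx => ?_) (fun hx => ?_) <;>
      simp only [Test.holds_neg, Test.holds_realLE, RExpr.eval_get, NExpr.eval_ofNat, hv,
        not_le, not_lt] at hx
    · refine hp (.inr ⟨rfl, Set.mem_insert _ _, hb, rfl, fun c hc hok => ?_⟩)
      rcases hc with rfl | hc
      exacts [le_rfl, hx.le.trans (h5 c hc hok)]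
    · refine Exec.le (t := 1) (Exec.skip (hk (.inr ⟨h1, Set.mem_insert_of_mem _ h2, h3, h4,
        fun c hc hok => ?_⟩))) ht
      rcases hc with rfl | hc
      exacts [hx, h5 c hc hok]

end Data
end Sched

namespace Sched

open RealRAM
open RealRAM.NExpr (get var)
open RealRAM.Program (setNat setReal forLoop branch)

namespace Data

variable {D : Data}

/-! ## The search over all colourings -/

/-- The jobs placed in quarter `q`. -/
abbrev part (D : Data) (X Z m : Finset ℕ) (q : ℕ) : Finset ℕ := D.partTo X Z m D.n q

/-- The two quarters whose jobs are determined in search number `r` are `r` and `D.second r`. -/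
def second (D : Data) (r : ℕ) : ℕ := if r = 0 then 3 - D.orient else 2 + D.orient

/-- The jobs placed in quarter `q` have the prescribed numbers. -/
def Fit (D : Data) (X Z m : Finset ℕ) (q : ℕ) : Prop :=
  (D.part X Z m q).card = D.n / 4 ∧ ∑ v ∈ D.part X Z m q, D.regular q v = D.target q

/-- The two quarters tested are the ends of the edge of the 4-cycle that belongs to family 7 + r. -/
def SearchOk (D : Data) (X Z m : Finset ℕ) (r : ℕ) : Prop :=
  D.Fit X Z m r ∧ D.Fit X Z m (D.second r)

noncomputable def partVal (D : Data) (H : ℕ → ℝ) (X Z m : Finset ℕ) (q : ℕ) : ℝ :=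
  H (mask (D.part X Z m q) * 4 + q)

noncomputable def searchVal (D : Data) (H : ℕ → ℝ) (X Z m : Finset ℕ) (r : ℕ) : ℝ :=
  D.partVal H X Z m r + D.partVal H X Z m (D.second r)

theorem second_lt (r : ℕ) : D.second r < 4 := by
  have := D.orient_le
  unfold second; split_ifs <;> omega

def eSecond (r : ℕ) : NExpr := if r = 0 then 3 - var aOr else 2 + var aOr

/-- The truncated differences in both directions add up to an absolute value, so one number vanishes
exactly if both prescribed counts are met. -/
def eDev (q : NExpr) : NExpr :=
  (get aCn q - var aIn / 4) + (var aIn / 4 - get aCn q) + (get aSp q - get aTg q) +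
    (get aTg q - get aSp q)

def eListL (r : ℕ) : NExpr := get aL (var iB * 16 + .lit (7 + r))

def searchUpdate (r : ℕ) : Program :=
  setReal rBv (.lit r) (RExpr.get rC 0);;
  setNat aBi (.lit r) (eListL r);;
  setNat aBf (.lit r) 1

def searchStep (r : ℕ) : Program :=
  setNat aMm 0 (var aO + eListL r);;
  colorProg;;
  branch (.natLE (eDev (.lit r) + eDev (eSecond r)) 0)
    (setReal rC 0 (RExpr.get rH (get aQ (.lit r) * 4 + .lit r) +
        RExpr.get rH (get aQ (eSecond r) * 4 + eSecond r));;
      minProg (get aBf (.lit r)) (RExpr.get rBv (.lit r)) (searchUpdate r))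
    .skip

def searchProg (r : ℕ) : Program :=
  setNat aBf (.lit r) 0;;
  forLoop iB (get aLen (.lit (7 + r))) (searchStep r)

/-- The list does not depend on r, so membership in it can be decided for variable r. -/
theorem searchStep_natWrites (r : ℕ) : (searchStep r).natWrites =
    [aMm, iD, aQ, aSp, aCn, iD, iC, aD, aQ, aSp, aCn, iC, aBi, aBf, aBi, aBf] := rfl

theorem searchStep_realWrites (r : ℕ) : (searchStep r).realWrites = [rC, rBv, rBv] := rfl

theorem mem_family {l : ℕ} {S : Finset ℕ} :
    S ∈ D.family l ↔ (∀ i ∈ S, i < D.n ∧ 1 ≤ D.cls l i) ∧ load (D.cls l) S ≤ D.lim l := mem_enum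

theorem family_lt {l v : ℕ} {S : Finset ℕ} (h : S ∈ D.family l) (hv : v ∈ S) : v < D.n :=
  ((mem_family.1 h).1 v hv).1

theorem disjoint_families {l l' : ℕ} {S T : Finset ℕ} (hS : S ∈ D.family l) (hT : T ∈ D.family l')
    (h : ∀ v, 1 ≤ D.cls l v → 1 ≤ D.cls l' v → False) : Disjoint S T :=
  Finset.disjoint_left.2 fun v hv hv' =>
    h v ((mem_family.1 hS).1 v hv).2 ((mem_family.1 hT).1 v hv').2

theorem cls_six {v : ℕ} : 1 ≤ D.cls 6 v ↔ D.fx v = 0 ∧ (D.na v + D.nd v + D.orient) % 2 = 1 := by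
  have := D.fx_le v
  simp only [cls, Nat.one_le_iff_ne_zero, mul_ne_zero_iff]; omega

theorem cls_seven {v : ℕ} :
    1 ≤ D.cls 7 v ↔ D.fx v = 0 ∧ D.na v = 0 ∧ (D.nd v + D.orient) % 2 = 0 := by
  have := D.fx_le v
  simp only [cls, Nat.one_le_iff_ne_zero, mul_ne_zero_iff]; omega

theorem cls_eight {v : ℕ} :
    1 ≤ D.cls 8 v ↔ D.fx v = 0 ∧ D.na v = 1 ∧ (D.nd v + D.orient) % 2 = 1 := by
  have := D.fx_le v
  have := D.na_le v
  simp only [cls, Nat.one_le_iff_ne_zero, mul_ne_zero_iff]; omega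

theorem disjoint_six {r : ℕ} (hr : r < 2) {S T : Finset ℕ} (hS : S ∈ D.family 6)
    (hT : T ∈ D.family (7 + r)) : Disjoint S T := by
  refine disjoint_families hS hT fun v h h' => ?_
  rw [cls_six] at h
  interval_cases r
  · rw [cls_seven] at h'; omega
  · rw [cls_eight] at h'; omega

theorem disjoint_seven {S T : Finset ℕ} (hS : S ∈ D.family 7) (hT : T ∈ D.family 8) :
    Disjoint S T := by
  refine disjoint_families hS hT fun v h h' => ?_
  rw [cls_seven] at h
  rw [cls_eight] at h'
  omega

/-- The jobs of class `8 - r` do not matter for the quarters of search number `r`. -/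
theorem part_union {X Z m I : Finset ℕ} {r q : ℕ} (hr : r < 2) (hI : I ∈ D.family (8 - r))
    (hq : q = r ∨ q = D.second r) : D.part X Z (m ∪ I) q = D.part X Z m q := by
  refine Finset.filter_congr fun v _ => ?_
  by_cases hv : v ∈ I
  · have h := ((mem_family.1 hI).1 v hv).2
    have h1 := D.orient_le
    have h2 := D.nd_le v
    unfold col
    rw [if_pos (Finset.mem_union_right _ hv)]
    -- A job of the other inner type can only move along the opposite edge of the 4-cycle, whose two
    -- ends differ from both quarters of this search.
    interval_cases r
    · rw [show 8 - 0 = 8 from rfl, cls_eight] at h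
      simp only [second, if_true] at hq
      split_ifs <;> omega
    · rw [show 8 - 1 = 7 from rfl, cls_seven] at h
      simp only [second, one_ne_zero, if_false] at hq
      split_ifs <;> omega
  · simp [col, hv]

theorem fit_union {X Z m I : Finset ℕ} {r q : ℕ} (hr : r < 2) (hI : I ∈ D.family (8 - r))
    (hq : q = r ∨ q = D.second r) : D.Fit X Z (m ∪ I) q ↔ D.Fit X Z m q := by
  rw [Fit, Fit, part_union hr hI hq]

theorem searchOk_union {X Z m I : Finset ℕ} {r : ℕ} (hr : r < 2) (hI : I ∈ D.family (8 - r)) :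
    D.SearchOk X Z (m ∪ I) r ↔ D.SearchOk X Z m r := by
  rw [SearchOk, SearchOk, fit_union hr hI (.inl rfl), fit_union hr hI (.inr rfl)]

theorem searchVal_union {H : ℕ → ℝ} {X Z m I : Finset ℕ} {r : ℕ} (hr : r < 2)
    (hI : I ∈ D.family (8 - r)) : D.searchVal H X Z (m ∪ I) r = D.searchVal H X Z m r := by
  simp only [searchVal, partVal, part_union hr hI (.inl rfl), part_union hr hI (.inr rfl)]

theorem eval_eSecond {s : State} (hs : s.nat aOr 0 = D.orient) (r : ℕ) :
    (eSecond r).eval s = D.second r := by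
  unfold eSecond second
  split_ifs <;> simp [hs]

theorem eval_eDev {s : State} (hs : D.Tables s) {X Z m : Finset ℕ} (h : D.Colored X Z m D.n s)
    {e : NExpr} {q : ℕ} (he : e.eval s = q) (hq : q < 4) :
    (eDev e).eval s = 0 ↔ D.Fit X Z m q := by
  simp only [eDev, NExpr.eval_add, NExpr.eval_sub, NExpr.eval_div, NExpr.eval_get,
    NExpr.eval_ofNat, NExpr.eval_lit, he, h.cn q hq, h.sp q hq, hs.target q hq, hs.input.n, Fit,
    part]
  omega

/-- Number of steps of `searchProg` on a list of length at most `N`. -/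
def searchTime (n N : ℕ) : ℕ :=
  1 + (N * ((1 + (colorTime n + ((1 + ((1 + (1 + 1)) + 1 + 1)) + 1))) + 2) + 2)

/-- The result of search number `r` for the list of sets `lst`. -/
def Found (D : Data) (H : ℕ → ℝ) (X Z O : Finset ℕ) (r : ℕ) (A : Set (Finset ℕ)) (s : State) : Prop :=
  ∃ I, (s.nat aBf r = 1 → s.nat aBi r = mask I) ∧ ArgMin (fun I => D.SearchOk X Z (O ∪ I) r)
    (fun I => D.searchVal H X Z (O ∪ I) r) A (s.nat aBf r) (s.real rBv r) I

theorem searchStep_exec (hD : D.Ok) {s : State} (hs : D.Ready s) {X Z O : Finset ℕ} {r i : ℕ}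
    (hr : r < 2) (hX : s.nat aX 0 = mask X) (hZ : s.nat aZ 0 = mask Z) (hO : s.nat aO 0 = mask O)
    (hOm : O ∈ D.family 6) (hi : i < (D.family (7 + r)).length) (hB : s.nat iB 0 = i)
    (h : D.Found (s.real rH) X Z O r {I | I ∈ (D.family (7 + r)).take i} s) :
    Exec D.bits (searchStep r) s
      (1 + (colorTime D.n + ((1 + ((1 + (1 + 1)) + 1 + 1)) + 1))) fun s' =>
      D.Found (s.real rH) X Z O r {I | I ∈ (D.family (7 + r)).take (i + 1)} s' ∧
      ∀ r' ≠ r, s'.nat aBf r' = s.nat aBf r' ∧ s'.nat aBi r' = s.nat aBi r' ∧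
        s'.real rBv r' = s.real rBv r' := by
  have hL := (hs.lists (7 + r) (by omega)).mask i hi
  have hIm : (D.family (7 + r))[i] ∈ D.family (7 + r) := List.getElem_mem hi
  have htake : {I | I ∈ (D.family (7 + r)).take (i + 1)} =
      insert (D.family (7 + r))[i] {I | I ∈ (D.family (7 + r)).take i} := by
    ext I
    rw [Set.mem_ofPred, List.take_succ_eq_append_getElem hi, List.mem_append, List.mem_singleton,
      Set.mem_insert_iff, or_comm]
    rfl
  rw [htake]
  clear htake
  generalize {I | I ∈ (D.family (7 + r)).take i} = A at h ⊢
  set I := (D.family (7 + r))[i] with hI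
  have hun : mask (O ∪ I) = mask O + mask I := mask_union (disjoint_six hr hOm hIm)
  have hIn : mask I < 2 ^ D.bits :=
    pow_lt_bits (a := D.n) (by omega) (mask_lt fun v hv => family_lt hIm hv).le
  refine Exec.setNat_seq ?_ ?_
  · simp only [eListL, NExpr.eval_add, NExpr.eval_mul, NExpr.eval_get, NExpr.eval_lit,
      NExpr.eval_ofNat, hO, hB, hL, ← hun]
    refine pow_lt_bits (a := D.n) (by omega) (mask_lt fun v hv => ?_).le
    rcases Finset.mem_union.1 hv with hv | hv
    exacts [family_lt hOm hv, family_lt hIm hv]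
  set s₁ := s.writeNat aMm _ _ with hs₁
  have r₁ : D.Ready s₁ := hs.congr (fun a ha => State.writeNat_nat_ne _ _ _
    (by revert ha a; decide)) (fun a ha => rfl)
  have n₁ : ∀ a ≠ aMm, s₁.nat a = s.nat a := fun a ha => State.writeNat_nat_ne _ _ _ ha
  have v₁ : s₁.real = s.real := rfl
  have m₁ : s₁.nat aMm 0 = mask (O ∪ I) := by simp [hs₁, eListL, hO, hB, hL, hun]
  clear_value s₁
  refine Exec.seq (colorProg_exec hD r₁.toBase (by rw [n₁ _ (by decide), hX])
    (by rw [n₁ _ (by decide), hZ]) m₁) fun s₂ hf₂ h₂ => ?_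
  have r₂ : D.Ready s₂ := r₁.congr (hf₂.agree _ (by decide)) (hf₂.agree_real _ (by decide))
  have k1 : s₂.nat aBf = s.nat aBf := by rw [hf₂.1 _ (by decide), n₁ _ (by decide)]
  have k2 : s₂.nat aBi = s.nat aBi := by rw [hf₂.1 _ (by decide), n₁ _ (by decide)]
  have k3 : s₂.real = s.real := by
    rw [← v₁]; funext a; exact hf₂.2 a (by simp [show colorProg.realWrites = [] from rfl])
  have k4 : s₂.nat iB 0 = i := by rw [hf₂.1 _ (by decide), n₁ _ (by decide), hB]
  have k5 : s₂.nat aL (i * 16 + (7 + r)) = mask I := by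
    rw [hf₂.1 _ (by decide), n₁ _ (by decide), hL]
  have esec := eval_eSecond r₂.orient r
  have hdev : (Test.natLE (eDev (.lit r) + eDev (eSecond r)) 0).Holds s₂ ↔
      D.SearchOk X Z (O ∪ I) r := by
    rw [Test.holds_natLE, NExpr.eval_add, SearchOk,
      ← eval_eDev r₂.toTables h₂ (e := .lit r) (q := r) rfl (by omega),
      ← eval_eDev r₂.toTables h₂ (e := eSecond r) esec (second_lt r), NExpr.eval_ofNat]
    omega
  obtain ⟨I₀, hI₀, hmin⟩ := h
  refine Exec.branch (t := 1 + ((1 + (1 + 1)) + 1 + 1)) (fun hb => ?_) (fun hb => ?_) <;>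
    rw [hdev] at hb
  swap
  · refine Exec.le (t := 1) (Exec.skip ⟨⟨I₀, by rw [k1, k2]; exact hI₀, ?_⟩,
      fun r' _ => by rw [k1, k2, k3]; simp⟩) (by norm_num)
    rw [k1, k3]
    exact hmin.extend_of_not (Set.subset_insert _ _) fun c hc hok => by
      rcases hc with rfl | hc
      exacts [absurd hok hb, hc]
  refine Exec.setReal_seq ?_
  set s₃ := s₂.writeReal rC _ _ with hs₃
  have n₃ : s₃.nat = s₂.nat := rfl
  have v₃ : ∀ a ≠ rC, s₃.real a = s.real a := fun a ha =>
    (State.writeReal_real_ne _ _ _ ha).trans (by rw [k3])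
  have c₃ : s₃.real rC 0 = D.searchVal (s.real rH) X Z (O ∪ I) r := by
    simp only [hs₃, RExpr.eval_add, RExpr.eval_get, NExpr.eval_add, NExpr.eval_mul, NExpr.eval_get,
      NExpr.eval_lit, NExpr.eval_ofNat, esec, h₂.q r (by omega), h₂.q _ (second_lt r), k3,
      State.writeReal_real_same, Function.update_self]
    rfl
  clear_value s₃
  refine minProg_exec (A := A) (a := I₀) (b := I) (ok := fun I => D.SearchOk X Z (O ∪ I) r)
    (val := fun I => D.searchVal (s.real rH) X Z (O ∪ I) r) ?_ hb c₃ (by norm_num) (fun hm => ?_)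
    (fun hm => ?_)
  · rw [NExpr.eval_get, RExpr.eval_get, NExpr.eval_lit, n₃, k1, v₃ _ (by decide)]
    exact hmin
  · refine Exec.setReal_seq (Exec.setNat_seq ?_ (Exec.setNat (lt_bits (by simp)) ⟨⟨I, ?_, ?_⟩, ?_⟩))
    · simpa [eListL, n₃, k4, k5] using hIn
    · simp [eListL, n₃, k4, k5]
    · simpa [c₃] using hm
    · intro r' hr'
      simp [hr', n₃, k1, k2, v₃]
  · refine ⟨⟨I₀, by rw [n₃, k1, k2]; exact hI₀, ?_⟩, fun r' _ => ?_⟩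
    · exact hm
    · rw [n₃, k1, k2, v₃ _ (by decide)]; simp

/-- Both searches use the same result arrays at different indices; the second conjunct preserves the
result of search 0 while search 1 runs. -/
theorem searchProg_exec (hD : D.Ok) {s : State} (hs : D.Ready s) {X Z O : Finset ℕ} {r N : ℕ}
    (hr : r < 2) (hX : s.nat aX 0 = mask X) (hZ : s.nat aZ 0 = mask Z) (hO : s.nat aO 0 = mask O)
    (hOm : O ∈ D.family 6) (hN : (D.family (7 + r)).length ≤ N) :
    Exec D.bits (searchProg r) s (searchTime D.n N) fun s' =>
      D.Found (s.real rH) X Z O r {I | I ∈ D.family (7 + r)} s' ∧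
      ∀ r' ≠ r, s'.nat aBf r' = s.nat aBf r' ∧ s'.nat aBi r' = s.nat aBi r' ∧
        s'.real rBv r' = s.real rBv r' := by
  refine Exec.setNat_seq (lt_bits (by simp)) ?_
  refine Exec.le (t := (D.family (7 + r)).length *
    ((1 + (colorTime D.n + ((1 + ((1 + (1 + 1)) + 1 + 1)) + 1))) + 2) + 2) ?_ (by gcongr)
  refine Exec.forLoop (D.family (7 + r)).length _ (fun i s' =>
      D.Found (s.real rH) X Z O r {I | I ∈ (D.family (7 + r)).take i} s' ∧
      ∀ r' ≠ r, s'.nat aBf r' = s.nat aBf r' ∧ s'.nat aBi r' = s.nat aBi r' ∧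
        s'.real rBv r' = s.real rBv r') (by rw [searchStep_natWrites]; decide)
    (pow_lt_bits (a := D.n) (by omega) (length_enum_le _ _ _))
    (fun j s x h => by simpa [Found] using h) (fun s' h => ?_) ⟨⟨∅, ?_, ?_⟩, ?_⟩ ?_ ?_
  · rw [searchStep_natWrites] at h
    simp [h.1 aLen (by decide), (hs.lists (7 + r) (by omega)).len]
  · simp
  · exact .inl ⟨by simp, by simp⟩
  · intro r' hr'
    simp [hr']
  · intro i hi s₁ hf₁ hB h₁
    rw [searchStep_natWrites, searchStep_realWrites] at hf₁
    have hw : ∀ a ≠ aBf, (s.writeNat aBf (NExpr.eval s (.lit r)) (NExpr.eval s 0)).nat a =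
      s.nat a := fun a ha => State.writeNat_nat_ne _ _ _ ha
    have r₁ : D.Ready s₁ := hs.congr
      (fun a ha => (hf₁.1 a (by revert ha a; decide)).trans (hw a (by revert ha a; decide)))
      (fun a ha => hf₁.2 a (by revert ha a; decide))
    have hH : s₁.real rH = s.real rH := hf₁.2 _ (by decide)
    rw [← hH] at h₁ ⊢
    refine (searchStep_exec hD r₁ hr (by rw [hf₁.1 _ (by decide), hw _ (by decide), hX])
      (by rw [hf₁.1 _ (by decide), hw _ (by decide), hZ])
      (by rw [hf₁.1 _ (by decide), hw _ (by decide), hO]) hOm hi hB h₁.1).mono le_rfl ?_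
    intro s₂ _ h₂
    refine ⟨h₂.1, fun r' hr' => ?_⟩
    have e1 := h₂.2 r' hr'
    have e2 := h₁.2 r' hr'
    exact ⟨e1.1.trans e2.1, e1.2.1.trans e2.2.1, e1.2.2.trans e2.2.2⟩
  · intro s' _ h'
    simpa using h'

end Data
end Sched

namespace Sched

open RealRAM
open RealRAM.NExpr (get var)
open RealRAM.Program (setNat setReal forLoop branch)

namespace Data

variable {D : Data}

/-! ## The main search -/

/-- A triple `(X, Z, m)` describes a colouring. -/
abbrev Triple := Finset ℕ × Finset ℕ × Finset ℕ

def TripleOk (D : Data) (T : Triple) : Prop :=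
  D.SearchOk T.1 T.2.1 T.2.2 0 ∧ D.SearchOk T.1 T.2.1 T.2.2 1

noncomputable def tripleVal (D : Data) (H : ℕ → ℝ) (T : Triple) : ℝ :=
  D.searchVal H T.1 T.2.1 T.2.2 0 + D.searchVal H T.1 T.2.1 T.2.2 1

/-- The triples examined together. -/
def block (D : Data) (X Z O : Finset ℕ) : Set Triple :=
  {T | T.1 = X ∧ T.2.1 = Z ∧ ∃ I ∈ D.family 7, ∃ J ∈ D.family 8, T.2.2 = O ∪ I ∪ J}

/-- The triples examined in the first `j` rounds of the search. -/
def seen (D : Data) (j : ℕ) : Set Triple :=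
  {T | ∃ i < j, T ∈ D.block ((D.family 4).getD (i % (D.family 4).length) ∅)
    ((D.family 5).getD (i / (D.family 4).length % (D.family 5).length) ∅)
    ((D.family 6).getD (i / ((D.family 4).length * (D.family 5).length)) ∅)}

/-- The number of rounds of the search. -/
def rounds (D : Data) : ℕ := (D.family 4).length * (D.family 5).length * (D.family 6).length

/-- The best triple of `A` is recorded. -/
def Recorded (D : Data) (H : ℕ → ℝ) (A : Set Triple) (s : State) : Prop :=
  ∃ T : Triple, (s.nat aGf 0 = 1 → s.nat aGx 0 = mask T.1 ∧ s.nat aGz 0 = mask T.2.1 ∧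
    s.nat aGm 0 = mask T.2.2) ∧ ArgMin D.TripleOk (D.tripleVal H) A (s.nat aGf 0) (s.real rGv 0) T

def mainUpdate : Program :=
  setReal rGv 0 (RExpr.get rC 0);;
  setNat aGx 0 (var aX);;
  setNat aGz 0 (var aZ);;
  setNat aGm 0 (var aO + get aBi 0 + get aBi 1);;
  setNat aGf 0 1

/-- One counter replaces three nested loops: its mixed-radix digits are the indices of X, Z and the
outer choice O. -/
def mainStep : Program :=
  setNat aX 0 (get aL (var iA % get aLen 4 * 16 + 4));;
  setNat aZ 0 (get aL (var iA / get aLen 4 % get aLen 5 * 16 + 5));;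
  setNat aO 0 (get aL (var iA / (get aLen 4 * get aLen 5) * 16 + 6));;
  searchProg 0;;
  searchProg 1;;
  branch (.natLE 2 (get aBf 0 + get aBf 1))
    (setReal rC 0 (RExpr.get rBv 0 + RExpr.get rBv 1);;
      minProg (var aGf) (RExpr.get rGv 0) mainUpdate)
    .skip

def mainProg : Program :=
  setNat aGf 0 0;;
  forLoop iA (get aLen 4 * get aLen 5 * get aLen 6) mainStep

/-- The independence that saves time: with X, Z, O fixed, the quarters of search 0 do not see J and
those of search 1 do not see I, so all admissible pairs (I, J) arise by combining separately
admissible I and J. -/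
theorem tripleOk_iff {X Z O I J : Finset ℕ} (hI : I ∈ D.family 7) (hJ : J ∈ D.family 8) :
    D.TripleOk (X, Z, O ∪ I ∪ J) ↔ D.SearchOk X Z (O ∪ I) 0 ∧ D.SearchOk X Z (O ∪ J) 1 := by
  rw [TripleOk]
  dsimp only
  refine and_congr (searchOk_union (r := 0) (by omega) hJ) ?_
  rw [Finset.union_right_comm]
  exact searchOk_union (r := 1) (by omega) hI

theorem tripleVal_eq {H : ℕ → ℝ} {X Z O I J : Finset ℕ} (hI : I ∈ D.family 7)
    (hJ : J ∈ D.family 8) : D.tripleVal H (X, Z, O ∪ I ∪ J) =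
      D.searchVal H X Z (O ∪ I) 0 + D.searchVal H X Z (O ∪ J) 1 := by
  rw [tripleVal]
  dsimp only
  rw [searchVal_union (r := 0) (by omega) hJ, Finset.union_right_comm,
    searchVal_union (r := 1) (by omega) hI]

def mainTime (n N : ℕ) : ℕ :=
  1 + (1 + (1 + (searchTime n N + (searchTime n N + ((1 + (5 + 1 + 1)) + 1)))))

theorem mainStep_exec (hD : D.Ok) {s : State} (hs : D.Ready s) {X Z O : Finset ℕ} {N i : ℕ}
    {A : Set Triple} (hA : s.nat iA 0 = i)
    (hXm : X ∈ D.family 4) (hZm : Z ∈ D.family 5) (hOm : O ∈ D.family 6)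
    (hX : s.nat aL (i % (D.family 4).length * 16 + 4) = mask X)
    (hZ : s.nat aL (i / (D.family 4).length % (D.family 5).length * 16 + 5) = mask Z)
    (hO : s.nat aL (i / ((D.family 4).length * (D.family 5).length) * 16 + 6) = mask O)
    (hN : ∀ r < 2, (D.family (7 + r)).length ≤ N)
    (h : D.Recorded (s.real rH) A s) :
    Exec D.bits mainStep s (mainTime D.n N) fun s' =>
      D.Recorded (s.real rH) (A ∪ D.block X Z O) s' := by
  have l4 := (hs.lists 4 (by omega)).len
  have l5 := (hs.lists 5 (by omega)).len
  have hlt : ∀ {l} {S : Finset ℕ}, S ∈ D.family l → mask S < 2 ^ D.bits := fun hS =>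
    pow_lt_bits (a := D.n) (by omega) (mask_lt fun v hv => family_lt hS hv).le
  refine Exec.setNat_seq ?_ (Exec.setNat_seq ?_ (Exec.setNat_seq ?_ ?_))
  · simpa [hA, l4, hX] using hlt hXm
  · simpa [hA, l4, l5, hZ] using hlt hZm
  · simpa [hA, l4, l5, hO] using hlt hOm
  set s₁ := ((s.writeNat aX _ _).writeNat aZ _ _).writeNat aO _ _ with hs₁
  have n₁ : ∀ a ∉ [aX, aZ, aO], s₁.nat a = s.nat a := fun a ha => by
    simp only [List.mem_cons, List.not_mem_nil, or_false, not_or] at ha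
    rw [hs₁, State.writeNat_nat_ne _ _ _ ha.2.2, State.writeNat_nat_ne _ _ _ ha.2.1,
      State.writeNat_nat_ne _ _ _ ha.1]
  have v₁ : s₁.real = s.real := rfl
  have r₁ : D.Ready s₁ := hs.congr (fun a ha => n₁ a (by revert ha a; decide))
    (fun a ha => rfl)
  have b1 : s₁.nat aX 0 = mask X := by simp [hs₁, hA, l4, hX]
  have b2 : s₁.nat aZ 0 = mask Z := by simp [hs₁, hA, l4, l5, hZ]
  have b3 : s₁.nat aO 0 = mask O := by simp [hs₁, hA, l4, l5, hO]
  clear_value s₁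
  refine Exec.seq (searchProg_exec hD r₁ (r := 0) (by omega) b1 b2 b3 hOm (hN 0 (by omega)))
    fun s₂ hf₂ h₂ => ?_
  have r₂ : D.Ready s₂ := r₁.congr (hf₂.agree _ (by decide)) (hf₂.agree_real _ (by decide))
  refine Exec.seq (searchProg_exec hD r₂ (r := 1) (by omega) (by rw [hf₂.1 _ (by decide), b1])
    (by rw [hf₂.1 _ (by decide), b2]) (by rw [hf₂.1 _ (by decide), b3]) hOm (hN 1 (by omega)))
    fun s₃ hf₃ h₃ => ?_
  have hH₂ : s₂.real rH = s.real rH := by rw [hf₂.2 _ (by decide), v₁]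
  have fr : ∀ a ∉ [aX, aZ, aO], a ∉ (searchProg 0).natWrites → a ∉ (searchProg 1).natWrites →
    s₃.nat a = s.nat a := fun a h1 h2 h3 => by rw [hf₃.1 a h3, hf₂.1 a h2, n₁ a h1]
  have gf : s₃.nat aGf = s.nat aGf := fr _ (by decide) (by decide) (by decide)
  have gx : s₃.nat aGx = s.nat aGx := fr _ (by decide) (by decide) (by decide)
  have gz : s₃.nat aGz = s.nat aGz := fr _ (by decide) (by decide) (by decide)
  have gm : s₃.nat aGm = s.nat aGm := fr _ (by decide) (by decide) (by decide)
  have gv : s₃.real rGv = s.real rGv := by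
    rw [hf₃.2 _ (by decide), hf₂.2 _ (by decide), v₁]
  have c1 : s₃.nat aX 0 = mask X := by rw [hf₃.1 _ (by decide), hf₂.1 _ (by decide), b1]
  have c2 : s₃.nat aZ 0 = mask Z := by rw [hf₃.1 _ (by decide), hf₂.1 _ (by decide), b2]
  have c3 : s₃.nat aO 0 = mask O := by rw [hf₃.1 _ (by decide), hf₂.1 _ (by decide), b3]
  obtain ⟨⟨I, hI, hmI⟩, -⟩ := h₂
  obtain ⟨⟨J, hJ, hmJ⟩, h0⟩ := h₃
  obtain ⟨h01, h02, h03⟩ := h0 0 (by omega)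
  rw [v₁, ← h01, ← h03] at hmI
  rw [← h01, ← h02] at hI
  rw [hH₂] at hmJ
  obtain ⟨T₀, hT₀, hmin⟩ := h
  have hbe : (Test.natLE 2 (get aBf 0 + get aBf 1)).Holds s₃ ↔
      2 ≤ s₃.nat aBf 0 + s₃.nat aBf 1 := by simp
  refine Exec.branch (t := 1 + (5 + 1 + 1)) (fun hb => ?_) (fun hb => ?_) <;> rw [hbe] at hb
  swap
  · refine Exec.le (t := 1) (Exec.skip ⟨T₀, by rw [gf, gx, gz, gm]; exact hT₀, ?_⟩) (by norm_num)
    rw [gf, gv]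
    -- If either search fails, no triple of the block is admissible.
    refine hmin.extend_of_not Set.subset_union_left fun c hc hok => hc.resolve_right fun hc => hb ?_
    obtain ⟨X', Z', m⟩ := c
    obtain ⟨rfl, rfl, I', hI', J', hJ', rfl⟩ := hc
    rw [tripleOk_iff hI' hJ'] at hok
    have e1 : s₃.nat aBf 0 = 1 := by
      rcases hmI with ⟨-, h⟩ | ⟨h, -⟩
      exacts [absurd hok.1 (h I' hI'), h]
    have e2 : s₃.nat aBf 1 = 1 := by
      rcases hmJ with ⟨-, h⟩ | ⟨h, -⟩
      exacts [absurd hok.2 (h J' hJ'), h]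
    omega
  rcases hmI with ⟨h1, -⟩ | ⟨e1, hI7, hokI, hvI, hbI⟩
  · rcases hmJ with ⟨h2, -⟩ | ⟨h2, -⟩ <;> omega
  rcases hmJ with ⟨h2, -⟩ | ⟨e2, hJ8, hokJ, hvJ, hbJ⟩
  · omega
  have hok : D.TripleOk (X, Z, O ∪ I ∪ J) := (tripleOk_iff hI7 hJ8).2 ⟨hokI, hokJ⟩
  have hval : s₃.real rBv 0 + s₃.real rBv 1 = D.tripleVal (s.real rH) (X, Z, O ∪ I ∪ J) := by
    rw [tripleVal_eq hI7 hJ8, hvI, hvJ]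
  have hmem : (X, Z, O ∪ I ∪ J) ∈ D.block X Z O := ⟨rfl, rfl, I, hI7, J, hJ8, rfl⟩
  -- The sum of the two separate minima is the minimum over the entire block, so the combined pair
  -- represents all of it.
  have hext : ∀ {f x a}, ArgMin D.TripleOk (D.tripleVal (s.real rH))
      (insert (X, Z, O ∪ I ∪ J) A) f x a → ArgMin D.TripleOk (D.tripleVal (s.real rH))
      (A ∪ D.block X Z O) f x a := fun h => by
    refine h.extend (Set.insert_subset (.inr hmem) Set.subset_union_left) hok fun c hc hok' =>
      hc.imp_right fun hc => ?_
    obtain ⟨X', Z', m⟩ := c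
    obtain ⟨rfl, rfl, I', hI', J', hJ', rfl⟩ := hc
    rw [tripleOk_iff hI' hJ'] at hok'
    rw [tripleVal_eq hI' hJ', ← hval]
    exact add_le_add (hbI I' hI' hok'.1) (hbJ J' hJ' hok'.2)
  have hmask : mask (O ∪ I ∪ J) = mask O + mask I + mask J := by
    rw [mask_union, mask_union (disjoint_six (r := 0) (by omega) hOm hI7)]
    rw [Finset.disjoint_union_left]
    exact ⟨disjoint_six (r := 1) (by omega) hOm hJ8, disjoint_seven hI7 hJ8⟩
  have hmlt : mask (O ∪ I ∪ J) < 2 ^ D.bits := by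
    refine pow_lt_bits (a := D.n) (by omega) (mask_lt fun v hv => ?_).le
    rcases Finset.mem_union.1 hv with hv | hv
    · rcases Finset.mem_union.1 hv with hv | hv
      exacts [family_lt hOm hv, family_lt hI7 hv]
    · exact family_lt hJ8 hv
  refine Exec.setReal_seq ?_
  refine minProg_exec (A := A) (a := T₀) (b := (X, Z, O ∪ I ∪ J)) (ok := D.TripleOk)
    (val := D.tripleVal (s.real rH)) ?_ hok ?_ (by norm_num) (fun hm => ?_) (fun hm => ?_)
  · simpa [gf, gv] using hmin
  · simpa using hval
  · refine Exec.setReal_seq (t := 1 + (1 + (1 + 1))) (Exec.setNat_seq ?_ (Exec.setNat_seq ?_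
      (Exec.setNat_seq ?_ (Exec.setNat (lt_bits (by simp))
        ⟨(X, Z, O ∪ I ∪ J), fun _ => ?_, ?_⟩))))
    · simpa [c1] using hlt hXm
    · simpa [c2] using hlt hZm
    · simpa [c3, hI e1, hJ e2, ← hmask] using hmlt
    · simp [c1, c2, c3, hI e1, hJ e2, ← hmask]
    · have := hext hm
      simpa [hval] using this
  · refine ⟨T₀, by simpa [gf, gx, gz, gm] using hT₀, hext ?_⟩
    simpa [gf, gv] using hm

theorem length_family_pos (l : ℕ) : 0 < (D.family l).length := length_enum_pos _ _ _

theorem seen_succ (i : ℕ) : D.seen (i + 1) = D.seen i ∪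
    D.block ((D.family 4).getD (i % (D.family 4).length) ∅)
    ((D.family 5).getD (i / (D.family 4).length % (D.family 5).length) ∅)
    ((D.family 6).getD (i / ((D.family 4).length * (D.family 5).length)) ∅) := by
  ext T
  constructor
  · rintro ⟨j, hj, h⟩
    rcases Nat.lt_succ_iff_lt_or_eq.1 hj with hj | rfl
    exacts [.inl ⟨j, hj, h⟩, .inr h]
  · rintro (⟨j, hj, h⟩ | h)
    exacts [⟨j, by omega, h⟩, ⟨i, by omega, h⟩]

theorem mem_seen_rounds {T : Triple} : T ∈ D.seen D.rounds ↔ T.1 ∈ D.family 4 ∧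
    T.2.1 ∈ D.family 5 ∧ ∃ O ∈ D.family 6, ∃ I ∈ D.family 7, ∃ J ∈ D.family 8,
      T.2.2 = O ∪ I ∪ J := by
  have p4 := length_family_pos (D := D) 4
  have p5 := length_family_pos (D := D) 5
  obtain ⟨X, Z, m⟩ := T
  constructor
  · rintro ⟨i, hi, rfl, rfl, h⟩
    have i4 := Nat.mod_lt i p4
    have i5 := Nat.mod_lt (i / (D.family 4).length) p5
    have i6 : i / ((D.family 4).length * (D.family 5).length) < (D.family 6).length :=
      Nat.div_lt_of_lt_mul hi
    rw [List.getD_eq_getElem _ _ i6] at h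
    rw [List.getD_eq_getElem _ _ i4, List.getD_eq_getElem _ _ i5]
    exact ⟨List.getElem_mem _, List.getElem_mem _, _, List.getElem_mem _, h⟩
  · rintro ⟨hX, hZ, O, hO, h⟩
    obtain ⟨x, hx, rfl⟩ := List.getElem_of_mem hX
    obtain ⟨z, hz, rfl⟩ := List.getElem_of_mem hZ
    obtain ⟨o, ho, rfl⟩ := List.getElem_of_mem hO
    have e1 : (x + (D.family 4).length * (z + (D.family 5).length * o)) % (D.family 4).length = x := by
      rw [Nat.add_mul_mod_self_left, Nat.mod_eq_of_lt hx]
    have e2 : (x + (D.family 4).length * (z + (D.family 5).length * o)) / (D.family 4).length =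
        z + (D.family 5).length * o := by
      rw [Nat.add_mul_div_left _ _ p4, Nat.div_eq_of_lt hx, zero_add]
    refine ⟨x + (D.family 4).length * (z + (D.family 5).length * o), ?_, ?_, ?_, ?_⟩
    · rw [rounds]
      have h1 : z + (D.family 5).length * o + 1 ≤ (D.family 5).length * (D.family 6).length := by
        have : (D.family 5).length * (o + 1) ≤ (D.family 5).length * (D.family 6).length :=
          Nat.mul_le_mul_left _ ho
        rw [mul_add] at this; omega
      have h2 := Nat.mul_le_mul_left (D.family 4).length h1
      rw [mul_add, ← mul_assoc] at h2
      omega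
    · rw [e1]; exact (List.getD_eq_getElem _ _ hx).symm
    · rw [e2, Nat.add_mul_mod_self_left, Nat.mod_eq_of_lt hz]
      exact (List.getD_eq_getElem _ _ hz).symm
    · rw [← Nat.div_div_eq_div_mul, e2, Nat.add_mul_div_left _ _ p5, Nat.div_eq_of_lt hz, zero_add,
        List.getD_eq_getElem _ _ ho]
      exact h

/-- The round counter needs about 3n bits, more than the masks and list lengths, and still fits into
the 4n + 8 bits allowed. -/
theorem rounds_le : D.rounds ≤ 2 ^ (3 * D.n) := by
  calc D.rounds ≤ 2 ^ D.n * 2 ^ D.n * 2 ^ D.n := by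
        unfold rounds
        gcongr <;> exact length_enum_le _ _ _
    _ = _ := by ring

theorem mainProg_exec (hD : D.Ok) {s : State} (hs : D.Ready s) {N : ℕ}
    (hN : ∀ r < 2, (D.family (7 + r)).length ≤ N) :
    Exec D.bits mainProg s (1 + (D.rounds * (mainTime D.n N + 2) + 2)) fun s' =>
      D.Recorded (s.real rH) (D.seen D.rounds) s' := by
  refine Exec.setNat_seq (lt_bits (by simp)) ?_
  set s₁ := s.writeNat aGf _ _ with hs₁
  have r₁ : D.Ready s₁ := hs.congr (fun a ha => State.writeNat_nat_ne _ _ _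
    (by revert ha a; decide)) (fun a ha => rfl)
  have hH : s₁.real rH = s.real rH := rfl
  have g₁ : s₁.nat aGf 0 = 0 := by simp [hs₁]
  clear_value s₁
  rw [← hH]
  refine Exec.forLoop D.rounds _ (fun j s' => D.Recorded (s₁.real rH) (D.seen j) s') (by decide)
    (pow_lt_bits (a := 3 * D.n) (by omega) rounds_le)
    (fun j s x h => by simpa [Recorded] using h) (fun s' h => ?_)
    ⟨(∅, ∅, ∅), by simp [g₁], .inl ⟨g₁, by simp [seen]⟩⟩ ?_ (fun s' _ h => h)
  · simp [h.1 aLen (by decide), rounds, (r₁.lists 4 (by omega)).len, (r₁.lists 5 (by omega)).len,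
      (r₁.lists 6 (by omega)).len]
  · intro i hi s₂ hf₂ hA h₂
    have r₂ : D.Ready s₂ := r₁.congr (hf₂.agree _ (by decide)) (hf₂.agree_real _ (by decide))
    have i4 := Nat.mod_lt i (length_family_pos (D := D) 4)
    have i5 := Nat.mod_lt (i / (D.family 4).length) (length_family_pos (D := D) 5)
    have i6 : i / ((D.family 4).length * (D.family 5).length) < (D.family 6).length :=
      Nat.div_lt_of_lt_mul hi
    have hH₂ : s₂.real rH = s₁.real rH := hf₂.2 _ (by decide)
    rw [seen_succ, ← hH₂, List.getD_eq_getElem _ _ i4, List.getD_eq_getElem _ _ i5,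
      List.getD_eq_getElem _ _ i6]
    rw [← hH₂] at h₂
    exact mainStep_exec hD r₂ hA (List.getElem_mem _) (List.getElem_mem _) (List.getElem_mem _)
      ((r₂.lists 4 (by omega)).mask _ i4) ((r₂.lists 5 (by omega)).mask _ i5)
      ((r₂.lists 6 (by omega)).mask _ i6) hN h₂

end Data
end Sched

namespace Sched

open RealRAM
open RealRAM.NExpr (get var)
open RealRAM.Program (setNat setReal forLoop branch)

namespace Data

variable {D : Data}

/-! ## Orderings of the jobs of a quarter -/

/-- `f` orders `S` in the first positions of quarter `q`. -/
structure IsOrd (D : Data) (q : ℕ) (S : Finset ℕ) (f : ℕ → ℕ) : Prop where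
  lower : ∀ v ∈ S, q * (D.n / 4) ≤ f v
  upper : ∀ v ∈ S, f v < q * (D.n / 4) + S.card
  inj : Set.InjOn f S
  mono : ∀ u ∈ S, ∀ v ∈ S, D.pr u v ≠ 0 → f u < f v

/-- The contribution of `S` to the cost of the ordering `f`. -/
noncomputable def ordCost (D : Data) (f : ℕ → ℕ) (S : Finset ℕ) : ℝ :=
  ∑ v ∈ S, ((D.n - f v : ℕ) : ℝ) * D.tt v

theorem ordCost_congr {f g : ℕ → ℕ} {S : Finset ℕ} (h : ∀ v ∈ S, f v = g v) :
    D.ordCost f S = D.ordCost g S :=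
  Finset.sum_congr rfl fun v hv => by rw [h v hv]

theorem IsOrd.congr {q : ℕ} {f g : ℕ → ℕ} {S : Finset ℕ} (hf : D.IsOrd q S f)
    (h : ∀ v ∈ S, f v = g v) : D.IsOrd q S g where
  lower v hv := by rw [← h v hv]; exact hf.lower v hv
  upper v hv := by rw [← h v hv]; exact hf.upper v hv
  inj u hu v hv huv := hf.inj hu hv (by rwa [h u hu, h v hv])
  mono u hu v hv huv := by rw [← h u hu, ← h v hv]; exact hf.mono u hu v hv huv

theorem family_erase {l : ℕ} {S : Finset ℕ} (hS : S ∈ D.family l) (v : ℕ) :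
    S.erase v ∈ D.family l := by
  rw [mem_family] at hS ⊢
  exact ⟨fun i hi => hS.1 i (Finset.mem_of_mem_erase hi),
    (load_mono _ (Finset.erase_subset _ _)).trans hS.2⟩

/-- The job in the last position. -/
theorem IsOrd.exists_last {q : ℕ} {f : ℕ → ℕ} {S : Finset ℕ} (hf : D.IsOrd q S f)
    (hS : S.Nonempty) : ∃ v, D.Last S v ∧ f v = q * (D.n / 4) + (S.card - 1) := by
  have hc := hS.card_pos
  have himg : S.image f = Finset.Ico (q * (D.n / 4)) (q * (D.n / 4) + S.card) := by
    refine Finset.eq_of_subset_of_card_le ?_ ?_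
    · intro x hx
      obtain ⟨v, hv, rfl⟩ := Finset.mem_image.1 hx
      exact Finset.mem_Ico.2 ⟨hf.lower v hv, hf.upper v hv⟩
    · rw [Finset.card_image_of_injOn hf.inj, Nat.card_Ico]; omega
  have : q * (D.n / 4) + (S.card - 1) ∈ S.image f := by
    rw [himg, Finset.mem_Ico]; omega
  obtain ⟨v, hv, hvf⟩ := Finset.mem_image.1 this
  refine ⟨v, ⟨hv, fun u hu => ?_⟩, hvf⟩
  by_contra hpr
  have h1 := hf.mono v hv u hu hpr
  have h2 := hf.upper u hu
  omega

theorem IsOrd.erase {q v : ℕ} {f : ℕ → ℕ} {S : Finset ℕ} (hf : D.IsOrd q S f) (hv : v ∈ S)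
    (hfv : f v = q * (D.n / 4) + (S.card - 1)) : D.IsOrd q (S.erase v) f where
  lower u hu := hf.lower u (Finset.mem_of_mem_erase hu)
  upper u hu := by
    have h1 := Finset.mem_erase.1 hu
    have h2 := hf.upper u h1.2
    have h3 : f u ≠ f v := fun h => h1.1 (hf.inj h1.2 hv h)
    rw [Finset.card_erase_of_mem hv]
    omega
  inj := hf.inj.mono (by simp)
  mono u hu w hw := hf.mono u (Finset.mem_of_mem_erase hu) w (Finset.mem_of_mem_erase hw)

/-- The table of the dynamic program contains lower bounds. -/
theorem dp_le {q : ℕ} {H : ℕ → ℝ} {P : ℕ → ℕ} (h : ∀ S ∈ D.family q, D.DpOk q S H P) {f : ℕ → ℕ}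
    (S : Finset ℕ) (hS : S ∈ D.family q) (hf : D.IsOrd q S f) :
    H (mask S * 4 + q) ≤ D.ordCost f S := by
  induction S using Finset.strongInduction with
  | H S ih =>
    obtain ⟨x, hx⟩ := h S hS
    rcases S.eq_empty_or_nonempty with rfl | hne
    · rcases hx with ⟨-, h0, -⟩ | ⟨-, h1, -⟩
      · rw [h0]; simp [ordCost]
      · exact absurd h1.1 (Finset.notMem_empty _)
    · obtain ⟨v, hv, hfv⟩ := hf.exists_last hne
      rcases hx with ⟨-, -, h1⟩ | ⟨-, -, -, h1⟩
      · exact absurd hv (h1 v (family_lt hS hv.1))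
      · refine (h1 v (family_lt hS hv.1) hv).trans ?_
        have := ih (S.erase v) (Finset.erase_ssubset hv.1) (family_erase hS v) (hf.erase hv.1 hfv)
        rw [cand, ordCost, ← Finset.sum_erase_add _ _ hv.1]
        refine add_le_add this (le_of_eq ?_)
        rw [posCost, hfv]

/-- The jobs of `Q \ T` have been placed by `f` in the last positions of an ordering of `Q`, at
optimal cost according to the table `H`. -/
structure Rebuilt (D : Data) (q : ℕ) (Q T : Finset ℕ) (H : ℕ → ℝ) (f : ℕ → ℕ) : Prop where
  sub : T ⊆ Q
  fam : T ∈ D.family q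
  lower : ∀ v ∈ Q \ T, q * (D.n / 4) + T.card ≤ f v
  upper : ∀ v ∈ Q \ T, f v < q * (D.n / 4) + Q.card
  inj : Set.InjOn f (Q \ T : Finset ℕ)
  mono : ∀ v ∈ Q \ T, ∀ u ∈ Q, D.pr v u ≠ 0 → u ∈ Q \ T ∧ f v < f u
  cost : H (mask Q * 4 + q) = H (mask T * 4 + q) + D.ordCost f (Q \ T)

theorem Rebuilt.init {q : ℕ} {Q : Finset ℕ} (hQ : Q ∈ D.family q) (H : ℕ → ℝ) (f : ℕ → ℕ) :
    D.Rebuilt q Q Q H f := by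
  constructor <;> simp [hQ, ordCost]

/-- Since v attains the table value at T, putting it in the last open position preserves the cost
identity. No job of T has to follow v, so all its successors in Q have been placed already, further
to the right. -/
theorem Rebuilt.step {q v : ℕ} {Q T : Finset ℕ} {H : ℕ → ℝ} {f : ℕ → ℕ} (h : D.Rebuilt q Q T H f)
    (hv : D.Last T v) (hH : H (mask T * 4 + q) = D.cand H q T v) :
    D.Rebuilt q Q (T.erase v) H (Function.update f v (q * (D.n / 4) + (T.card - 1))) := by
  have hpos : 0 < T.card := Finset.card_pos.2 ⟨v, hv.1⟩
  have hvQ := h.sub hv.1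
  have hcard := Finset.card_le_card h.sub
  have hins : Q \ T.erase v = insert v (Q \ T) := by
    rw [Finset.sdiff_erase hvQ]
  have hnot : v ∉ Q \ T := by simp [hv.1]
  have hne : ∀ u ∈ Q \ T, u ≠ v := fun u hu huv => hnot (huv ▸ hu)
  have hupd : ∀ u ∈ Q \ T, Function.update f v (q * (D.n / 4) + (T.card - 1)) u = f u :=
    fun u hu => Function.update_of_ne (hne u hu) _ _
  refine ⟨(Finset.erase_subset _ _).trans h.sub, family_erase h.fam v, ?_, ?_, ?_, ?_, ?_⟩
  · rw [hins, Finset.card_erase_of_mem hv.1]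
    intro u hu
    rcases Finset.mem_insert.1 hu with rfl | hu
    · simp
    · rw [hupd u hu]; have := h.lower u hu; omega
  · rw [hins]
    intro u hu
    rcases Finset.mem_insert.1 hu with rfl | hu
    · simp; omega
    · rw [hupd u hu]; exact h.upper u hu
  · rw [hins]
    intro u hu w hw huw
    rw [Finset.mem_coe, Finset.mem_insert] at hu hw
    rcases hu with rfl | hu <;> rcases hw with rfl | hw
    · rfl
    · rw [hupd w hw, Function.update_self] at huw
      have := h.lower w hw; omega
    · rw [hupd u hu, Function.update_self] at huw
      have := h.lower u hu; omega
    · rw [hupd u hu, hupd w hw] at huw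
      exact h.inj hu hw huw
  · rw [hins]
    intro w hw u hu hpr
    rcases Finset.mem_insert.1 hw with rfl | hw
    · have hu' : u ∈ Q \ T := Finset.mem_sdiff.2 ⟨hu, fun huT => hpr (hv.2 u huT)⟩
      refine ⟨Finset.mem_insert_of_mem hu', ?_⟩
      rw [hupd u hu', Function.update_self]
      have := h.lower u hu'; omega
    · have := h.mono w hw u hu hpr
      refine ⟨Finset.mem_insert_of_mem this.1, ?_⟩
      rw [hupd w hw, hupd u this.1]
      exact this.2
  · rw [hins, ordCost, Finset.sum_insert hnot, Function.update_self, h.cost, hH, cand, posCost,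
      add_assoc]
    congr 2
    exact ordCost_congr fun u hu => (hupd u hu).symm

theorem Rebuilt.isOrd {q : ℕ} {Q T : Finset ℕ} {H : ℕ → ℝ} {P f : ℕ → ℕ}
    (h : D.Rebuilt q Q T H f) (hT : T.card = 0) (hdp : D.DpOk q T H P) :
    D.IsOrd q Q f ∧ H (mask Q * 4 + q) = D.ordCost f Q := by
  obtain rfl := Finset.card_eq_zero.1 hT
  have h0 : H (mask ∅ * 4 + q) = 0 := by
    obtain ⟨x, ⟨-, h0, -⟩ | ⟨-, h1, -⟩⟩ := hdp
    · exact h0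
    · exact absurd h1.1 (Finset.notMem_empty _)
  obtain ⟨-, -, h1, h2, h3, h4, h5⟩ := h
  rw [h0, zero_add] at h5
  simp only [Finset.sdiff_empty, Finset.card_empty, add_zero] at h1 h2 h3 h4 h5
  exact ⟨⟨h1, h2, h3, fun u hu v hv huv => (h4 u hu v hv huv).2⟩, h5⟩

/-! ## Writing the answer -/

def outStep : Program :=
  setNat aOut (get aBp eAddr) (var iA * (var aIn / 4) + (var aIn / 4 - 1 - var iB));;
  setNat aS 0 (var aS - get aPow (get aBp eAddr))

def outLoop : Program :=
  forLoop iA 4 (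
    setNat aS 0 (get aQ (var iA));;
    forLoop iB (var aIn / 4) outStep)

def outProg : Program :=
  branch (.natLE 1 (var aGf))
    (setNat aRes 0 1;;
      setNat aX 0 (var aGx);;
      setNat aZ 0 (var aGz);;
      setNat aMm 0 (var aGm);;
      colorProg;;
      outLoop)
    (setNat aRes 0 0)

/-- `f` orders every quarter of the colouring, at optimal cost according to the table `H`. -/
def Ordered (D : Data) (T : Triple) (H : ℕ → ℝ) (f : ℕ → ℕ) (j : ℕ) : Prop :=
  ∀ q < j, D.IsOrd q (D.part T.1 T.2.1 T.2.2 q) f ∧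
    D.partVal H T.1 T.2.1 T.2.2 q = D.ordCost f (D.part T.1 T.2.1 T.2.2 q)

theorem Ordered.congr {T : Triple} {H : ℕ → ℝ} {f g : ℕ → ℕ} {j : ℕ} (h : D.Ordered T H f j)
    (hfg : ∀ q < j, ∀ v ∈ D.part T.1 T.2.1 T.2.2 q, f v = g v) : D.Ordered T H g j :=
  fun q hq => ⟨(h q hq).1.congr (hfg q hq), by rw [(h q hq).2, ordCost_congr (hfg q hq)]⟩

theorem outLoop_exec {s : State} (hs : D.Ready s) {T : Triple}
    (hdp : ∀ q < 4, ∀ S ∈ D.family q, D.DpOk q S (s.real rH) (s.nat aBp))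
    (hlast : ∀ S : Finset ℕ, S.Nonempty → (∀ v ∈ S, v < D.n) → ∃ v, D.Last S v)
    (hfam : ∀ q < 4, D.part T.1 T.2.1 T.2.2 q ∈ D.family q)
    (hcard : ∀ q < 4, (D.part T.1 T.2.1 T.2.2 q).card = D.n / 4)
    (hcol : D.Colored T.1 T.2.1 T.2.2 D.n s) :
    Exec D.bits outLoop s (4 * ((1 + (D.n / 4 * ((1 + 1) + 2) + 2)) + 2) + 2)
      fun s' => D.Ordered T (s.real rH) (s'.nat aOut) 4 := by
  refine Exec.forLoop 4 (1 + (D.n / 4 * ((1 + 1) + 2) + 2))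
    (fun j s' => D.Ordered T (s.real rH) (s'.nat aOut) j) (by decide) (lt_bits (by omega))
    (fun j s x h => by simpa using h) (fun s' h => by simp)
    (fun q hq => by omega) ?_ (fun s' _ h => h)
  intro q hq s₁ hf₁ hA h
  have r₁ : D.Ready s₁ := hs.congr (hf₁.agree _ (by decide)) (hf₁.agree_real _ (by decide))
  have b1 : s₁.nat aBp = s.nat aBp := hf₁.1 _ (by decide)
  have b2 : s₁.nat aQ q = mask (D.part T.1 T.2.1 T.2.2 q) := by
    rw [hf₁.1 _ (by decide), hcol.q q hq]
  have b3 : s₁.real rH = s.real rH := hf₁.2 _ (by decide)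
  have hQf := hfam q hq
  have hQc := hcard q hq
  set Q := D.part T.1 T.2.1 T.2.2 q with hQ
  have hlt : ∀ S : Finset ℕ, S ∈ D.family q → mask S < 2 ^ D.bits := fun S hS =>
    pow_lt_bits (a := D.n) (by omega) (mask_lt fun v hv => family_lt hS hv).le
  refine Exec.setNat_seq ?_ ?_
  · simpa [hA, b2] using hlt Q hQf
  refine Exec.forLoop (D.n / 4) _ (fun j s' => ∃ S : Finset ℕ, s'.nat aS 0 = mask S ∧
      S.card + j = D.n / 4 ∧ D.Rebuilt q Q S (s.real rH) (s'.nat aOut) ∧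
      ∀ v ∉ Q, s'.nat aOut v = s₁.nat aOut v) (by decide) (lt_bits (by omega))
    (fun j s x h => by simpa using h) (fun s' h => ?_) ⟨Q, ?_, hQc, ?_, ?_⟩ ?_ ?_
  · simp [h.1 aIn (by decide), r₁.input.n]
  · simp [hA, b2]
  · exact Rebuilt.init hQf _ _
  · simp
  · intro j hj s₂ hf₂ hB h₂
    obtain ⟨S, hS, hSj, hreb, hout⟩ := h₂
    have c1 : s₂.nat aBp = s.nat aBp := by rw [hf₂.1 _ (by decide)]; simp [b1]
    have c2 : s₂.nat iA 0 = q := by rw [hf₂.1 _ (by decide)]; simp [hA]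
    have c3 : s₂.nat aIn 0 = D.n := by rw [hf₂.1 _ (by decide)]; simp [r₁.input.n]
    have c4 : ∀ v ≤ D.n, s₂.nat aPow v = 2 ^ v := by
      rw [hf₂.1 _ (by decide)]; simpa using r₁.pow
    have hSn : ∀ v ∈ S, v < D.n := fun v hv => family_lt hreb.fam hv
    obtain ⟨u, hu⟩ := hlast S (Finset.card_pos.1 (by omega)) hSn
    obtain ⟨f, ⟨-, -, hno⟩ | ⟨-, hl, hx, -⟩⟩ := hdp q hq S hreb.fam
    · exact absurd hu (hno u (hSn u hu.1))
    set v := s.nat aBp (mask S * 4 + q) with hv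
    have haddr : NExpr.eval s₂ (get aBp eAddr) = v := by simp [eAddr, hS, c1, c2, hv]
    have hpos : NExpr.eval s₂ (var iA * (var aIn / 4) + (var aIn / 4 - 1 - var iB)) =
        q * (D.n / 4) + (S.card - 1) := by
      simp [c2, c3, hB]; omega
    refine Exec.setNat_seq ?_ (Exec.setNat ?_ ⟨S.erase v, ?_, ?_, ?_, ?_⟩)
    · rw [hpos]
      refine lt_bits ?_
      have : q * (D.n / 4) ≤ 4 * (D.n / 4) := Nat.mul_le_mul_right _ hq.le
      omega
    · simp [eAddr, hS, c1, c2, ← hv, c4 v (hSn v hl.1).le, ← mask_erase hl.1]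
      exact hlt _ (family_erase hreb.fam v)
    · simp [eAddr, hS, c1, c2, ← hv, c4 v (hSn v hl.1).le, ← mask_erase hl.1]
    · rw [Finset.card_erase_of_mem hl.1]
      have := Finset.card_pos.2 ⟨v, hl.1⟩
      omega
    · rw [State.writeNat_nat_ne _ _ _ (by decide), State.writeNat_nat_same, haddr, hpos]
      exact hreb.step hl hx
    · intro w hw
      have : w ≠ v := fun h => hw (h ▸ hreb.sub hl.1)
      rw [State.writeNat_nat_ne _ _ _ (by decide), State.writeNat_nat_same, haddr,
        Function.update_of_ne this]
      exact hout w hw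
  · rintro s' - ⟨S, -, hSj, hreb, hout⟩ q' hq'
    rcases Nat.lt_succ_iff_lt_or_eq.1 hq' with hq' | rfl
    · refine (h.congr (g := s'.nat aOut) fun p hp w hw => (hout w fun hwQ => ?_).symm) q' hq'
      have h1 := (Finset.mem_filter.1 hw).2
      have h2 := (Finset.mem_filter.1 hwQ).2
      omega
    · exact hreb.isOrd (by omega) (hdp q' hq S hreb.fam)

def outTime (n : ℕ) : ℕ := (1 + (1 + (1 + (1 + (colorTime n +
  (4 * ((1 + (n / 4 * ((1 + 1) + 2) + 2)) + 2) + 2)))))) + 1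

/-- The memory contains the answer. -/
def Solved (D : Data) (H : ℕ → ℝ) (s : State) : Prop :=
  (s.nat aRes 0 = 0 ∧ ∀ T ∈ D.seen D.rounds, ¬ D.TripleOk T) ∨
  (s.nat aRes 0 = 1 ∧ ∃ T ∈ D.seen D.rounds, D.TripleOk T ∧ D.Ordered T H (s.nat aOut) 4 ∧
    ∀ T' ∈ D.seen D.rounds, D.TripleOk T' → D.tripleVal H T ≤ D.tripleVal H T')

/-- In either orientation the two searches cover every quarter exactly once, as opposite edges of a
4-cycle do. -/
theorem forall_lt_four {p : ℕ → Prop} : (p 0 ∧ p (D.second 0)) ∧ p 1 ∧ p (D.second 1) ↔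
    ∀ q < 4, p q := by
  have ho : D.orient = 0 ∨ D.orient = 1 := by have := D.orient_le; omega
  constructor
  · intro h q hq
    rcases ho with ho | ho <;> simp [second, ho] at h <;> interval_cases q <;> tauto
  · intro h
    rcases ho with ho | ho <;> simp [second, ho, h]

theorem tripleOk_iff_fit {T : Triple} : D.TripleOk T ↔ ∀ q < 4, D.Fit T.1 T.2.1 T.2.2 q :=
  forall_lt_four (D := D) (p := fun q => D.Fit T.1 T.2.1 T.2.2 q)

theorem tripleVal_eq_sum {H : ℕ → ℝ} {T : Triple} :
    D.tripleVal H T = ∑ q ∈ Finset.range 4, D.partVal H T.1 T.2.1 T.2.2 q := by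
  have ho : D.orient = 0 ∨ D.orient = 1 := by have := D.orient_le; omega
  rw [tripleVal, searchVal, searchVal]
  rcases ho with ho | ho <;> simp [second, ho, Finset.sum_range_succ] <;> ring

theorem outProg_exec (hD : D.Ok) {s : State} (hs : D.Ready s)
    (hdp : ∀ q < 4, ∀ S ∈ D.family q, D.DpOk q S (s.real rH) (s.nat aBp))
    (hlast : ∀ S : Finset ℕ, S.Nonempty → (∀ v ∈ S, v < D.n) → ∃ v, D.Last S v)
    (hfam : ∀ T ∈ D.seen D.rounds, ∀ q < 4, D.part T.1 T.2.1 T.2.2 q ∈ D.family q)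
    (h : D.Recorded (s.real rH) (D.seen D.rounds) s) :
    Exec D.bits outProg s (outTime D.n) (D.Solved (s.real rH)) := by
  obtain ⟨T, hT, hmin⟩ := h
  refine Exec.branch (fun hb => ?_) (fun hb => ?_) <;>
    rw [Test.holds_natLE, NExpr.eval_get, NExpr.eval_lit, NExpr.eval_ofNat] at hb
  swap
  · refine Exec.le (t := 1) (Exec.setNat (lt_bits (by simp)) (.inl ⟨by simp, ?_⟩)) (by omega)
    rcases hmin with ⟨-, h⟩ | ⟨h, -⟩
    · exact h
    · omega
  rcases hmin with ⟨h, -⟩ | ⟨hg, hTA, hok, hval, hbest⟩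
  · omega
  obtain ⟨t1, t2, t3⟩ := hT hg
  have hlt : ∀ {l} {S : Finset ℕ}, S ∈ D.family l → mask S < 2 ^ D.bits := fun hS =>
    pow_lt_bits (a := D.n) (by omega) (mask_lt fun v hv => family_lt hS hv).le
  obtain ⟨m1, m2, O, hO, I, hI, J, hJ, m3⟩ := mem_seen_rounds.1 hTA
  have hm : mask T.2.2 < 2 ^ D.bits := by
    rw [m3]
    refine pow_lt_bits (a := D.n) (by omega) (mask_lt fun v hv => ?_).le
    rcases Finset.mem_union.1 hv with hv | hv
    · rcases Finset.mem_union.1 hv with hv | hv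
      exacts [family_lt hO hv, family_lt hI hv]
    · exact family_lt hJ hv
  refine Exec.setNat_seq (lt_bits (by simp)) (Exec.setNat_seq ?_ (Exec.setNat_seq ?_
    (Exec.setNat_seq ?_ ?_)))
  · simpa [t1] using hlt m1
  · simpa [t2] using hlt m2
  · simpa [t3] using hm
  set s₁ := (((s.writeNat aRes _ _).writeNat aX _ _).writeNat aZ _ _).writeNat aMm _ _ with hs₁
  have n₁ : ∀ a ∉ [aRes, aX, aZ, aMm], s₁.nat a = s.nat a := fun a ha => by
    simp only [List.mem_cons, List.not_mem_nil, or_false, not_or] at ha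
    rw [hs₁, State.writeNat_nat_ne _ _ _ ha.2.2.2, State.writeNat_nat_ne _ _ _ ha.2.2.1,
      State.writeNat_nat_ne _ _ _ ha.2.1, State.writeNat_nat_ne _ _ _ ha.1]
  have v₁ : s₁.real = s.real := rfl
  have r₁ : D.Ready s₁ := hs.congr (fun a ha => n₁ a (by revert ha a; decide)) (fun a ha => rfl)
  have b0 : s₁.nat aRes 0 = 1 := by simp [hs₁]
  have b1 : s₁.nat aX 0 = mask T.1 := by simp [hs₁, t1]
  have b2 : s₁.nat aZ 0 = mask T.2.1 := by simp [hs₁, t2]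
  have b3 : s₁.nat aMm 0 = mask T.2.2 := by simp [hs₁, t3]
  clear_value s₁
  refine Exec.seq (colorProg_exec hD r₁.toBase b1 b2 b3) fun s₂ hf₂ h₂ => ?_
  have r₂ : D.Ready s₂ := r₁.congr (hf₂.agree _ (by decide)) (hf₂.agree_real _ (by decide))
  have c1 : s₂.real rH = s.real rH := by rw [hf₂.2 _ (by decide), v₁]
  have c2 : s₂.nat aBp = s.nat aBp := by rw [hf₂.1 _ (by decide), n₁ _ (by decide)]
  refine (outLoop_exec r₂ (T := T) (by rw [c1, c2]; exact hdp) hlast (hfam T hTA)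
    (fun q hq => (tripleOk_iff_fit.1 hok q hq).1) h₂).mono le_rfl fun s₃ hf₃ h₃ => ?_
  refine .inr ⟨?_, T, hTA, hok, by rwa [c1] at h₃, fun T' hT' hok' => ?_⟩
  · rw [hf₃.1 _ (by decide), hf₂.1 _ (by decide), b0]
  · rw [← hval]
    exact hbest T' hT' hok'

end Data
end Sched

namespace Sched

open RealRAM
open RealRAM.NExpr (get var)
open RealRAM.Program (setNat setReal forLoop branch)

namespace Data

variable {D : Data}

/-! ## The whole algorithm -/

theorem load_eq_zero {c : ℕ → ℕ} {S : Finset ℕ} (h : ∀ v ∈ S, c v ≤ 1) : load c S = 0 :=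
  Finset.sum_eq_zero fun v hv => by have := h v hv; omega

theorem load_le_load {c c' : ℕ → ℕ} {S T : Finset ℕ}
    (h : ∀ v ∈ S, 2 ≤ c v → v ∈ T ∧ c v ≤ c' v) : load c S ≤ load c' T := by
  calc load c S = ∑ v ∈ S.filter (fun v => 2 ≤ c v), (c v - 1) := by
        rw [load, Finset.sum_filter]
        refine Finset.sum_congr rfl fun v _ => ?_
        split_ifs <;> omega
    _ ≤ ∑ v ∈ S.filter (fun v => 2 ≤ c v), (c' v - 1) := by
        refine Finset.sum_le_sum fun v hv => ?_
        have := (h v (Finset.mem_filter.1 hv).1 (Finset.mem_filter.1 hv).2).2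
        omega
    _ ≤ load c' T := by
        refine Finset.sum_le_sum_of_subset fun v hv => ?_
        exact (h v (Finset.mem_filter.1 hv).1 (Finset.mem_filter.1 hv).2).1

theorem fx_cases (D : Data) (v : ℕ) : D.fx v = 0 ∨ D.fx v = 1 := by
  have := D.fx_le v; omega

/-- Jobs of class 2 reach B only through X and C only through Z, so the limits on X and Z bound the
load of the quarters. Hence every table cell consulted by the search has been filled. -/
theorem part_mem_family {X Z m : Finset ℕ} (hX : X ∈ D.family 4)
    (hZ : Z ∈ D.family 5) {q : ℕ} (hq : q < 4) : D.part X Z m q ∈ D.family q := by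
  have hcol : ∀ v ∈ D.part X Z m q, v < D.n ∧ D.col X Z m v = q := fun v hv => by
    simpa [partTo] using hv
  rw [mem_family]
  refine ⟨fun v hv => ⟨(hcol v hv).1, ?_⟩, ?_⟩
  · have h1 := (hcol v hv).2
    have h2 := D.na_le v
    have h3 := D.nd_le v
    unfold col at h1
    rcases D.fx_cases v with hf | hf
    · rw [if_neg (by omega)] at h1
      interval_cases q <;> simp only [cls, hf] <;> split_ifs at h1 <;> omega
    · rw [if_pos hf] at h1
      interval_cases q <;> simp [cls, hf, h1]
  · have hle : ∀ {l l' : ℕ} {S : Finset ℕ}, S ∈ D.family l' → D.lim l = D.lim l' →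
        (∀ v ∈ D.part X Z m q, 2 ≤ D.cls l v → v ∈ S ∧ D.cls l v ≤ D.cls l' v) →
        load (D.cls l) (D.part X Z m q) ≤ D.lim l := fun hS hl h =>
      (load_le_load h).trans (hl ▸ (mem_family.1 hS).2)
    have key : ∀ v ∈ D.part X Z m q, 2 ≤ D.cls q v →
        (q = 1 ∧ v ∈ X ∧ D.cls 1 v ≤ D.cls 4 v) ∨ (q = 2 ∧ v ∈ Z ∧ D.cls 2 v ≤ D.cls 5 v) := by
      intro v hv hc
      have h1 := (hcol v hv).2
      have h2 := D.na_le v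
      have h3 := D.nd_le v
      unfold col at h1
      rcases D.fx_cases v with hf | hf
      · rw [if_neg (by omega)] at h1
        interval_cases q <;> simp only [cls, hf] at hc ⊢
        · omega
        · have : v ∈ X := by
            split_ifs at h1 <;> first | assumption | omega
          refine .inl ⟨trivial, this, by omega⟩
        · have : v ∈ Z := by
            split_ifs at h1 <;> first | assumption | omega
          refine .inr ⟨trivial, this, by omega⟩
        · omega
      · rw [if_pos hf] at h1
        interval_cases q <;> simp [cls, hf, h1] at hc
    interval_cases q
    · rw [load_eq_zero]
      · omega
      · intro v hv; by_contra hc; have := key v hv (by omega); omega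
    · refine hle hX rfl fun v hv hc => ?_
      rcases key v hv hc with h | h
      exacts [h.2, absurd h.1 (by omega)]
    · refine hle hZ rfl fun v hv hc => ?_
      rcases key v hv hc with h | h
      exacts [absurd h.1 (by omega), h.2]
    · rw [load_eq_zero]
      · omega
      · intro v hv; by_contra hc; have := key v hv (by omega); omega

def solveProg : Program :=
  powProg;; flagProg;; orientProg;; classProg;; enumProg;; multProg;; dpProg;; mainProg;; outProg

/-- The cost of the ordering `f` whose quarters are given by the triple `T`. -/
noncomputable def tripleCost (D : Data) (T : Triple) (f : ℕ → ℕ) : ℝ :=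
  ∑ q ∈ Finset.range 4, D.ordCost f (D.part T.1 T.2.1 T.2.2 q)

/-- `f` orders all quarters of the colouring given by `T`. -/
def Arranged (D : Data) (T : Triple) (f : ℕ → ℕ) : Prop :=
  D.TripleOk T ∧ ∀ q < 4, D.IsOrd q (D.part T.1 T.2.1 T.2.2 q) f

/-- The memory contains a best ordering, or the information that there is none. -/
def Result (D : Data) (s : State) : Prop :=
  (s.nat aRes 0 = 0 ∧ ∀ T ∈ D.seen D.rounds, ∀ f, ¬ D.Arranged T f) ∨
  (s.nat aRes 0 = 1 ∧ ∃ T ∈ D.seen D.rounds, D.Arranged T (s.nat aOut) ∧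
    ∀ T' ∈ D.seen D.rounds, ∀ f, D.Arranged T' f →
      D.tripleCost T (s.nat aOut) ≤ D.tripleCost T' f)

/-- The table values are attained by the ordering written out and are lower bounds for every other
arrangement, so a triple of minimum table value gives minimum cost. -/
theorem Solved.result {H : ℕ → ℝ} {P : ℕ → ℕ} {s : State} (h : D.Solved H s)
    (hdp : ∀ q < 4, ∀ S ∈ D.family q, D.DpOk q S H P) : D.Result s := by
  rcases h with ⟨h0, h⟩ | ⟨h1, T, hT, hok, hord, hbest⟩
  · exact .inl ⟨h0, fun T hT f hf => h T hT hf.1⟩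
  · refine .inr ⟨h1, T, hT, ⟨hok, fun q hq => (hord q hq).1⟩, fun T' hT' f hf => ?_⟩
    have e1 : D.tripleCost T (s.nat aOut) = D.tripleVal H T := by
      rw [tripleVal_eq_sum]
      exact Finset.sum_congr rfl fun q hq => ((hord q (Finset.mem_range.1 hq)).2).symm
    rw [e1]
    refine (hbest T' hT' hf.1).trans ?_
    rw [tripleVal_eq_sum]
    obtain ⟨m1, m2, -⟩ := mem_seen_rounds.1 hT'
    refine Finset.sum_le_sum fun q hq => ?_
    rw [Finset.mem_range] at hq
    exact dp_le (hdp q hq) _ (part_mem_family m1 m2 hq) (hf.2 q hq)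

/-- Two quantities govern the time: the length of a list, for enumeration and dynamic program, and
the number of rounds times the length of an inner list, for the main search. L dominates both. -/
theorem solveProg_exec (hD : D.Ok)
    (hlast : ∀ S : Finset ℕ, S.Nonempty → (∀ v ∈ S, v < D.n) → ∃ v, D.Last S v)
    {s : State} (hs : D.Input s) {L : ℕ} (hL : ∀ l < 9, (D.family l).length ≤ L) {N : ℕ}
    (hN : ∀ r < 2, (D.family (7 + r)).length ≤ N) (hR : D.rounds * N ≤ L) :
    Exec D.bits solveProg s (4000 * (D.n ^ 3 * L)) D.Result := by
  have hN0 : 1 ≤ N := (length_family_pos (7 + 0)).trans_le (hN 0 (by omega))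
  have hRL : D.rounds ≤ L := (Nat.le_mul_of_pos_right _ hN0).trans hR
  have hL0 : 1 ≤ L := (length_family_pos 0).trans_le (hL 0 (by omega))
  have hn := hD.four_le
  have a1 : 64 ≤ D.n ^ 3 := Nat.pow_le_pow_left hn 3
  have a2 : 4 * D.n ^ 2 ≤ D.n ^ 3 := by rw [pow_succ D.n 2, mul_comm]; gcongr
  have a3 : 4 * D.n ≤ D.n ^ 2 := by rw [sq]; gcongr
  have b1 : 64 * L ≤ D.n ^ 3 * L := by gcongr
  have b2 : 16 * (D.n * L) ≤ D.n ^ 3 * L := by rw [← mul_assoc]; gcongr; omega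
  have b3 : 4 * (D.n ^ 2 * L) ≤ D.n ^ 3 * L := by rw [← mul_assoc]; gcongr
  have b4 : D.n ^ 3 ≤ D.n ^ 3 * L := Nat.le_mul_of_pos_right _ hL0
  have c1 : D.n * (D.rounds * N) ≤ D.n * L := by gcongr
  have c2 : D.n * D.rounds ≤ D.n * L := by gcongr
  -- A crude bound for each of the nine phases; 9 · 400 is below the 4000 claimed.
  obtain ⟨W, hW⟩ : ∃ W, W = 400 * (D.n ^ 3 * L) := ⟨_, rfl⟩
  have pow_le : (1 + (D.n * 3 + 2)) ≤ W := by
    ring_nf at *; omega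
  have flag_le : (D.n * ((1 + (1 + (1 + ((D.n * ((1 + (1 + 1)) + 2) + 2) +
      (1 + (1 + 1)))))) + 2) + 2) ≤ W := by
    ring_nf at *; omega
  have orient_le : (1 + (1 + ((D.n * ((1 + 1) + 2) + 2) + 1))) ≤ W := by
    ring_nf at *; omega
  have class_le : ((D.n * ((1 + (1 + (1 + (1 + (1 + (1 + (1 + (1 + 1)))))))) + 2) + 2) +
      (1 + (1 + (1 + (1 + (1 + (1 + (1 + (1 + (1 + (1 + (1 + (1 + 1))))))))))))) ≤ W := by
    ring_nf at *; omega
  have enum_le : (9 * ((1 + (1 + (1 + (D.n * ((1 + (L * (((1 + (1 + 1)) + 1) + 2) +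
      2)) + 2) + 2)))) + 2) + 2) ≤ W := by
    ring_nf at *; omega
  have mult_le : (D.n * ((1 + (D.n * (1 + 2) + 2)) + 2) + 2) ≤ W := by
    ring_nf at *; omega
  have dp_le : (4 * ((L * (dpTime D.n + 2) + 2) + 2) + 2) ≤ W := by
    simp only [dpTime]; ring_nf at *; omega
  have main_le : (1 + (D.rounds * (mainTime D.n N + 2) + 2)) ≤ W := by
    simp only [mainTime, searchTime, colorTime]; ring_nf at *; omega
  have out_le : (outTime D.n) ≤ W := by
    simp only [outTime, colorTime]; ring_nf at *; omega
  refine Exec.le (t := W + (W + (W + (W + (W + (W + (W + (W + W)))))))) ?_ (by omega)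
  refine Exec.seq ((powProg_exec hs.n).le pow_le) fun s₁ f₁ h₁ => ?_
  have i₁ : D.Input s₁ := hs.congr (f₁.1 _ (by decide)) (f₁.1 _ (by decide)) (f₁.1 _ (by decide))
    (f₁.1 _ (by decide)) (f₁.2 _ (by decide))
  refine Exec.seq ((flagProg_exec hD i₁).le flag_le) fun s₂ f₂ h₂ => ?_
  have i₂ : D.Base s₂ := ⟨i₁.congr (f₂.1 _ (by decide)) (f₂.1 _ (by decide)) (f₂.1 _ (by decide))
    (f₂.1 _ (by decide)) (f₂.2 _ (by decide)), by rwa [f₂.1 aPow (by decide)], h₂.1, h₂.2.1, h₂.2.2⟩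
  refine Exec.seq ((orientProg_exec i₂).le orient_le) fun s₃ f₃ h₃ => ?_
  have i₃ : D.Base s₃ := i₂.congr (f₃.agree _ (by decide)) (f₃.agree_real _ (by decide))
  refine Exec.seq ((classProg_exec hD i₃ h₃).le class_le) fun s₄ _ i₄ => ?_
  refine Exec.seq ((enumProg_exec i₄ hL).le enum_le) fun s₅ f₅ h₅ => ?_
  have i₅ : D.Tables s₅ := i₄.congr (f₅.agree _ (by decide)) (f₅.agree_real _ (by decide))
  refine Exec.seq ((multProg_exec i₅.input).le mult_le) fun s₆ f₆ h₆ => ?_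
  have i₆ : D.Ready s₆ := ⟨i₅.congr (f₆.agree _ (by decide)) (f₆.agree_real _ (by decide)),
    fun l hl => (h₅ l hl).congr (f₆.agree _ (by decide)), h₆⟩
  refine Exec.seq ((dpProg_exec hD.pr_le i₆ hL).le dp_le) fun s₇ f₇ h₇ => ?_
  have i₇ : D.Ready s₇ := i₆.congr (f₇.agree _ (by decide)) (f₇.agree_real _ (by decide))
  refine Exec.seq ((mainProg_exec hD i₇ hN).le main_le) fun s₈ f₈ h₈ => ?_
  have i₈ : D.Ready s₈ := i₇.congr (f₈.agree _ (by decide)) (f₈.agree_real _ (by decide))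
  have e1 : s₈.real rH = s₇.real rH := f₈.2 _ (by decide)
  have e2 : s₈.nat aBp = s₇.nat aBp := f₈.1 _ (by decide)
  rw [← e1, ← e2] at h₇
  rw [← e1] at h₈
  refine (outProg_exec hD i₈ h₇ hlast (fun T hT q hq => ?_) h₈).mono out_le
    fun s₉ _ h₉ => h₉.result h₇
  · obtain ⟨m1, m2, -⟩ := mem_seen_rounds.1 hT
    exact part_mem_family m1 m2 hq

end Data
end Sched

namespace Sched

namespace Data

variable {D : Data}

/-! ## Orderings of all jobs -/

/-- `f` is an ordering that agrees with all guesses. -/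
structure Schedule (D : Data) (f : ℕ → ℕ) : Prop where
  lt : ∀ v < D.n, f v < D.n
  inj : Set.InjOn f (Finset.range D.n)
  mono : ∀ u < D.n, ∀ v < D.n, D.pr u v ≠ 0 → f u < f v
  fixed : ∀ v < D.n, D.fx v = 1 → f v / (D.n / 4) = D.gg v
  -- For a branch, this condition and the next follow from precedences with special jobs; listing
  -- them makes what follows independent of M.
  na : ∀ v < D.n, D.fx v = 0 → D.na v = 1 → f v / (D.n / 4) ≠ 0
  nd : ∀ v < D.n, D.fx v = 0 → D.nd v = 1 → f v / (D.n / 4) ≠ 3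
  pB : ∑ v ∈ (Finset.range D.n).filter (fun v => f v / (D.n / 4) = 1),
    (1 - D.fx v) * D.na v = D.pB
  pC : ∑ v ∈ (Finset.range D.n).filter (fun v => f v / (D.n / 4) = 2),
    (1 - D.fx v) * D.nd v = D.pC

/-- The guesses are consistent with the precedence constraints. -/
structure Coherent (D : Data) : Prop where
  mono : ∀ u < D.n, ∀ v < D.n, D.pr u v ≠ 0 → D.fx u = 1 → D.fx v = 1 → D.gg u ≤ D.gg v
  before : ∀ u < D.n, ∀ v < D.n, D.pr u v ≠ 0 → D.fx u = 0 → D.fx v = 1 →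
    D.gg v = 3 ∨ D.gg v = 2 ∧ D.nd u = 1
  after : ∀ u < D.n, ∀ v < D.n, D.pr u v ≠ 0 → D.fx u = 1 → D.fx v = 0 →
    D.gg u = 0 ∨ D.gg u = 1 ∧ D.na v = 1
  free : ∀ u < D.n, ∀ v < D.n, D.pr u v ≠ 0 → D.fx u = 0 → D.fx v = 0 → False

theorem cls_four {v : ℕ} : 1 ≤ D.cls 4 v ↔ D.fx v = 0 ∧ D.na v = 0 := by
  have := D.fx_le v
  have := D.na_le v
  simp only [cls, Nat.one_le_iff_ne_zero, mul_ne_zero_iff]; omega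

theorem cls_five {v : ℕ} : 1 ≤ D.cls 5 v ↔ D.fx v = 0 ∧ D.nd v = 0 := by
  have := D.fx_le v
  have := D.nd_le v
  simp only [cls, Nat.one_le_iff_ne_zero, mul_ne_zero_iff]; omega

/-- Two free jobs are incomparable and two guessed ones agree with the guesses. A free job below a
guessed one leaves only the quarters C and D for the latter; if it is C, the free job has `nd = 1`,
so it is not in Z and cannot receive D. The reverse case is symmetric, with `na`, B and X. -/
theorem Coherent.col_le_col (hD : D.Ok) (h : D.Coherent) {X Z m : Finset ℕ} (hX : X ∈ D.family 4)
    (hZ : Z ∈ D.family 5) {u v : ℕ} (hu : u < D.n) (hv : v < D.n) (huv : D.pr u v ≠ 0) :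
    D.col X Z m u ≤ D.col X Z m v := by
  have X4 : ∀ w ∈ X, D.na w = 0 := fun w hw => (cls_four.1 ((mem_family.1 hX).1 w hw).2).2
  have Z5 : ∀ w ∈ Z, D.nd w = 0 := fun w hw => (cls_five.1 ((mem_family.1 hZ).1 w hw).2).2
  have nu := D.na_le u
  have nv := D.nd_le v
  rcases D.fx_cases u with fu | fu <;> rcases D.fx_cases v with fv | fv
  · exact (h.free u hu v hv huv fu fv).elim
  · have e : D.col X Z m v = D.gg v := by rw [col, if_pos fv]
    rw [e]
    rcases h.before u hu v hv huv fu fv with h3 | ⟨h2, hd⟩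
    · rw [h3]; exact hD.col_le _ _ _ _
    · have : u ∉ Z := fun hz => by have := Z5 u hz; omega
      rw [col, if_neg (by omega), if_neg this]
      split_ifs <;> omega
  · have e : D.col X Z m u = D.gg u := by rw [col, if_pos fu]
    rw [e]
    rcases h.after u hu v hv huv fu fv with h3 | ⟨h2, hd⟩
    · omega
    · have : v ∉ X := fun hz => by have := X4 v hz; omega
      rw [col, if_neg (by omega), if_neg this]
      split_ifs <;> omega
  · rw [col, if_pos fu, col, if_pos fv]
    exact h.mono u hu v hv huv fu fv

theorem mem_part {X Z m : Finset ℕ} {q v : ℕ} :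
    v ∈ D.part X Z m q ↔ v < D.n ∧ D.col X Z m v = q := by simp [partTo]

theorem tripleCost_eq (hD : D.Ok) (T : Triple) (f : ℕ → ℕ) :
    D.tripleCost T f = D.ordCost f (Finset.range D.n) :=
  Finset.sum_fiberwise_of_maps_to (fun v _ => Finset.mem_range.2
    (Nat.lt_succ_of_le (hD.col_le T.1 T.2.1 T.2.2 v))) fun v => ((D.n - f v : ℕ) : ℝ) * D.tt v

theorem part_eq_filter {X Z m : Finset ℕ} {f : ℕ → ℕ}
    (h : ∀ v < D.n, D.col X Z m v = f v / (D.n / 4)) (q : ℕ) :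
    D.part X Z m q = (Finset.range D.n).filter fun v => f v / (D.n / 4) = q := by
  ext v
  rw [mem_part, Finset.mem_filter, Finset.mem_range]
  exact and_congr_right fun hv => by rw [h v hv]

theorem Arranged.col_eq (hD : D.Ok) {T : Triple} {f : ℕ → ℕ} (h : D.Arranged T f) {v : ℕ}
    (hv : v < D.n) : D.col T.1 T.2.1 T.2.2 v = f v / (D.n / 4) := by
  have hq : D.col T.1 T.2.1 T.2.2 v < 4 := Nat.lt_succ_of_le (hD.col_le _ _ _ _)
  have h1 := (h.2 _ hq).lower v (mem_part.2 ⟨hv, rfl⟩)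
  have h2 := (h.2 _ hq).upper v (mem_part.2 ⟨hv, rfl⟩)
  rw [((tripleOk_iff_fit.1 h.1) _ hq).1] at h2
  exact (Nat.div_eq_of_lt_le h1 (by rw [Nat.succ_mul]; exact h2)).symm

/-- An arrangement of the quarters is an ordering. -/
theorem Arranged.schedule (hD : D.Ok) (h4 : 4 ∣ D.n) (hc : D.Coherent) {T : Triple}
    (hT : T ∈ D.seen D.rounds) {f : ℕ → ℕ} (h : D.Arranged T f) : D.Schedule f := by
  obtain ⟨hX, hZ, -⟩ := mem_seen_rounds.1 hT
  have hcol := fun v hv => h.col_eq hD (v := v) hv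
  have hq : ∀ v, D.col T.1 T.2.1 T.2.2 v < 4 := fun v => Nat.lt_succ_of_le (hD.col_le _ _ _ _)
  have hfit := tripleOk_iff_fit.1 h.1
  have hpart := fun q => part_eq_filter hcol q
  have hX' : ∀ w ∈ T.1, D.na w = 0 := fun w hw => (cls_four.1 ((mem_family.1 hX).1 w hw).2).2
  have hZ' : ∀ w ∈ T.2.1, D.nd w = 0 := fun w hw => (cls_five.1 ((mem_family.1 hZ).1 w hw).2).2
  have hlow : ∀ v < D.n, D.col T.1 T.2.1 T.2.2 v * (D.n / 4) ≤ f v ∧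
      f v < D.col T.1 T.2.1 T.2.2 v * (D.n / 4) + D.n / 4 := fun v hv => by
    have h1 := (h.2 _ (hq v)).lower v (mem_part.2 ⟨hv, rfl⟩)
    have h2 := (h.2 _ (hq v)).upper v (mem_part.2 ⟨hv, rfl⟩)
    rw [(hfit _ (hq v)).1] at h2
    exact ⟨h1, h2⟩
  refine ⟨fun v hv => ?_, fun u hu v hv huv => ?_, fun u hu v hv huv => ?_, fun v hv h1 => ?_,
    fun v hv h0 h1 => ?_, fun v hv h0 h1 => ?_, ?_, ?_⟩
  · calc f v < (D.col T.1 T.2.1 T.2.2 v + 1) * (D.n / 4) := by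
          rw [Nat.succ_mul]; exact (hlow v hv).2
      _ ≤ 4 * (D.n / 4) := Nat.mul_le_mul_right _ (hq v)
      _ = D.n := Nat.mul_div_cancel' h4
  · rw [Finset.coe_range, Set.mem_Iio] at hu hv
    refine (h.2 _ (hq u)).inj (mem_part.2 ⟨hu, rfl⟩) (mem_part.2 ⟨hv, ?_⟩) huv
    rw [hcol u hu, hcol v hv, huv]
  · rcases (hc.col_le_col hD hX hZ (m := T.2.2) hu hv huv).eq_or_lt with e | e
    · exact (h.2 _ (hq u)).mono u (mem_part.2 ⟨hu, rfl⟩) v (mem_part.2 ⟨hv, e.symm⟩) huv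
    · calc f u < (D.col T.1 T.2.1 T.2.2 u + 1) * (D.n / 4) := by
            rw [Nat.succ_mul]; exact (hlow u hu).2
        _ ≤ D.col T.1 T.2.1 T.2.2 v * (D.n / 4) := Nat.mul_le_mul_right _ e
        _ ≤ f v := (hlow v hv).1
  · rw [← hcol v hv, col, if_pos h1]
  · have : v ∉ T.1 := fun hz => by have := hX' v hz; omega
    have := D.nd_le v
    rw [← hcol v hv, col, if_neg (by omega), if_neg (by assumption)]
    split_ifs <;> omega
  · have : v ∉ T.2.1 := fun hz => by have := hZ' v hz; omega
    have := D.na_le v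
    rw [← hcol v hv, col, if_neg (by omega), if_neg (by assumption : v ∉ T.2.1)]
    split_ifs <;> omega
  · rw [← part_eq_filter hcol, ← show D.target 1 = D.pB from rfl, ← (hfit 1 (by omega)).2]
    exact Finset.sum_congr rfl fun v _ => by simp [regular]
  · rw [← part_eq_filter hcol, ← show D.target 2 = D.pC from rfl, ← (hfit 2 (by omega)).2]
    exact Finset.sum_congr rfl fun v _ => by simp [regular]

/-- An ordering fills every quarter. -/
theorem Schedule.card_quarter (h4 : 4 ∣ D.n) {f : ℕ → ℕ} (h : D.Schedule f) {q : ℕ}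
    (hq : q < 4) : ((Finset.range D.n).filter fun v => f v / (D.n / 4) = q).card = D.n / 4 := by
  have himg : (Finset.range D.n).image f = Finset.range D.n :=
    Finset.eq_of_subset_of_card_le (fun x hx => by
      obtain ⟨v, hv, rfl⟩ := Finset.mem_image.1 hx
      exact Finset.mem_range.2 (h.lt v (Finset.mem_range.1 hv)))
      (by rw [Finset.card_image_of_injOn h.inj])
  rcases Nat.eq_zero_or_pos (D.n / 4) with h0 | hpos
  · have : D.n = 0 := by omega
    simp [this]
  have e : ((Finset.range D.n).filter fun v => f v / (D.n / 4) = q).image f =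
      Finset.Ico (q * (D.n / 4)) (q * (D.n / 4) + D.n / 4) := by
    ext x
    simp only [Finset.mem_image, Finset.mem_filter, Finset.mem_Ico]
    constructor
    · rintro ⟨v, ⟨-, rfl⟩, rfl⟩
      exact ⟨Nat.div_mul_le_self _ _, Nat.lt_div_mul_add hpos⟩
    · rintro ⟨h1, h2⟩
      have hx : x ∈ (Finset.range D.n).image f := by
        rw [himg, Finset.mem_range]
        calc x < (q + 1) * (D.n / 4) := by rwa [Nat.succ_mul]
          _ ≤ 4 * (D.n / 4) := Nat.mul_le_mul_right _ hq
          _ = D.n := Nat.mul_div_cancel' h4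
      obtain ⟨v, hv, rfl⟩ := Finset.mem_image.1 hx
      exact ⟨v, ⟨hv, Nat.div_eq_of_lt_le h1 (by rw [Nat.succ_mul]; exact h2)⟩, rfl⟩
  rw [← Finset.card_image_of_injOn (h.inj.mono (by
    rw [Finset.coe_subset]; exact Finset.filter_subset _ _)), e, Nat.card_Ico]
  omega

/-- Exceptional and regular jobs of a quarter are disjoint, so together they number at most its
size. This shows that X and Z of an actual ordering respect their limits. -/
theorem load_add_sum_le {c g : ℕ → ℕ} {S P : Finset ℕ} (hS : S ⊆ P)
    (h : ∀ v ∈ P, (if v ∈ S then c v - 1 else 0) + g v ≤ 1) :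
    load c S + ∑ v ∈ P, g v ≤ P.card := by
  have e : load c S = ∑ v ∈ P, if v ∈ S then c v - 1 else 0 := by
    rw [← Finset.sum_filter, Finset.filter_mem_eq_inter, Finset.inter_eq_right.2 hS]; rfl
  rw [e, ← Finset.sum_add_distrib, Finset.card_eq_sum_ones]
  exact Finset.sum_le_sum h

theorem cls_le_one (D : Data) {l : ℕ} (hl : l ∈ [6, 7, 8]) (v : ℕ) : D.cls l v ≤ 1 := by
  have h1 := D.fx_le v
  have h2 := D.na_le v
  simp only [List.mem_cons, List.not_mem_nil, or_false] at hl
  rcases hl with rfl | rfl | rfl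
  · exact mul_mod_two_le _ _
  · calc D.cls 7 v ≤ 1 * (1 * 1) := Nat.mul_le_mul (by omega) (Nat.mul_le_mul (by omega) (by omega))
      _ = 1 := rfl
  · calc D.cls 8 v ≤ 1 * (1 * 1) := Nat.mul_le_mul (by omega) (Nat.mul_le_mul (by omega) (by omega))
      _ = 1 := rfl

theorem filter_cls_mem_family {l : ℕ} (hl : l ∈ [6, 7, 8]) {m : Finset ℕ}
    (hm : ∀ v ∈ m, v < D.n) : m.filter (fun v => 1 ≤ D.cls l v) ∈ D.family l := by
  refine mem_family.2 ⟨fun v hv => ⟨hm v (Finset.mem_filter.1 hv).1, (Finset.mem_filter.1 hv).2⟩, ?_⟩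
  rw [load_eq_zero fun v _ => D.cls_le_one hl v]
  exact Nat.zero_le _

/-- An ordering arranges the quarters. -/
theorem Schedule.arranged (h4 : 4 ∣ D.n) {f : ℕ → ℕ} (h : D.Schedule f) :
    ∃ T ∈ D.seen D.rounds, D.Arranged T f := by
  set q := fun v => f v / (D.n / 4) with hqdef
  set X := (Finset.range D.n).filter fun v => (D.fx v = 0 ∧ D.na v = 0) ∧ q v = 1 with hX
  set Z := (Finset.range D.n).filter fun v => (D.fx v = 0 ∧ D.nd v = 0) ∧ q v = 2 with hZ
  -- This contains X as well, harmlessly, because the colouring tests X and Z before m.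
  set m := (Finset.range D.n).filter fun v => D.fx v = 0 ∧ q v ≤ 1 with hm
  have hq4 : ∀ v < D.n, q v < 4 := fun v hv => by
    rw [hqdef, Nat.div_lt_iff_lt_mul (by have := h.lt v hv; omega), Nat.mul_div_cancel' h4]
    exact h.lt v hv
  have hcol : ∀ v < D.n, D.col X Z m v = q v := fun v hv => by
    have h1 := D.na_le v
    have h2 := D.nd_le v
    have h3 := hq4 v hv
    have h4 := h.na v hv
    have h5 := h.nd v hv
    have h6 := h.fixed v hv
    change _ → _ → q v ≠ 0 at h4
    change _ → _ → q v ≠ 3 at h5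
    change _ → q v = _ at h6
    rw [col, hX, hZ, hm]
    simp only [Finset.mem_filter, Finset.mem_range]
    rcases D.fx_cases v with hf | hf <;> split_ifs <;> omega
  have hpart : ∀ r, D.part X Z m r = (Finset.range D.n).filter fun v => q v = r :=
    part_eq_filter hcol
  have hcard : ∀ r < 4, (D.part X Z m r).card = D.n / 4 := fun r hr => by
    rw [hpart]; exact h.card_quarter h4 hr
  have hB : ∑ v ∈ D.part X Z m 1, (1 - D.fx v) * D.na v = D.pB := by rw [hpart]; exact h.pB
  have hC : ∑ v ∈ D.part X Z m 2, (1 - D.fx v) * D.nd v = D.pC := by rw [hpart]; exact h.pC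
  have hXload : load (D.cls 4) X + D.pB ≤ D.n / 4 := by
    rw [← hB, ← hcard 1 (by omega)]
    refine load_add_sum_le (fun v hv => ?_) fun v _ => ?_
    · rw [hpart, Finset.mem_filter]
      exact ⟨(Finset.mem_filter.1 hv).1, (Finset.mem_filter.1 hv).2.2⟩
    · have h1 := D.na_le v
      rcases D.fx_cases v with hf | hf <;> simp [cls, hX, hf]
      split_ifs <;> omega
  have hZload : load (D.cls 5) Z + D.pC ≤ D.n / 4 := by
    rw [← hC, ← hcard 2 (by omega)]
    refine load_add_sum_le (fun v hv => ?_) fun v _ => ?_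
    · rw [hpart, Finset.mem_filter]
      exact ⟨(Finset.mem_filter.1 hv).1, (Finset.mem_filter.1 hv).2.2⟩
    · have h1 := D.nd_le v
      rcases D.fx_cases v with hf | hf <;> simp [cls, hZ, hf]
      split_ifs <;> omega
  have hmn : ∀ v ∈ m, v < D.n := fun v hv => Finset.mem_range.1 (Finset.mem_filter.1 hv).1
  have hmem : ∀ {r v}, v ∈ D.part X Z m r → v < D.n ∧ q v = r := fun hv => by
    rwa [hpart, Finset.mem_filter, Finset.mem_range] at hv
  have hdiv : ∀ v, q v * (D.n / 4) ≤ f v := fun v => Nat.div_mul_le_self _ _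
  refine ⟨(X, Z, m), mem_seen_rounds.2 ⟨mem_family.2 ⟨fun v hv => ?_, ?_⟩,
    mem_family.2 ⟨fun v hv => ?_, ?_⟩, m.filter fun v => 1 ≤ D.cls 6 v,
    filter_cls_mem_family (by simp) hmn, m.filter fun v => 1 ≤ D.cls 7 v,
    filter_cls_mem_family (by simp) hmn, m.filter fun v => 1 ≤ D.cls 8 v,
    filter_cls_mem_family (by simp) hmn, ?_⟩,
    tripleOk_iff_fit.2 fun r hr => ⟨hcard r hr, ?_⟩, fun r hr => ⟨fun v hv => ?_, fun v hv => ?_,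
      fun u hu v hv huv => ?_, fun u hu v hv huv => ?_⟩⟩
  · have := Finset.mem_filter.1 hv
    exact ⟨Finset.mem_range.1 this.1, cls_four.2 this.2.1⟩
  · exact Nat.le_sub_of_add_le hXload
  · have := Finset.mem_filter.1 hv
    exact ⟨Finset.mem_range.1 this.1, cls_five.2 this.2.1⟩
  · exact Nat.le_sub_of_add_le hZload
  -- Classes 6, 7 and 8 partition the free jobs, so m is the union of its traces on them.
  · ext v
    simp only [Finset.mem_union, Finset.mem_filter, cls_six, cls_seven, cls_eight]
    have h1 := D.na_le v
    have h2 : v ∈ m → D.fx v = 0 := fun hv => (Finset.mem_filter.1 hv).2.1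
    by_cases hv : v ∈ m <;> simp only [hv, true_and, false_and, or_self, true_iff]
    have := h2 hv
    omega
  · interval_cases r
    · refine Finset.sum_eq_zero fun v hv => ?_
      obtain ⟨hv, e⟩ := hmem hv
      rcases D.fx_cases v with hf | hf
      · have h1 := h.na v hv hf
        have h2 := D.na_le v
        have : D.na v = 0 := by
          by_contra h3
          exact h1 (by omega) e
        simp [regular, this]
      · simp [regular, hf]
    · rw [show D.target 1 = D.pB from rfl, ← hB]
      exact Finset.sum_congr rfl fun v _ => by simp [regular]
    · rw [show D.target 2 = D.pC from rfl, ← hC]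
      exact Finset.sum_congr rfl fun v _ => by simp [regular]
    · refine Finset.sum_eq_zero fun v hv => ?_
      obtain ⟨hv, e⟩ := hmem hv
      rcases D.fx_cases v with hf | hf
      · have h1 := h.nd v hv hf
        have h2 := D.nd_le v
        have : D.nd v = 0 := by
          by_contra h3
          exact h1 (by omega) e
        simp [regular, this]
      · simp [regular, hf]
  · rw [← (hmem hv).2]; exact hdiv v
  · rw [hcard r hr, ← (hmem hv).2]
    have := h.lt v (hmem hv).1
    exact Nat.lt_div_mul_add (by omega)
  · exact h.inj (by simpa using (hmem hu).1) (by simpa using (hmem hv).1) huv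
  · exact h.mono u (hmem hu).1 v (hmem hv).1 huv

end Data
end Sched

namespace Sched

open RealRAM

namespace Branch

variable {n : ℕ} {R : Branch n}

/-! ## The data of a branch -/

open Classical in
/-- The content of the input arrays. -/
noncomputable def data (R : Branch n) : Data where
  n := n
  pr u v := if ∃ a b : Fin n, u = a ∧ v = b ∧ R.Prec a b then 1 else 0
  mm v := if ∃ a ∈ R.M, v = (a : ℕ) then 1 else 0
  gg v := if h : v < n then (R.guess ⟨v, h⟩ : ℕ) else 0
  tt v := if h : v < n then R.time ⟨v, h⟩ else 0
  pB := R.pB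
  pC := R.pC

open Classical in
@[simp] theorem data_pr (u v : Fin n) : R.data.pr u v = if R.Prec u v then 1 else 0 := by
  simp only [data]
  refine if_congr ⟨?_, fun h => ⟨u, v, rfl, rfl, h⟩⟩ rfl rfl
  rintro ⟨a, b, ha, hb, h⟩
  rwa [Fin.ext ha, Fin.ext hb]

open Classical in
@[simp] theorem data_mm (v : Fin n) : R.data.mm v = if v ∈ R.M then 1 else 0 := by
  simp only [data]
  refine if_congr ⟨?_, fun h => ⟨v, h, rfl⟩⟩ rfl rfl
  rintro ⟨a, ha, h⟩
  rwa [Fin.ext h]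

@[simp] theorem data_gg (v : Fin n) : R.data.gg v = R.guess v := by simp [data]

@[simp] theorem data_tt (v : Fin n) : R.data.tt v = R.time v := by simp [data]

theorem data_n (R : Branch n) : R.data.n = n := rfl

theorem Valid.ok (h : R.Valid) : R.data.Ok where
  four_le := by
    have := R.vBegin.pos
    have := h.four_dvd
    rw [data_n]; omega
  pr_le u v := by simp only [data]; split_ifs <;> omega
  mm_le v := by simp only [data]; split_ifs <;> omega
  gg_le v := by simp only [data]; split_ifs <;> omega
  pB_le := by
    have := h.pB_le
    change R.pB ≤ n; omega
  pC_le := by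
    have := h.pC_le
    change R.pC ≤ n; omega

theorem input_data (R : Branch n) : R.data.Input R.input where
  n := rfl
  pB := rfl
  pC := rfl
  pr u hu v hv := by
    rw [data_n] at hu hv
    classical
    simp only [input, data]
    refine if_congr ⟨?_, ?_⟩ rfl rfl
    · rintro ⟨a, b, e, h⟩
      have hn : 0 < n := by omega
      have e1 : u = a := by
        have := congrArg (· / n) e
        simpa [Nat.mul_comm _ n, Nat.mul_add_div hn, Nat.div_eq_of_lt hv, Nat.div_eq_of_lt b.2] using this
      have e2 : v = b := by
        have := congrArg (· % n) e
        simpa [Nat.mul_comm _ n, Nat.mod_eq_of_lt hv, Nat.mod_eq_of_lt b.2] using this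
      exact ⟨a, b, e1, e2, h⟩
    · rintro ⟨a, b, rfl, rfl, h⟩
      exact ⟨a, b, rfl, h⟩
  mm v _ := by
    simp only [input, data]
  gg v _ := rfl
  tt v _ := rfl

theorem Valid.input_bdd (h : R.Valid) : Bdd R.data.bits R.input := by
  have hb := h.pB_le
  have hc := h.pC_le
  intro a i
  refine Data.lt_bits ?_
  rw [data_n]
  simp only [input]
  split <;> (try split_ifs) <;> omega

/-- A maximal element of S in the precedence order serves. -/
theorem exists_last (R : Branch n) (S : Finset ℕ) (hS : S.Nonempty)
    (hn : ∀ v ∈ S, v < R.data.n) : ∃ v, R.data.Last S v := by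
  obtain ⟨w, hw⟩ := hS
  obtain ⟨x, hx, hmax⟩ := (@Finite.to_wellFoundedGT (Fin n) _ R.ord.toPreorder).wf.has_min
    {v : Fin n | (v : ℕ) ∈ S} ⟨⟨w, hn w hw⟩, hw⟩
  refine ⟨x, hx, fun u hu => ?_⟩
  have : ¬ R.Prec x ⟨u, hn u hu⟩ := hmax ⟨u, hn u hu⟩ hu
  rw [show u = ((⟨u, hn u hu⟩ : Fin n) : ℕ) from rfl, data_pr, if_neg this]

theorem sum_range_ne_zero {g : ℕ → ℕ} :
    ∑ w ∈ Finset.range n, g w ≠ 0 ↔ ∃ w : Fin n, g w ≠ 0 := by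
  simp [← Fin.sum_univ_eq_sum_range, Finset.sum_eq_zero_iff]

theorem fx_eq_one (v : Fin n) : R.data.fx v = 1 ↔ v ∈ R.Fixed := by
  classical
  have e : R.data.fx v = 1 ↔ R.data.mm v ≠ 0 ∨ ∑ w ∈ Finset.range n, R.data.mm w *
      (R.data.pr v w * (2 - R.data.gg w) + R.data.pr w v * (R.data.gg w - 1)) ≠ 0 := by
    rw [Data.fx, Data.fxSum, data_n]; omega
  rw [e, sum_range_ne_zero]
  simp only [data_mm, data_pr, data_gg, Fixed, WhalfAB, WhalfCD, MQ, Set.mem_union,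
    Set.mem_ofPred_eq]
  have h0 : ∀ g : Fin 4, (g : ℕ) < 2 ↔ g = 0 ∨ g = 1 := by decide
  have h2 : ∀ g : Fin 4, 1 < (g : ℕ) ↔ g = 2 ∨ g = 3 := by decide
  have key : ∀ w : Fin n, (if w ∈ R.M then 1 else 0) * ((if R.Prec v w then 1 else 0) *
      (2 - (R.guess w : ℕ)) + (if R.Prec w v then 1 else 0) * ((R.guess w : ℕ) - 1)) ≠ 0 ↔
      (w ∈ R.M ∧ R.Prec v w ∧ (R.guess w = 0 ∨ R.guess w = 1)) ∨
      (w ∈ R.M ∧ R.Prec w v ∧ (R.guess w = 2 ∨ R.guess w = 3)) := fun w => by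
    rw [← h0, ← h2]
    by_cases c1 : w ∈ R.M <;> by_cases c2 : R.Prec v w <;> by_cases c3 : R.Prec w v <;>
      simp [c1, c2, c3] <;> omega
  simp only [key, exists_or]
  by_cases hv : v ∈ R.M
  · simp [hv]
  · simp only [hv, if_false, ne_eq, not_true, false_or, not_false_eq_true, true_and]
    refine or_congr (exists_congr fun w => by tauto) (exists_congr fun w => by tauto)

theorem na_eq_one (v : Fin n) : R.data.na v = 1 ↔ ∃ w ∈ R.MQ 1, R.Prec w v := by
  have e : R.data.na v = 1 ↔ R.data.naSum v n ≠ 0 := by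
    rw [Data.na, data_n]; omega
  have hg : ∀ g : Fin 4, (g : ℕ) * (2 - g) ≠ 0 ↔ g = 1 := by decide
  rw [e, Data.naSum, sum_range_ne_zero]
  simp only [data_mm, data_pr, data_gg, mul_ne_zero_iff (a := _ * _), hg, MQ, Set.mem_ofPred_eq]
  simp only [ne_eq, mul_eq_zero, ite_eq_right_iff, one_ne_zero, imp_false, not_or, not_not]
  exact exists_congr fun w => by tauto

theorem nd_eq_one (v : Fin n) : R.data.nd v = 1 ↔ ∃ w ∈ R.MQ 2, R.Prec v w := by
  have e : R.data.nd v = 1 ↔ R.data.ndSum v n ≠ 0 := by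
    rw [Data.nd, data_n]; omega
  have hg : ∀ g : Fin 4, ((g : ℕ) - 1) * (3 - g) ≠ 0 ↔ g = 2 := by decide
  rw [e, Data.ndSum, sum_range_ne_zero]
  simp only [data_mm, data_pr, data_gg, mul_ne_zero_iff (a := _ * _), hg, MQ, Set.mem_ofPred_eq]
  simp only [ne_eq, mul_eq_zero, ite_eq_right_iff, one_ne_zero, imp_false, not_or, not_not]
  exact exists_congr fun w => by tauto

end Branch
end Sched

namespace Sched

open RealRAM

/-! ## Orderings of a branch -/

theorem inQuarter_iff {n : ℕ} (h4 : 4 ∣ n) {Γ : Fin 4} {i : Fin n} :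
    InQuarter Γ i ↔ (i : ℕ) / (n / 4) = Γ := by
  obtain ⟨d, rfl⟩ := h4
  have hd : 0 < d := by have := i.2; omega
  rw [Nat.mul_div_cancel_left d (by norm_num), Nat.div_eq_iff hd, InQuarter]
  constructor
  · rintro ⟨h1, h2⟩
    constructor
    · linarith
    · have : 4 * (i : ℕ) < 4 * ((Γ : ℕ) * d + d) := by linarith
      omega
  · rintro ⟨h1, h2⟩
    constructor
    · linarith
    · have : (i : ℕ) < (Γ : ℕ) * d + d := by omega
      linarith

/-- Double counting: the time of u is charged once for each job at or after its position, and with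
positions from 0 there are n − σ(u) of these. In this form the cost is a sum over single jobs and
splits over quarters. -/
theorem Inst.cost_eq {n : ℕ} (I : Inst n) (σ : Equiv.Perm (Fin n)) :
    I.cost σ = ∑ v, ((n - σ v : ℕ) : ℝ) * I.time v := by
  simp only [Inst.cost, Finset.sum_filter]
  rw [Finset.sum_comm]
  refine Finset.sum_congr rfl fun u _ => ?_
  rw [← Finset.sum_filter, Finset.sum_const, nsmul_eq_mul]
  congr 2
  rw [← Finset.card_map σ.toEmbedding, ← Fin.card_Ici]
  congr 1
  ext x
  simp only [Finset.mem_map, Finset.mem_filter, Finset.mem_univ, true_and, Finset.mem_Ici]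
  constructor
  · rintro ⟨v, hv, rfl⟩; exact hv
  · exact fun hx => ⟨σ.symm x, by simpa using hx, by simp⟩

namespace Branch

variable {n : ℕ} {R : Branch n}

theorem fx_eq_zero {v : Fin n} : R.data.fx v = 0 ↔ v ∉ R.Fixed := by
  have := R.data.fx_le v
  rw [← fx_eq_one]; omega

/-- In a comparable pair with a free job the other job is in M. If that job is the later one, it
cannot lie in the first half, or the free job would belong to W_half^{AB}; if it lies in C, it
witnesses membership in P^{¬D}. The other direction is dual. -/
theorem Valid.coherent (h : R.Valid) : R.data.Coherent := by
  have lift : ∀ {p : ℕ → ℕ → Prop}, (∀ u v : Fin n, R.Prec u v → p u v) →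
      ∀ u < R.data.n, ∀ v < R.data.n, R.data.pr u v ≠ 0 → p u v := by
    intro p hp u hu v hv huv
    refine hp ⟨u, hu⟩ ⟨v, hv⟩ ?_
    by_contra hc
    exact huv (by simpa [hc] using data_pr (R := R) ⟨u, hu⟩ ⟨v, hv⟩)
  constructor
  · refine lift fun u v huv hu hv => ?_
    rw [fx_eq_one] at hu hv
    rw [data_gg, data_gg]
    exact h.guess_mono u hu v hv huv
  · refine lift fun u v huv hu hv => ?_
    rw [fx_eq_zero] at hu
    rw [data_gg]
    have hvM : v ∈ R.M := (h.covers u v huv).resolve_left fun hc => hu (.inl hc)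
    have h01 : ¬ (R.guess v = 0 ∨ R.guess v = 1) := fun hc =>
      hu (.inr (.inl ⟨fun hc => hu (.inl hc), v, hc.imp (⟨hvM, ·⟩) (⟨hvM, ·⟩), huv⟩))
    have h23 : ∀ g : Fin 4, ¬ (g = 0 ∨ g = 1) → (g : ℕ) = 3 ∨ g = 2 := by decide
    refine (h23 _ h01).imp_right fun h2 => ⟨by rw [h2]; rfl, ?_⟩
    exact (nd_eq_one u).2 ⟨v, ⟨hvM, h2⟩, huv⟩
  · refine lift fun u v huv hu hv => ?_
    rw [fx_eq_zero] at hv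
    rw [data_gg]
    have huM : u ∈ R.M := (h.covers u v huv).resolve_right fun hc => hv (.inl hc)
    have h01 : ¬ (R.guess u = 2 ∨ R.guess u = 3) := fun hc =>
      hv (.inr (.inr ⟨fun hc => hv (.inl hc), u, hc.imp (⟨huM, ·⟩) (⟨huM, ·⟩), huv⟩))
    have h23 : ∀ g : Fin 4, ¬ (g = 2 ∨ g = 3) → (g : ℕ) = 0 ∨ g = 1 := by decide
    refine (h23 _ h01).imp_right fun h2 => ⟨by rw [h2]; rfl, ?_⟩
    exact (na_eq_one v).2 ⟨u, ⟨huM, h2⟩, huv⟩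
  · refine lift fun u v huv hu hv => ?_
    rw [fx_eq_zero] at hu hv
    exact (h.covers u v huv).elim (fun hc => hu (.inl hc)) fun hc => hv (.inl hc)

theorem sum_quarter {g f : ℕ → ℕ} {P : Set (Fin n)} {Γ : Fin 4} {σ : Equiv.Perm (Fin n)}
    (h4 : 4 ∣ n) (hf : ∀ v : Fin n, f v = σ v) (h1 : ∀ v : Fin n, v ∈ P → g v = 1)
    (h0 : ∀ v : Fin n, v ∉ P → g v = 0) :
    ∑ v ∈ (Finset.range n).filter (fun v => f v / (n / 4) = Γ), g v = count P Γ σ := by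
  classical
  rw [count, Set.ncard_eq_toFinset_card', Finset.card_eq_sum_ones, Finset.sum_filter,
    ← Fin.sum_univ_eq_sum_range (fun v => if f v / (n / 4) = Γ then g v else 0)]
  rw [show ({v | v ∈ P ∧ InQuarter Γ (σ v)} : Set (Fin n)).toFinset =
    Finset.univ.filter fun v => v ∈ P ∧ InQuarter Γ (σ v) by ext; simp, Finset.sum_filter]
  refine Finset.sum_congr rfl fun v _ => ?_
  rw [hf, inQuarter_iff h4]
  by_cases hv : v ∈ P
  · simp [hv, h1 v hv]
  · simp [hv, h0 v hv]

theorem free_mul_eq {k : ℕ} {v : Fin n} {p : Prop} (hk : k ≤ 1) (h : k = 1 ↔ p) :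
    (v ∈ R.I₂ ∧ p → (1 - R.data.fx v) * k = 1) ∧
      (¬ (v ∈ R.I₂ ∧ p) → (1 - R.data.fx v) * k = 0) := by
  rw [I₂, Set.mem_compl_iff, ← fx_eq_zero, ← h]
  rcases R.data.fx_cases v with hf | hf <;> simp [hf]
  omega

/-- Exclusion from A and D is automatic: a job of P^{¬A} follows a special job placed in B, and one
of P^{¬D} precedes a special job placed in C. The values of `f` from n on are irrelevant. -/
theorem Valid.feasible_iff (h : R.Valid) {σ : Equiv.Perm (Fin n)} {f : ℕ → ℕ}
    (hf : ∀ v : Fin n, f v = σ v) : R.Feasible σ ↔ R.data.Schedule f := by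
  have h4 := h.four_dvd
  have hq : ∀ (v : Fin n) (Γ : Fin 4), InQuarter Γ (σ v) ↔ f v / (n / 4) = Γ := fun v Γ => by
    rw [inQuarter_iff h4, hf]
  have hB : ∑ v ∈ (Finset.range n).filter (fun v => f v / (n / 4) = 1),
      (1 - R.data.fx v) * R.data.na v = count R.PnotA 1 σ :=
    sum_quarter (Γ := 1) h4 hf (fun v => (free_mul_eq (R.data.na_le v) (na_eq_one v)).1)
      fun v => (free_mul_eq (R.data.na_le v) (na_eq_one v)).2
  have hC : ∑ v ∈ (Finset.range n).filter (fun v => f v / (n / 4) = 2),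
      (1 - R.data.fx v) * R.data.nd v = count R.PnotD 2 σ :=
    sum_quarter (Γ := 2) h4 hf (fun v => (free_mul_eq (R.data.nd_le v) (nd_eq_one v)).1)
      fun v => (free_mul_eq (R.data.nd_le v) (nd_eq_one v)).2
  have lift : ∀ {p : ℕ → Prop}, (∀ v : Fin n, p v) → ∀ v < R.data.n, p v :=
    fun hp v hv => hp ⟨v, hv⟩
  constructor
  · intro hs
    have hM : ∀ w ∈ R.M, f w / (n / 4) = R.guess w := fun w hw =>
      (hq w _).1 (hs.quarter w (.inl hw))
    have mono : ∀ u v : Fin n, R.Prec u v → f u < f v := fun u v huv => by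
      rw [hf, hf]; exact hs.respects u v huv
    refine ⟨lift fun v => ?_, ?_, ?_, lift fun v hv => ?_, lift fun v _ hv hc => ?_,
      lift fun v _ hv hc => ?_, ?_, ?_⟩
    · rw [hf]; exact (σ v).2
    · intro u hu v hv huv
      rw [Finset.coe_range, Set.mem_Iio, data_n] at hu hv
      have := (hf ⟨u, hu⟩).symm.trans (huv.trans (hf ⟨v, hv⟩))
      simpa using σ.injective (Fin.ext this)
    · intro u hu v hv huv
      refine mono ⟨u, hu⟩ ⟨v, hv⟩ ?_
      by_contra hc
      exact huv (by simpa [hc] using data_pr (R := R) ⟨u, hu⟩ ⟨v, hv⟩)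
    · rw [data_gg]; exact (hq v _).1 (hs.quarter v ((fx_eq_one v).1 hv))
    · obtain ⟨w, hw, hwv⟩ := (na_eq_one v).1 hv
      have h1 := hM w hw.1
      rw [hw.2] at h1
      have : f w / (n / 4) ≤ f v / (n / 4) := Nat.div_le_div_right (mono w v hwv).le
      rw [data_n] at hc
      rw [hc, h1] at this
      exact absurd this (by decide)
    · obtain ⟨w, hw, hwv⟩ := (nd_eq_one v).1 hv
      have h1 := hM w hw.1
      rw [hw.2] at h1
      have : f v / (n / 4) ≤ f w / (n / 4) := Nat.div_le_div_right (mono v w hwv).le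
      rw [data_n] at hc
      rw [hc, h1] at this
      exact absurd this (by decide)
    · exact hB.trans hs.pB_eq
    · exact hC.trans hs.pC_eq
  · intro hs
    refine ⟨fun u v huv => ?_, fun v hv => ?_, hB.symm.trans hs.pB, hC.symm.trans hs.pC⟩
    · have := hs.mono u u.2 v v.2 (by simp [huv])
      rwa [hf, hf] at this
    · rw [hq, ← data_gg]
      exact hs.fixed v v.2 ((fx_eq_one v).2 hv)

theorem cost_eq_ordCost {σ : Equiv.Perm (Fin n)} {f : ℕ → ℕ} (hf : ∀ v : Fin n, f v = σ v) :
    R.cost σ = R.data.ordCost f (Finset.range n) := by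
  rw [Inst.cost_eq, Data.ordCost, data_n,
    ← Fin.sum_univ_eq_sum_range (fun v => ((n - f v : ℕ) : ℝ) * R.data.tt v)]
  exact Finset.sum_congr rfl fun v _ => by rw [hf, data_tt]

/-- The ordering given by a list of positions. -/
theorem exists_perm {f : ℕ → ℕ} (h : R.data.Schedule f) :
    ∃ σ : Equiv.Perm (Fin n), ∀ v : Fin n, f v = σ v := by
  let g : Fin n → Fin n := fun v => ⟨f v, h.lt v v.2⟩
  have hg : Function.Injective g := fun u v huv =>
    Fin.ext (h.inj (by simp [data_n]) (by simp [data_n]) (Fin.mk.inj huv))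
  exact ⟨Equiv.ofBijective g (Finite.injective_iff_bijective.1 hg), fun v => rfl⟩

theorem Valid.answers (h : R.Valid) {s : State} (hs : R.data.Result s) : R.Answers s := by
  have ho := h.ok
  have h4 : 4 ∣ R.data.n := h.four_dvd
  have lower : ∀ τ, R.Feasible τ → ∃ f : ℕ → ℕ, (∀ v : Fin n, f v = τ v) ∧
      ∃ T ∈ R.data.seen R.data.rounds, R.data.Arranged T f := fun τ hτ => by
    obtain ⟨f, hf⟩ : ∃ f : ℕ → ℕ, ∀ v : Fin n, f v = τ v :=
      ⟨fun v => if hv : v < n then (τ ⟨v, hv⟩ : ℕ) else 0, fun v => by simp⟩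
    exact ⟨f, hf, ((h.feasible_iff hf).1 hτ).arranged h4⟩
  rcases hs with ⟨h0, hs⟩ | ⟨h1, T, hT, hA, hs⟩
  · refine .inl ⟨h0, fun ⟨σ, hσ⟩ => ?_⟩
    obtain ⟨f, -, T, hT, hA⟩ := lower σ hσ
    exact hs T hT f hA
  · have hsch := hA.schedule ho h4 h.coherent hT
    obtain ⟨σ, hσ⟩ := exists_perm hsch
    refine .inr ⟨h1, σ, ⟨(h.feasible_iff hσ).2 hsch, fun τ hτ => ?_⟩, hσ⟩
    obtain ⟨f, hf, T', hT', hA'⟩ := lower τ hτ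
    rw [cost_eq_ordCost hσ, cost_eq_ordCost hf]
    have := hs T' hT' f hA'
    rwa [Data.tripleCost_eq ho, Data.tripleCost_eq ho] at this

end Branch
end Sched

namespace Sched

open RealRAM

namespace Data

variable {D : Data}

/-! ## The number of sets in the families -/

/-- The number of free jobs `v` with `na v = i` and `nd v = j`. -/
def freeCard (D : Data) (i j : ℕ) : ℕ :=
  ((Finset.range D.n).filter fun v => D.fx v = 0 ∧ D.na v = i ∧ D.nd v = j).card

/-- The number of jobs with guessed quarter. -/
def fixedCard (D : Data) : ℕ := ((Finset.range D.n).filter fun v => D.fx v = 1).card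

/-- The number of jobs of class `1` in family number `l`. -/
def oneCard (D : Data) (l : ℕ) : ℕ := ((Finset.range D.n).filter fun v => D.cls l v = 1).card

theorem na_cases (D : Data) (v : ℕ) : D.na v = 0 ∨ D.na v = 1 := by
  have := D.na_le v; omega

theorem nd_cases (D : Data) (v : ℕ) : D.nd v = 0 ∨ D.nd v = 1 := by
  have := D.nd_le v; omega

/-- The free jobs admitted without limit to the four quarters are those of P^A, P^{¬A}, P^{¬D} and
P^D, each the union of two adjacent types. -/
theorem oneCard_le : D.oneCard 0 ≤ D.fixedCard + D.freeCard 0 0 + D.freeCard 0 1 ∧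
    D.oneCard 1 ≤ D.fixedCard + D.freeCard 1 0 + D.freeCard 1 1 ∧
    D.oneCard 2 ≤ D.fixedCard + D.freeCard 0 1 + D.freeCard 1 1 ∧
    D.oneCard 3 ≤ D.fixedCard + D.freeCard 0 0 + D.freeCard 1 0 := by
  simp only [oneCard, fixedCard, freeCard, Finset.card_filter, ← Finset.sum_add_distrib]
  refine ⟨?_, ?_, ?_, ?_⟩ <;> refine Finset.sum_le_sum fun v _ => ?_ <;>
    rcases D.fx_cases v with hf | hf <;> rcases D.na_cases v with ha | ha <;>
    rcases D.nd_cases v with hd | hd <;> simp [cls, hf, ha, hd] <;> split_ifs <;> omega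

theorem oneCard_search (h : D.orient = 0) : D.oneCard 6 = D.freeCard 0 1 + D.freeCard 1 0 ∧
    D.oneCard 7 = D.freeCard 0 0 ∧ D.oneCard 8 = D.freeCard 1 1 := by
  simp only [oneCard, freeCard, Finset.card_filter, ← Finset.sum_add_distrib]
  refine ⟨?_, ?_, ?_⟩ <;> refine Finset.sum_congr rfl fun v _ => ?_ <;>
    rcases D.fx_cases v with hf | hf <;> rcases D.na_cases v with ha | ha <;>
    rcases D.nd_cases v with hd | hd <;> simp [cls, hf, ha, hd, h]

theorem oneCard_search' (h : D.orient = 1) : D.oneCard 6 = D.freeCard 0 0 + D.freeCard 1 1 ∧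
    D.oneCard 7 = D.freeCard 0 1 ∧ D.oneCard 8 = D.freeCard 1 0 := by
  simp only [oneCard, freeCard, Finset.card_filter, ← Finset.sum_add_distrib]
  refine ⟨?_, ?_, ?_⟩ <;> refine Finset.sum_congr rfl fun v _ => ?_ <;>
    rcases D.fx_cases v with hf | hf <;> rcases D.na_cases v with ha | ha <;>
    rcases D.nd_cases v with hd | hd <;> simp [cls, hf, ha, hd, h]

theorem neSum_eq : D.neSum D.n = D.freeCard 0 1 + D.freeCard 1 0 := by
  simp only [neSum, freeCard, Finset.card_filter, ← Finset.sum_add_distrib]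
  refine Finset.sum_congr rfl fun v _ => ?_
  rcases D.fx_cases v with hf | hf <;> rcases D.na_cases v with ha | ha <;>
    rcases D.nd_cases v with hd | hd <;> simp [hf, ha, hd]

theorem eqSum_eq : D.eqSum D.n = D.freeCard 0 0 + D.freeCard 1 1 := by
  simp only [eqSum, freeCard, Finset.card_filter, ← Finset.sum_add_distrib]
  refine Finset.sum_congr rfl fun v _ => ?_
  rcases D.fx_cases v with hf | hf <;> rcases D.na_cases v with ha | ha <;>
    rcases D.nd_cases v with hd | hd <;> simp [hf, ha, hd]

theorem freeCard_total :
    D.freeCard 0 0 + D.freeCard 0 1 + D.freeCard 1 0 + D.freeCard 1 1 ≤ D.n := by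
  calc _ ≤ ∑ v ∈ Finset.range D.n, 1 := by
        simp only [freeCard, Finset.card_filter, ← Finset.sum_add_distrib]
        refine Finset.sum_le_sum fun v _ => ?_
        rcases D.fx_cases v with hf | hf <;> rcases D.na_cases v with ha | ha <;>
          rcases D.nd_cases v with hd | hd <;> simp [hf, ha, hd]
    _ = D.n := by simp

/-- The outer loop and an inner loop of the search range over few jobs. -/
theorem oneCard_search_le {H : ℕ} (h1 : D.freeCard 0 0 + D.freeCard 0 1 ≤ H)
    (h2 : D.freeCard 1 0 + D.freeCard 1 1 ≤ H) (h3 : D.freeCard 0 1 + D.freeCard 1 1 ≤ H)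
    (h4 : D.freeCard 0 0 + D.freeCard 1 0 ≤ H) {r : ℕ} (hr : r < 2) :
    4 * (D.oneCard 6 + D.oneCard (7 + r)) ≤ D.n + 4 * H := by
  have ht := D.freeCard_total
  have ho := D.orient_le
  have he : D.orient = 1 - (1 - (D.neSum D.n - D.eqSum D.n)) := rfl
  rw [neSum_eq, eqSum_eq] at he
  obtain h0 | h0 : D.orient = 0 ∨ D.orient = 1 := by omega
  -- For an outer pair of sizes b, c and an inner type of size a, 2(a + b + c) = (a + b) + (a + c) +
  -- (b + c). The first two sums are at most H, since the inner type is adjacent to both outer ones,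
  -- and b + c ≤ n/2 by the choice of the smaller pair.
  · obtain ⟨e6, e7, e8⟩ := oneCard_search h0
    interval_cases r <;> simp only [Nat.reduceAdd, e6, e7, e8] <;> omega
  · obtain ⟨e6, e7, e8⟩ := oneCard_search' h0
    interval_cases r <;> simp only [Nat.reduceAdd, e6, e7, e8] <;> omega

theorem length_family_le {l K : ℕ} (hl : D.lim l ≤ K) (hc : ∀ v, D.cls l v ≤ 2)
    (hK : 2 * K ≤ D.n) :
    (D.family l).length ≤ 2 ^ D.oneCard l * ((K + 1) * D.n.choose K) :=
  length_enum_le_mul _ _ _ (fun v _ => hc v) hl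
    ((Finset.card_filter_le _ _).trans (by simp)) hK

/-- Every member of an exceptional set counts against its limit, so these families contribute
binomial coefficients and no power of 2. -/
theorem oneCard_eq_zero {l : ℕ} (hl : l = 4 ∨ l = 5) : D.oneCard l = 0 := by
  rw [oneCard, Finset.card_eq_zero, Finset.filter_eq_empty_iff]
  rintro v - hv
  have := D.fx_le v
  rcases hl with rfl | rfl
  · have h : D.cls 4 v = (1 - D.fx v) * (1 - D.na v) * 2 := (mul_assoc _ _ _).symm
    omega
  · have h : D.cls 5 v = (1 - D.fx v) * (1 - D.nd v) * 2 := (mul_assoc _ _ _).symm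
    omega

theorem length_families (hD : D.Ok) {K H : ℕ} (hB : D.n / 4 - D.pB ≤ K)
    (hC : D.n / 4 - D.pC ≤ K) (hK : 2 * K ≤ D.n) (hF : D.fixedCard ≤ D.n / 4 + 2)
    (h1 : D.freeCard 0 0 + D.freeCard 0 1 ≤ H)
    (h2 : D.freeCard 1 0 + D.freeCard 1 1 ≤ H) (h3 : D.freeCard 0 1 + D.freeCard 1 1 ≤ H)
    (h4 : D.freeCard 0 0 + D.freeCard 1 0 ≤ H) :
    ∃ N, (∀ l < 9, (D.family l).length ≤
        2 ^ (D.n / 4 + 2 + H) * ((K + 1) * D.n.choose K) ^ 2) ∧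
      (∀ r < 2, (D.family (7 + r)).length ≤ N) ∧
      D.rounds * N ≤ 2 ^ (D.n / 4 + 2 + H) * ((K + 1) * D.n.choose K) ^ 2 := by
  set G := (K + 1) * D.n.choose K with hG
  have hG1 : 1 ≤ G := Nat.mul_pos (Nat.succ_pos K) (Nat.choose_pos (by omega))
  have hGG : G ≤ G ^ 2 := Nat.le_self_pow (by norm_num) _
  obtain ⟨o0, o1, o2, o3⟩ := D.oneCard_le
  have s0 := oneCard_search_le h1 h2 h3 h4 (r := 0) (by omega)
  have s1 := oneCard_search_le h1 h2 h3 h4 (r := 1) (by omega)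
  have o4 := D.oneCard_eq_zero (.inl rfl)
  have o5 := D.oneCard_eq_zero (.inr rfl)
  have hlim : ∀ l, D.lim l ≤ K := fun l => by
    unfold lim; split <;> omega
  have hlen : ∀ l < 9, (D.family l).length ≤ 2 ^ D.oneCard l * G := fun l hl =>
    length_family_le (hlim l) (fun v => hD.cls_le l v) hK
  have hlen0 : ∀ l ∈ [6, 7, 8], (D.family l).length ≤ 2 ^ D.oneCard l := fun l hl => by
    have h0 : D.lim l = 0 := by
      simp only [List.mem_cons, List.not_mem_nil, or_false] at hl
      rcases hl with rfl | rfl | rfl <;> rfl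
    simpa using length_family_le (K := 0) h0.le (fun v => hD.cls_le l v) (by omega)
  have hone : ∀ l < 9, D.oneCard l ≤ D.n / 4 + 2 + H := fun l hl => by
    simp only [Nat.reduceAdd] at s0 s1
    interval_cases l <;> omega
  have hmax : D.oneCard 6 + max (D.oneCard 7) (D.oneCard 8) ≤ D.n / 4 + 2 + H := by
    simp only [Nat.reduceAdd] at s0 s1
    omega
  -- The inner searches run one after the other, so the larger of the two types counts, not both.
  refine ⟨2 ^ max (D.oneCard 7) (D.oneCard 8), fun l hl => (hlen l hl).trans ?_, fun r hr => ?_, ?_⟩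
  · exact Nat.mul_le_mul (Nat.pow_le_pow_right (by norm_num) (hone l hl)) hGG
  · refine (hlen0 _ (by interval_cases r <;> simp)).trans (Nat.pow_le_pow_right (by norm_num) ?_)
    interval_cases r
    exacts [le_max_left _ _, le_max_right _ _]
  · have e4 := hlen 4 (by omega)
    have e5 := hlen 5 (by omega)
    rw [o4, pow_zero, one_mul] at e4
    rw [o5, pow_zero, one_mul] at e5
    calc _ ≤ G * G * 2 ^ D.oneCard 6 * 2 ^ max (D.oneCard 7) (D.oneCard 8) :=
          Nat.mul_le_mul_right _ (Nat.mul_le_mul (Nat.mul_le_mul e4 e5) (hlen0 6 (by simp)))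
      _ = 2 ^ (D.oneCard 6 + max (D.oneCard 7) (D.oneCard 8)) * G ^ 2 := by rw [pow_add]; ring
      _ ≤ _ := Nat.mul_le_mul_right _ (Nat.pow_le_pow_right (by norm_num) hmax)

end Data

namespace Branch

variable {n : ℕ} {R : Branch n}

/-! ## The running time -/

theorem card_filter_range {p : ℕ → Prop} [DecidablePred p] {P : Set (Fin n)}
    (h : ∀ v : Fin n, p v ↔ v ∈ P) : ((Finset.range n).filter p).card = P.ncard := by
  classical
  rw [Set.ncard_eq_toFinset_card', Finset.card_filter,
    ← Fin.sum_univ_eq_sum_range (fun v => if p v then 1 else 0), ← Finset.card_filter]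
  congr 1
  ext v
  simp [h]

theorem fixedCard_eq (R : Branch n) : R.data.fixedCard = R.Fixed.ncard :=
  card_filter_range fx_eq_one

theorem freeCard_add (i j i' j' : ℕ) {P : Set (Fin n)} (hij : i ≠ i' ∨ j ≠ j')
    (h : ∀ v : Fin n, v ∈ P ↔ R.data.fx v = 0 ∧
      ((R.data.na v = i ∧ R.data.nd v = j) ∨ (R.data.na v = i' ∧ R.data.nd v = j'))) :
    R.data.freeCard i j + R.data.freeCard i' j' = P.ncard := by
  rw [Data.freeCard, Data.freeCard, ← Finset.card_union_of_disjoint, ← Finset.filter_or]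
  · refine card_filter_range (n := n) fun v => ?_
    have := h v
    tauto
  · rw [Finset.disjoint_filter]
    omega

theorem mem_PnotA {v : Fin n} : v ∈ R.PnotA ↔ R.data.fx v = 0 ∧ R.data.na v = 1 := by
  rw [fx_eq_zero, na_eq_one]; rfl

theorem mem_PnotD {v : Fin n} : v ∈ R.PnotD ↔ R.data.fx v = 0 ∧ R.data.nd v = 1 := by
  rw [fx_eq_zero, nd_eq_one]; rfl

theorem mem_PA {v : Fin n} : v ∈ R.PA ↔ R.data.fx v = 0 ∧ R.data.na v = 0 := by
  have := R.data.na_le v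
  rw [PA, Set.mem_sdiff, mem_PnotA, I₂, Set.mem_compl_iff, ← fx_eq_zero]; omega

theorem mem_PD {v : Fin n} : v ∈ R.PD ↔ R.data.fx v = 0 ∧ R.data.nd v = 0 := by
  have := R.data.nd_le v
  rw [PD, Set.mem_sdiff, mem_PnotD, I₂, Set.mem_compl_iff, ← fx_eq_zero]; omega

theorem freeCard_PA : R.data.freeCard 0 0 + R.data.freeCard 0 1 = R.PA.ncard :=
  freeCard_add _ _ _ _ (by omega) fun v => by
    have := R.data.nd_le v
    rw [mem_PA]; omega

theorem freeCard_PnotA : R.data.freeCard 1 0 + R.data.freeCard 1 1 = R.PnotA.ncard :=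
  freeCard_add _ _ _ _ (by omega) fun v => by
    have := R.data.nd_le v
    rw [mem_PnotA]; omega

theorem freeCard_PnotD : R.data.freeCard 0 1 + R.data.freeCard 1 1 = R.PnotD.ncard :=
  freeCard_add _ _ _ _ (by omega) fun v => by
    have := R.data.na_le v
    rw [mem_PnotD]; omega

theorem freeCard_PD : R.data.freeCard 0 0 + R.data.freeCard 1 0 = R.PD.ncard :=
  freeCard_add _ _ _ _ (by omega) fun v => by
    have := R.data.na_le v
    rw [mem_PD]; omega

theorem ncard_verts_le {G : SimpleGraph (Fin n)} {H : G.Subgraph} (h : H.IsMatching) :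
    H.verts.ncard ≤ 2 * H.edgeSet.ncard := by
  classical
  have hsub : H.verts.toFinset ⊆ H.edgeSet.toFinset.biUnion Sym2.toFinset := fun v hv => by
    obtain ⟨w, hw, -⟩ := h (Set.mem_toFinset.1 hv)
    exact Finset.mem_biUnion.2 ⟨s(v, w), by simpa using hw, by simp⟩
  rw [Set.ncard_eq_toFinset_card', Set.ncard_eq_toFinset_card', mul_comm]
  refine (Finset.card_le_card hsub).trans (Finset.card_biUnion_le_card_mul _ _ _ fun e _ => ?_)
  rw [Sym2.card_toFinset]; split_ifs <;> omega

theorem Valid.ncard_fixed_le (h : R.Valid) :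
    R.Fixed.ncard ≤ 2 * R.matching.edgeSet.ncard + 2 + R.WhalfAB.ncard + R.WhalfCD.ncard := by
  have h1 := ncard_verts_le h.isMatching
  have h2 : ({R.vBegin, R.vEnd} : Set (Fin n)).ncard ≤ 2 :=
    (Set.ncard_insert_le _ _).trans (by simp)
  have h3 := Set.ncard_union_le R.matching.verts {R.vBegin, R.vEnd}
  have h4 := Set.ncard_union_le R.WhalfAB R.WhalfCD
  have h5 := Set.ncard_union_le R.M (R.WhalfAB ∪ R.WhalfCD)
  rw [Fixed, M] at *
  omega

/-- From K + 1 ≤ n and 4n + 9 ≤ 7n the polynomial factors are at most 49 n⁷, and 2² · 4000 = 16000.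
The remaining constant x satisfies x ≤ 2^x ≤ n^x, so it goes into the exponent and no constant
factor is left. -/
theorem time_le {n k H K U : ℕ} {ε₃ : ℝ} (hn : 4 ≤ n) (h4 : 4 ∣ n) (hK : 2 * K ≤ n)
    (hH : (H : ℝ) ≤ (1 / 2 + ε₃) * n)
    (hk : k ≤ 4000 * (n ^ 3 * (2 ^ (n / 4 + 2 + H) * ((K + 1) * n.choose K) ^ 2)) *
      (U * (4 * n + 8 + 1) ^ 2)) :
    (k : ℝ) ≤ (n.choose K : ℝ) ^ 2 * (2 : ℝ) ^ ((3 / 4 + ε₃) * n) *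
      (n : ℝ) ^ (16000 * U * 49 + 7) := by
  have hU : 16000 * U * 49 ≤ n ^ (16000 * U * 49) := by
    generalize 16000 * U * 49 = x
    exact Nat.lt_two_pow_self.le.trans (Nat.pow_le_pow_left (by omega) x)
  have h2 : ((2 ^ (n / 4 + H) : ℕ) : ℝ) ≤ (2 : ℝ) ^ ((3 / 4 + ε₃) * n) := by
    rw [Nat.cast_pow, Nat.cast_ofNat, ← Real.rpow_natCast]
    refine Real.rpow_le_rpow_of_exponent_le (by norm_num) ?_
    rw [Nat.cast_add, Nat.cast_div h4 (by norm_num), Nat.cast_ofNat]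
    linarith
  have h1 : k ≤ (n.choose K) ^ 2 * 2 ^ (n / 4 + H) * n ^ (16000 * U * 49 + 7) := by
    calc k ≤ _ := hk
      _ ≤ 4000 * (n ^ 3 * (2 ^ (n / 4 + 2 + H) * (n * n.choose K) ^ 2)) * (U * (7 * n) ^ 2) := by
          gcongr <;> omega
      _ = (n.choose K) ^ 2 * 2 ^ (n / 4 + H) * (16000 * U * 49 * n ^ 7) := by
          rw [show n / 4 + 2 + H = n / 4 + H + 2 by omega, pow_add 2 (n / 4 + H) 2]; ring
      _ ≤ (n.choose K) ^ 2 * 2 ^ (n / 4 + H) * (n ^ (16000 * U * 49) * n ^ 7) := by gcongr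
      _ = _ := by rw [← pow_add]
  calc (k : ℝ) ≤ _ := Nat.cast_le.2 h1
    _ = (n.choose K : ℝ) ^ 2 * ((2 ^ (n / 4 + H) : ℕ) : ℝ) * (n : ℝ) ^ (16000 * U * 49 + 7) := by
        push_cast; rfl
    _ ≤ _ := by gcongr

end Branch
end Sched

/-! ### The main theorem -/

theorem mainTheorem4 :
    ∃ (p : RealRAM.Program) (c : ℕ), ∀ (ε₁ ε₂ ε₃ ε₄ : ℝ),
      0 < ε₁ → 0 < ε₂ → 0 < ε₃ → 0 < ε₄ → 2 * ε₁ + 2 * ε₂ + ε₄ < 1 / 4 →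
      ∀ (n : ℕ) (R : Sched.Branch n), R.Valid →
      -- the matching is small
      (R.matching.edgeSet.ncard : ℝ) < ε₁ * n →
      -- few jobs are forced into a half
      (R.WhalfAB.ncard : ℝ) ≤ ε₂ * n → (R.WhalfCD.ncard : ℝ) ≤ ε₂ * n →
      -- none of the four sets is much larger than a half
      (R.PA.ncard : ℝ) ≤ (1 / 2 + ε₃) * n → (R.PnotA.ncard : ℝ) ≤ (1 / 2 + ε₃) * n →
      (R.PnotD.ncard : ℝ) ≤ (1 / 2 + ε₃) * n → (R.PD.ncard : ℝ) ≤ (1 / 2 + ε₃) * n →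
      -- none of the four counts is much smaller than a quarter
      (∀ σ, R.Feasible σ → (1 / 4 - ε₄) * n ≤ (Sched.Branch.count R.PA 0 σ : ℝ)) →
      (1 / 4 - ε₄) * n ≤ (R.pB : ℝ) →
      (1 / 4 - ε₄) * n ≤ (R.pC : ℝ) →
      (∀ σ, R.Feasible σ → (1 / 4 - ε₄) * n ≤ (Sched.Branch.count R.PD 3 σ : ℝ)) →
      ∃ (s : RealRAM.State) (k : ℕ), RealRAM.Runs p R.input s k ∧ R.Answers s ∧
        (k : ℝ) ≤ (n.choose ⌊ε₄ * n⌋₊ : ℝ) ^ 2 * (2 : ℝ) ^ ((3 / 4 + ε₃) * n) * (n : ℝ) ^ c := by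
  refine ⟨Sched.Data.solveProg, 16000 * Sched.Data.solveProg.unit * 49 + 7, ?_⟩
  intro ε₁ ε₂ ε₃ ε₄ h₁ h₂ h₃ h₄ hε n R hR hM hAB hCD hPA hPnA hPnD hPD _ hpB hpC _
  have hn : 4 ≤ n := hR.ok.four_le
  have hn0 : (0 : ℝ) < n := by exact_mod_cast (by omega : 0 < n)
  have hquarter : ((n / 4 : ℕ) : ℝ) = n / 4 := Nat.cast_div hR.four_dvd (by norm_num)
  -- The lower bounds on p^B and p^C become upper bounds for the number of exceptional jobs.
  have hlim : ∀ p : ℕ, (1 / 4 - ε₄) * n ≤ (p : ℝ) → n / 4 - p ≤ ⌊ε₄ * n⌋₊ := fun p hp => by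
    refine Nat.le_floor ?_
    rcases le_total (n / 4) p with h | h
    · rw [Nat.sub_eq_zero_of_le h, Nat.cast_zero]; positivity
    · rw [Nat.cast_sub h, hquarter]; linarith
  -- Since ε₄ < 1/4, the binomial coefficient lies in the increasing range.
  have hK : 2 * ⌊ε₄ * n⌋₊ ≤ n := by
    have h : (⌊ε₄ * n⌋₊ : ℝ) ≤ ε₄ * n := Nat.floor_le (by positivity)
    have h' : ε₄ * n ≤ 1 / 4 * n := by gcongr; linarith
    have : (2 : ℝ) * (⌊ε₄ * n⌋₊ : ℝ) ≤ n := by linarith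
    exact_mod_cast this
  -- Matching and W_half contribute at most (2ε₁ + 2ε₂)n < n/4 jobs; the 2 is for the first and the
  -- last job.
  have hF : R.data.fixedCard ≤ n / 4 + 2 := by
    rw [R.fixedCard_eq]
    have h : (R.Fixed.ncard : ℝ) ≤ 2 * R.matching.edgeSet.ncard + 2 + R.WhalfAB.ncard +
      R.WhalfCD.ncard := by exact_mod_cast hR.ncard_fixed_le
    have h' : (2 * ε₁ + 2 * ε₂ + ε₄) * n ≤ 1 / 4 * n := by gcongr
    have h'' : 0 < ε₄ * n := by positivity
    have : (R.Fixed.ncard : ℝ) ≤ ((n / 4 + 2 : ℕ) : ℝ) := by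
      rw [Nat.cast_add, hquarter]; push_cast; linarith
    exact_mod_cast this
  have hH : (⌊(1 / 2 + ε₃) * n⌋₊ : ℝ) ≤ (1 / 2 + ε₃) * n := Nat.floor_le (by positivity)
  obtain ⟨N, hL, hN, hrounds⟩ := Sched.Data.length_families hR.ok (hlim _ hpB) (hlim _ hpC) hK hF
    (Sched.Branch.freeCard_PA.trans_le (Nat.le_floor hPA))
    (Sched.Branch.freeCard_PnotA.trans_le (Nat.le_floor hPnA))
    (Sched.Branch.freeCard_PnotD.trans_le (Nat.le_floor hPnD))
    (Sched.Branch.freeCard_PD.trans_le (Nat.le_floor hPD))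
  obtain ⟨s, k, hrun, hk, -, hs⟩ := Sched.Data.solveProg_exec hR.ok R.exists_last R.input_data
    hL hN hrounds hR.input_bdd
  exact ⟨s, k, hrun, hR.answers hs, Sched.Branch.time_le hn hR.four_dvd hK hH hk⟩
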